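/- Let $\alpha=e^{2\pi i/3}$, let $\Omega_1=\{0<\arg k<\pi/3\}$ and $\Omega_2=\{2\pi/3<\arg k<\pi\}$ (the components of $\{\operatorname{Re}(ik^3)<0\}$ in the upper half-plane), with positively oriented boundaries, and for a function $f$ put $F[f](w,t)=\int_0^t e^{ws}f(s)\,ds$. The parts of the solution of $u_t=u_{xxx}$ ($x,t>0$) that come from the boundary data $u(0,t)=f_0(t)$ and $u_x(0,t)=f_1(t)$ are $$I_{f_0}(x,t)=\frac{1-\alpha}{2\pi}\int_{\partial\Omega_1}e^{ikx-ik^3t}k^2F[f_0](ik^3,t)\,dk+\frac{1-\alpha^2}{2\pi}\int_{\partial\Omega_2}e^{ikx-ik^3t}k^2F[f_0](ik^3,t)\,dk,$$ $$I_{f_1}(x,t)=\frac{1-\alpha^2}{2\pi i}\int_{\partial\Omega_1}e^{ikx-ik^3t}kF[f_1](ik^3,t)\,dk+\frac{1-\alpha}{2\pi i}\int_{\partial\Omega_2}e^{ikx-ik^3t}kF[f_1](ik^3,t)\,dk,$$ where the contour integrals are improper, i.e. limits as $R\to\infty$ of the integrals over the part of the contour in $|k|\le R$. For $0<\mu<1$,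 $n\ge 1$ and $t>0$ put $$B_{\mu,n}[f](t)=\frac{\sqrt3\,\Gamma(\mu)}{2\pi}\left[\sum_{m=1}^n\frac{(-1)^{n-m}\Gamma(n-m+\mu)}{t^{\,n-m+\mu}\,\Gamma(\mu)}f^{(m-1)}(0)+\int_0^t\frac{f^{(n)}(s)}{(t-s)^{\mu}}\,ds\right],$$ and define $$a_{3n}(t)=\frac{f_0^{(n)}(t)}{(3n)!}\ (n\ge0),\qquad a_{3n-2}(t)=0,\quad a_{3n-1}(t)=-\frac{B_{2/3,n}[f_0](t)}{(3n-1)!}\ (n\ge1),$$ $$b_{3n}(t)=0,\quad b_{3n+1}(t)=\frac{f_1^{(n)}(t)}{(3n+1)!}\ (n\ge0),\qquad b_{3n-1}(t)=-\frac{B_{1/3,n}[f_1](t)}{(3n-1)!}\ (n\ge1).$$ **Theorem.** Let $r>0$, $T>0$ and $\mathcal D=\{t\in\mathbb C:\operatorname{dist}(t,[0,T])\le r\}$. Suppose that $f_0$ (resp. $f_1$) is analytic on (a neighbourhood of each point of) $\mathcal D$. Then: 1. For all $x>0$ and $0\le t\le T$ the contour integrals defining $I_{f_0}(x,t)$ (resp.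 $I_{f_1}(x,t)$) converge, and for each $t\in[0,T]$ the function $x\mapsto I_{f_0}(x,t)$ (resp. $x\mapsto I_{f_1}(x,t)$) is real-analytic on $(0,\infty)$. 2. For every $0<t\le T$ the series $\sum_{n\ge0}a_n(t)x^n$ (resp. $\sum_{n\ge0}b_n(t)x^n$) converges for all $x\in\mathbb C$ to an entire function of $x$, and for every $x>0$ its sum equals $I_{f_0}(x,t)$ (resp. $I_{f_1}(x,t)$). 3. For every $0<t\le T$ and $n\ge1$, $a_{3n-1}(t)=-f_0^{(n-1/3)}(t)/(3n-1)!$ (resp. $b_{3n-1}(t)=-f_1^{(n-2/3)}(t)/(3n-1)!$), where for $0<\nu<1$ the Riemann–Liouville derivative of order $n-\nu$ is $$f^{(n-\nu)}(t)=\frac{d^n}{dt^n}\left[\frac1{\Gamma(\nu)}\int_0^t(t-s)^{\nu-1}f(s)\,ds\right],$$ the function in brackets being $n$ times continuously differentiable near $t$. -/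

import Mathlib

open Filter Topology

noncomputable section

namespace KdV

/-- The primitive cube root of unity `α = exp (2πi/3)`. -/
def α : ℂ := Complex.exp (2 * (Real.pi : ℂ) * Complex.I / 3)

/-- The closed `r`-neighbourhood `{z : ℂ | dist (z, [0, T]) ≤ r}` of the segment `[0, T]`. -/
def nbhd (T r : ℝ) : Set ℂ :=
  {z : ℂ | Metric.infDist z ((fun s : ℝ => (s : ℂ)) '' Set.Icc (0 : ℝ) T) ≤ r}

/-- The time transform `F (w, t) = ∫₀ᵗ e^{w s} f(s) ds`, to be used with `w = i k³`. -/
def timeTransform (f : ℂ → ℂ) (w : ℂ) (t : ℝ) : ℂ :=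
  ∫ s in (0 : ℝ)..t, Complex.exp (w * (s : ℂ)) * f (s : ℂ)

/-- The integral of `g` along the part of the ray `arg k = θ` with `|k| ≤ R`, from `0` outwards. -/
def raySegmentIntegral (θ : ℝ) (g : ℂ → ℂ) (R : ℝ) : ℂ :=
  ∫ ρ in (0 : ℝ)..R,
    g ((ρ : ℂ) * Complex.exp ((θ : ℂ) * Complex.I)) * Complex.exp ((θ : ℂ) * Complex.I)

/-- The integral of `g` along the part in `|k| ≤ R` of the positively oriented boundary of the
sector `θ₁ < arg k < θ₂`: in along the ray `arg k = θ₂`, out along the ray `arg k = θ₁`. -/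
def sectorBoundaryPartial (θ₁ θ₂ : ℝ) (g : ℂ → ℂ) (R : ℝ) : ℂ :=
  raySegmentIntegral θ₁ g R - raySegmentIntegral θ₂ g R

/-- The (improper) integral of `g` along the boundary of the sector converges. -/
def SectorBoundaryConverges (θ₁ θ₂ : ℝ) (g : ℂ → ℂ) : Prop :=
  ∃ L : ℂ, Tendsto (sectorBoundaryPartial θ₁ θ₂ g) atTop (𝓝 L)

/-- The (improper) integral of `g` along the positively oriented boundary of the sector. -/
def sectorBoundaryIntegral (θ₁ θ₂ : ℝ) (g : ℂ → ℂ) : ℂ :=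
  limUnder atTop (sectorBoundaryPartial θ₁ θ₂ g)

/-- The boundary integral over `∂Ω₁`, where `Ω₁ = {0 < arg k < π/3}`. The sectors `Ω₁`, `Ω₂` are
the two components of `{Re (i k³) < 0}` in the upper half plane, and `Ω₂ = α Ω₁`. -/
def integralΩ₁ (g : ℂ → ℂ) : ℂ := sectorBoundaryIntegral 0 (Real.pi / 3) g

/-- The boundary integral over `∂Ω₂`, where `Ω₂ = {2π/3 < arg k < π}`. -/
def integralΩ₂ (g : ℂ → ℂ) : ℂ := sectorBoundaryIntegral (2 * Real.pi / 3) Real.pi g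

/-- Convergence of the boundary integrals over both `∂Ω₁` and `∂Ω₂`. -/
def ConvergesΩ (g : ℂ → ℂ) : Prop :=
  SectorBoundaryConverges 0 (Real.pi / 3) g ∧
    SectorBoundaryConverges (2 * Real.pi / 3) Real.pi g

/-- The integrand `e^{ikx - ik³t} k^p F(ik³, t)`. -/
def integrand (p : ℕ) (f : ℂ → ℂ) (x t : ℝ) (k : ℂ) : ℂ :=
  Complex.exp (Complex.I * k * (x : ℂ) - Complex.I * k ^ 3 * (t : ℂ)) * k ^ p *
    timeTransform f (Complex.I * k ^ 3) t

/-- The part `I_{f₀}(x,t)` of the solution coming from `u(0,t) = f₀(t)`. -/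
def If₀ (f₀ : ℂ → ℂ) (x t : ℝ) : ℂ :=
  (1 - α) / (2 * (Real.pi : ℂ)) * integralΩ₁ (integrand 2 f₀ x t) +
    (1 - α ^ 2) / (2 * (Real.pi : ℂ)) * integralΩ₂ (integrand 2 f₀ x t)

/-- The part `I_{f₁}(x,t)` of the solution coming from `uₓ(0,t) = f₁(t)`. -/
def If₁ (f₁ : ℂ → ℂ) (x t : ℝ) : ℂ :=
  (1 - α ^ 2) / (2 * (Real.pi : ℂ) * Complex.I) * integralΩ₁ (integrand 1 f₁ x t) +
    (1 - α) / (2 * (Real.pi : ℂ) * Complex.I) * integralΩ₂ (integrand 1 f₁ x t)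

/-- The Riemann–Liouville integral of order `ν > 0`:
`(J^ν f)(t) = Γ(ν)⁻¹ ∫₀ᵗ (t - s)^{ν - 1} f(s) ds`. -/
def rlIntegral (ν : ℝ) (f : ℂ → ℂ) (t : ℝ) : ℂ :=
  ((1 / Real.Gamma ν : ℝ) : ℂ) *
    ∫ s in (0 : ℝ)..t, (((t - s) ^ (ν - 1) : ℝ) : ℂ) * f (s : ℂ)

/-- The Riemann–Liouville derivative `f^{(n - ν)}` of order `n - ν`, for `0 < ν < 1 ≤ n`: the
`n`-th derivative of `J^ν f`. -/
def rlDeriv (n : ℕ) (ν : ℝ) (f : ℂ → ℂ) (t : ℝ) : ℂ :=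
  iteratedDeriv n (rlIntegral ν f) t

/-- The expression `(√3 Γ(μ) / 2π) · [ ∑_{m=1}^n (-1)^{n-m} Γ(n-m+μ) / (t^{n-m+μ} Γ(μ)) f^{(m-1)}(0)
+ ∫₀ᵗ f^{(n)}(s) / (t-s)^μ ds ]`. -/
def fracBracket (μ : ℝ) (n : ℕ) (f : ℂ → ℂ) (t : ℝ) : ℂ :=
  ((Real.sqrt 3 * Real.Gamma μ / (2 * Real.pi) : ℝ) : ℂ) *
    ((∑ m ∈ Finset.Icc 1 n,
        (((-1) ^ (n - m) * Real.Gamma (((n - m : ℕ) : ℝ) + μ) /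
          (t ^ (((n - m : ℕ) : ℝ) + μ) * Real.Gamma μ) : ℝ) : ℂ) * iteratedDeriv (m - 1) f 0) +
      ∫ s in (0 : ℝ)..t, iteratedDeriv n f (s : ℂ) / (((t - s) ^ μ : ℝ) : ℂ))

/-- The coefficients `aⱼ(t)` of the series of `I_{f₀}`: `a_{3n} = f₀^{(n)}(t) / (3n)!`,
`a_{3n-2} = 0`, and `a_{3n-1} = - fracBracket (2/3) n f₀ t / (3n-1)!`. -/
def aCoeff (f₀ : ℂ → ℂ) (t : ℝ) (j : ℕ) : ℂ :=
  if j % 3 = 0 then iteratedDeriv (j / 3) f₀ (t : ℂ) / (j.factorial : ℂ)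
  else if j % 3 = 2 then -fracBracket (2 / 3) ((j + 1) / 3) f₀ t / (j.factorial : ℂ)
  else 0

/-- The coefficients `bⱼ(t)` of the series of `I_{f₁}`: `b_{3n} = 0`,
`b_{3n+1} = f₁^{(n)}(t) / (3n+1)!`, and `b_{3n-1} = - fracBracket (1/3) n f₁ t / (3n-1)!`. -/
def bCoeff (f₁ : ℂ → ℂ) (t : ℝ) (j : ℕ) : ℂ :=
  if j % 3 = 1 then iteratedDeriv (j / 3) f₁ (t : ℂ) / (j.factorial : ℂ)
  else if j % 3 = 2 then -fracBracket (1 / 3) ((j + 1) / 3) f₁ t / (j.factorial : ℂ)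
  else 0

end KdV

end

/-! Both integrals are treated at once, with `j = 0` for `f₀` and `j = 1` for `f₁`; put ν = (j +
1)/3 (`fracOrder`).

Constant datum 1. Here `F` is elementary and the integrand becomes -i (e^{ikx} - e^{ikx - ik³τ}) /
k^{j+1}. The part e^{ikx} is closed inside each sector. The part e^{ikx - ik³τ} is rotated by
Cauchy's theorem to the directions -π/6, π/2, 7π/6, where e^{-ik³τ} = e^{-ρ³τ}. The arcs around 0
add up to x^j. On the rotated rays e^{ikx} is expanded in powers of x; the weights kill all powers
except x^{3n+2}, and Gamma integrals remain. The result is the self-similar series `stepPrim j 0 x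
τ` (`tendsto_stepRay`, `tendsto_unitResponse`).

General datum. Integration by parts in time gives the response P(t) f(0) + ∫ P(τ) f'(t - τ) dτ with
P = `stepPrim j 0 x` (`boundary_integrals_eq`). Exchanging this with the limit R → ∞ needs
convergence of the truncated integrals uniformly in τ ≥ 0. For j = 0 on the real rays this is
conditional, and the stationary point escapes to infinity as τ → 0; a van der Corput bound covers it
(`norm_integral_airyPhase_div_le`).

Expansion. Let P_M be the M-fold antiderivative of P in x. Then ∂_τ P_{M+3} equals P_M minus the
monomial x^{M+j}/(M+j)! minus a multiple of τ^{ν-1} x^{M+2}. Integrating by parts in τ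
(`integral_stepPrim_mul_eq`) therefore splits off a value of a derivative of f at t, an Abel
integral and initial values, and leaves the same expression with M + 3 and one more derivative of f.
The bound |P_M| ≤ B x^M/M!, uniform in τ, and Cauchy's estimates n! C/rⁿ for the derivatives send
the remainder to 0 (`tendsto_remainder`). All the series converge absolutely, so they may be
regrouped into powers of x (`remainder_zero_eq`, `hasSum_seriesCoeff`).

Fractional derivatives. Differentiating an Abel integral produces exactly the next initial term, so
the derivative of `fracBracket` of index n is the one of index n + 1. By the reflection formula the
one of index 0 is the Riemann–Liouville integral (`contDiffAt_rlIntegral_and_rlDeriv_eq`). -/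

noncomputable section

namespace KdV

open MeasureTheory intervalIntegral

/-! ### Oscillatory integrals: a van der Corput bound uniform in time -/

/-- The Airy oscillation `e^{i (ρ x - ρ³ τ)}`. -/
def airyPhase (x τ ρ : ℝ) : ℂ := Complex.exp (((ρ * x - ρ ^ 3 * τ : ℝ) : ℂ) * Complex.I)

lemma norm_airyPhase (x τ ρ : ℝ) : ‖airyPhase x τ ρ‖ = 1 := Complex.norm_exp_ofReal_mul_I _

lemma hasDerivAt_airyPhase (x τ ρ : ℝ) :
    HasDerivAt (airyPhase x τ) (airyPhase x τ ρ * (((x - 3 * ρ ^ 2 * τ : ℝ) : ℂ) * Complex.I)) ρ := by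
  have h : HasDerivAt (fun ρ : ℝ => ρ * x - ρ ^ 3 * τ) (x - 3 * ρ ^ 2 * τ) ρ := by
    have := ((hasDerivAt_id' ρ).mul_const x).fun_sub ((hasDerivAt_pow 3 ρ).mul_const τ)
    simpa using this
  exact (h.ofReal_comp.mul_const Complex.I).cexp

lemma continuous_airyPhase (x τ : ℝ) : Continuous (airyPhase x τ) := by
  unfold airyPhase; fun_prop

lemma continuousOn_airyPhase_div (x τ : ℝ) {a b : ℝ} (ha : 0 < a) :
    ContinuousOn (fun ρ : ℝ => airyPhase x τ ρ / ρ) (Set.Icc a b) := by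
  refine (continuous_airyPhase x τ).continuousOn.div Complex.continuous_ofReal.continuousOn ?_
  intro ρ hρ
  exact_mod_cast (ha.trans_le hρ.1).ne'

/-- Integration by parts away from the stationary point of the phase. -/
lemma norm_integral_airyPhase_div_le_of_nonstationary {x τ a b c : ℝ} (hτ : 0 ≤ τ) (ha : 0 < a)
    (hab : a ≤ b) (hc : 0 < c)
    (hφ : ∀ ρ ∈ Set.Icc a b, c ≤ |x - 3 * ρ ^ 2 * τ|) :
    ‖∫ ρ in a..b, airyPhase x τ ρ / (ρ : ℂ)‖ ≤ 5 / (a * c) := by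
  have hne : ∀ ρ ∈ Set.Icc a b, x - 3 * ρ ^ 2 * τ ≠ 0 := fun ρ hρ h => by
    have := hφ ρ hρ
    rw [h, abs_zero] at this
    linarith
  have hpos : ∀ ρ ∈ Set.Icc a b, 0 < ρ := fun ρ hρ => ha.trans_le hρ.1
  have hu : Set.uIcc a b = Set.Icc a b := Set.uIcc_of_le hab
  set D : ℝ → ℝ := fun ρ => x - 3 * ρ ^ 2 * τ with hD
  have hDd : ∀ ρ, HasDerivAt D (-(6 * ρ * τ)) ρ := fun ρ => by
    have := (((hasDerivAt_pow 2 ρ).const_mul 3).mul_const τ).const_sub x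
    refine this.congr_deriv ?_
    push_cast; ring
  set q' : ℝ → ℝ := fun ρ => -(D ρ + ρ * -(6 * ρ * τ)) / (ρ * D ρ) ^ 2 with hq'
  have hq : ∀ ρ ∈ Set.Icc a b, HasDerivAt (fun ρ => (ρ * D ρ)⁻¹) (q' ρ) ρ := fun ρ hρ => by
    have h1 := (hasDerivAt_id' ρ).fun_mul (hDd ρ)
    have := h1.fun_inv (mul_ne_zero (hpos ρ hρ).ne' (hne ρ hρ))
    rwa [one_mul] at this
  have hDc : Continuous D := by fun_prop
  have hq'c : ContinuousOn q' (Set.Icc a b) := by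
    refine ContinuousOn.div (by fun_prop) (by fun_prop) fun ρ hρ => ?_
    exact pow_ne_zero _ (mul_ne_zero (hpos ρ hρ).ne' (hne ρ hρ))
  have hibp := intervalIntegral.integral_mul_deriv_eq_deriv_mul
    (u := fun ρ : ℝ => (((ρ * D ρ)⁻¹ : ℝ) : ℂ)) (u' := fun ρ => (q' ρ : ℂ)) (v := airyPhase x τ)
    (v' := fun ρ => airyPhase x τ ρ * (((x - 3 * ρ ^ 2 * τ : ℝ) : ℂ) * Complex.I)) (a := a) (b := b)
    (fun ρ hρ => (hq ρ (hu ▸ hρ)).ofReal_comp) (fun ρ _ => hasDerivAt_airyPhase x τ ρ)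
    (ContinuousOn.intervalIntegrable (by
      rw [hu]; exact Complex.continuous_ofReal.comp_continuousOn hq'c))
    (Continuous.intervalIntegrable (by have := continuous_airyPhase x τ; fun_prop) _ _)
  have hL : ∫ ρ in a..b, (((ρ * D ρ)⁻¹ : ℝ) : ℂ) *
      (airyPhase x τ ρ * (((x - 3 * ρ ^ 2 * τ : ℝ) : ℂ) * Complex.I)) =
      (∫ ρ in a..b, airyPhase x τ ρ / (ρ : ℂ)) * Complex.I := by
    rw [← intervalIntegral.integral_mul_const]
    refine intervalIntegral.integral_congr fun ρ hρ => ?_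
    rw [hu] at hρ
    have h1 : (ρ : ℂ) ≠ 0 := by exact_mod_cast (hpos ρ hρ).ne'
    have h2 : ((D ρ : ℝ) : ℂ) ≠ 0 := by exact_mod_cast hne ρ hρ
    have h3 : (x - 3 * ρ ^ 2 * τ : ℝ) = D ρ := rfl
    simp only [h3, Complex.ofReal_inv, Complex.ofReal_mul]
    field_simp
  rw [hL] at hibp
  have hN : ‖∫ ρ in a..b, airyPhase x τ ρ / (ρ : ℂ)‖ =
      ‖(∫ ρ in a..b, airyPhase x τ ρ / (ρ : ℂ)) * Complex.I‖ := by simp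
  rw [hN, hibp]
  have hend : ∀ ρ ∈ Set.Icc a b, ‖(((ρ * D ρ)⁻¹ : ℝ) : ℂ) * airyPhase x τ ρ‖ ≤ 1 / (a * c) := by
    intro ρ hρ
    rw [norm_mul, norm_airyPhase, mul_one, Complex.norm_real, Real.norm_eq_abs, abs_inv, abs_mul,
      abs_of_pos (hpos ρ hρ), ← one_div]
    exact one_div_le_one_div_of_le (by positivity) (mul_le_mul hρ.1 (hφ ρ hρ) hc.le (hpos ρ hρ).le)
  -- A primitive of a majorant of |q'|, where q = 1/(ρ D). Since τ ≥ 0, D' keeps its sign, so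
  -- |D'|/D² is itself an exact derivative. This contributes at most 3/(ac), and the two boundary
  -- terms contribute 2/(ac).
  set H : ℝ → ℝ := fun ρ => -(c⁻¹ * ρ⁻¹) + a⁻¹ * (D ρ)⁻¹ with hH
  have hHd : ∀ ρ ∈ Set.Icc a b,
      HasDerivAt H (c⁻¹ * (ρ ^ 2)⁻¹ + a⁻¹ * (6 * ρ * τ / (D ρ) ^ 2)) ρ := fun ρ hρ => by
    have h1 := ((hasDerivAt_inv (hpos ρ hρ).ne').const_mul c⁻¹).neg
    have h2 := ((hDd ρ).inv (hne ρ hρ)).const_mul a⁻¹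
    refine (h1.add h2).congr_deriv ?_
    simp only [neg_neg, div_eq_mul_inv, mul_neg]
  have hHc : ContinuousOn (fun ρ => c⁻¹ * (ρ ^ 2)⁻¹ + a⁻¹ * (6 * ρ * τ / (D ρ) ^ 2))
      (Set.Icc a b) := by
    refine ContinuousOn.add (continuousOn_const.mul (ContinuousOn.inv₀ (by fun_prop) ?_))
      (continuousOn_const.mul (ContinuousOn.div (by fun_prop) (by fun_prop) ?_))
    · exact fun ρ hρ => pow_ne_zero _ (hpos ρ hρ).ne'
    · exact fun ρ hρ => pow_ne_zero _ (hne ρ hρ)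
  have hHi : IntervalIntegrable (fun ρ => c⁻¹ * (ρ ^ 2)⁻¹ + a⁻¹ * (6 * ρ * τ / (D ρ) ^ 2))
      MeasureTheory.volume a b := ContinuousOn.intervalIntegrable (by rwa [hu])
  have hq'b : ∀ ρ ∈ Set.Icc a b, |q' ρ| ≤ c⁻¹ * (ρ ^ 2)⁻¹ + a⁻¹ * (6 * ρ * τ / (D ρ) ^ 2) := by
    intro ρ hρ
    have hρ0 := hpos ρ hρ
    have hD0 := hne ρ hρ
    have hDp : 0 < |D ρ| := abs_pos.mpr hD0
    have e : q' ρ = -((ρ ^ 2)⁻¹ * (D ρ)⁻¹) + ρ⁻¹ * (6 * ρ * τ / (D ρ) ^ 2) := by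
      simp only [hq']
      field_simp [show D ρ ≠ 0 from hD0]
      ring
    rw [e]
    refine (abs_add_le _ _).trans (add_le_add ?_ ?_)
    · rw [abs_neg, abs_mul, abs_inv, abs_inv, abs_of_pos (by positivity : 0 < ρ ^ 2), mul_comm]
      gcongr
      exact hφ ρ hρ
    · rw [abs_of_nonneg (by positivity)]
      gcongr
      exact hρ.1
  have hI : ‖∫ ρ in a..b, (q' ρ : ℂ) * airyPhase x τ ρ‖ ≤ 3 / (a * c) := by
    refine (intervalIntegral.norm_integral_le_of_norm_le hab (Filter.Eventually.of_forall
      fun ρ hρ => ?_) hHi).trans ?_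
    · rw [norm_mul, norm_airyPhase, mul_one, Complex.norm_real]
      exact hq'b ρ (Set.Ioc_subset_Icc_self hρ)
    · rw [intervalIntegral.integral_eq_sub_of_hasDerivAt (fun ρ hρ => hHd ρ (hu ▸ hρ)) hHi]
      have hb : ∀ ρ ∈ Set.Icc a b, |(D ρ)⁻¹| ≤ c⁻¹ := fun ρ hρ => by
        rw [abs_inv]
        exact inv_anti₀ hc (hφ ρ hρ)
      have h1 := abs_le.mp (hb a ⟨le_rfl, hab⟩)
      have h2 := abs_le.mp (hb b ⟨hab, le_rfl⟩)
      have hb0 : 0 < b := ha.trans_le hab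
      have e : 3 / (a * c) = c⁻¹ * a⁻¹ + a⁻¹ * (2 * c⁻¹) := by field_simp; norm_num
      rw [e]
      have h3 : a⁻¹ * ((D b)⁻¹ - (D a)⁻¹) ≤ a⁻¹ * (2 * c⁻¹) := by
        gcongr; linarith [h1.1, h2.2]
      have h4 : 0 < c⁻¹ * b⁻¹ := by positivity
      simp only [hH]
      linarith
  have hb1 := hend b ⟨hab, le_rfl⟩
  have ha1 := hend a ⟨le_rfl, hab⟩
  have e : 5 / (a * c) = 1 / (a * c) + 1 / (a * c) + 3 / (a * c) := by ring
  rw [e]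
  exact (norm_sub_le _ _).trans (add_le_add ((norm_sub_le _ _).trans (add_le_add hb1 ha1)) hI)

lemma norm_integral_airyPhase_div_le_sub_div {x τ a b : ℝ} (ha : 0 < a) (hab : a ≤ b) :
    ‖∫ ρ in a..b, airyPhase x τ ρ / (ρ : ℂ)‖ ≤ (b - a) / a := by
  have := intervalIntegral.norm_integral_le_of_norm_le_const (a := a) (b := b) (C := 1 / a)
    (f := fun ρ : ℝ => airyPhase x τ ρ / (ρ : ℂ)) (fun ρ hρ => by
      rw [Set.uIoc_of_le hab] at hρ
      have h0 : 0 < ρ := ha.trans hρ.1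
      rw [norm_div, norm_airyPhase, Complex.norm_real, Real.norm_eq_abs, abs_of_pos h0]
      exact one_div_le_one_div_of_le ha hρ.1.le)
  rwa [abs_of_nonneg (sub_nonneg.mpr hab), one_div_mul_eq_div] at this

/-- The line is cut around the stationary point √(x/(3τ)). Outside the window [l, (1 + 2ε) l] the
phase derivative is at least εx in absolute value, so integration by parts applies. Inside, the
trivial bound length/left end gives 2ε. The cut points are clamped to [A, R], since the window may
lie partly or wholly outside. -/
lemma norm_integral_airyPhase_div_le_aux {x τ A R ε : ℝ} (hx : 0 < x) (hτ : 0 ≤ τ) (hA : 0 < A)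
    (hAR : A ≤ R) (hε : 0 < ε) (hε' : ε ≤ 1 / 2) :
    ‖∫ ρ in A..R, airyPhase x τ ρ / (ρ : ℂ)‖ ≤ 10 / (A * (ε * x)) + 2 * ε := by
  have hεx : 0 < ε * x := by positivity
  rcases hτ.eq_or_lt with rfl | hτ
  · refine (norm_integral_airyPhase_div_le_of_nonstationary le_rfl hA hAR hεx ?_).trans ?_
    · intro ρ _
      rw [mul_zero, sub_zero, abs_of_pos hx]
      nlinarith
    · have : 5 / (A * (ε * x)) ≤ 10 / (A * (ε * x)) := by gcongr; norm_num
      linarith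
  set l : ℝ := Real.sqrt (x * (1 - ε) / (3 * τ)) with hl
  have hlsq : 3 * l ^ 2 * τ = x * (1 - ε) := by
    rw [hl, Real.sq_sqrt (by apply div_nonneg <;> nlinarith)]
    field_simp
  have hl0 : 0 < l := Real.sqrt_pos.mpr (by apply div_pos <;> nlinarith)
  set u : ℝ := (1 + 2 * ε) * l with hu
  have hlu : l ≤ u := by nlinarith
  have husq : x * (1 + ε) ≤ 3 * u ^ 2 * τ := by
    have : 3 * u ^ 2 * τ = (1 + 2 * ε) ^ 2 * (x * (1 - ε)) := by rw [← hlsq, hu]; ring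
    rw [this]
    nlinarith [mul_nonneg hx.le (mul_nonneg hε.le (by nlinarith : (0:ℝ) ≤ 2 - 4 * ε ^ 2))]
  set a₁ : ℝ := max A (min l R) with ha₁
  set b₁ : ℝ := max A (min u R) with hb₁
  have hAa : A ≤ a₁ := le_max_left _ _
  have hab : a₁ ≤ b₁ := max_le_max le_rfl (min_le_min hlu le_rfl)
  have hbR : b₁ ≤ R := max_le hAR (min_le_right _ _)
  have ha0 : 0 < a₁ := hA.trans_le hAa
  have hb0 : 0 < b₁ := ha0.trans_le hab
  have hint : ∀ a b : ℝ, 0 < a → a ≤ b →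
      IntervalIntegrable (fun ρ : ℝ => airyPhase x τ ρ / (ρ : ℂ)) MeasureTheory.volume a b :=
    fun a b h0 h => ContinuousOn.intervalIntegrable
      (by rw [Set.uIcc_of_le h]; exact continuousOn_airyPhase_div x τ h0)
  have hAe : 0 ≤ 5 / (A * (ε * x)) := by positivity
  have h1 : ‖∫ ρ in A..a₁, airyPhase x τ ρ / (ρ : ℂ)‖ ≤ 5 / (A * (ε * x)) := by
    rcases hAa.eq_or_lt with h | h
    · rw [← h, intervalIntegral.integral_same, norm_zero]; exact hAe
    · refine norm_integral_airyPhase_div_le_of_nonstationary hτ.le hA hAa hεx fun ρ hρ => ?_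
      have hal : a₁ ≤ l := by
        rcases le_total A (min l R) with h' | h'
        · rw [ha₁, max_eq_right h']; exact min_le_left _ _
        · rw [ha₁, max_eq_left h'] at h; exact absurd h (lt_irrefl _)
      have h0 : 0 < ρ := hA.trans_le hρ.1
      have h2 : ρ ^ 2 ≤ l ^ 2 := pow_le_pow_left₀ h0.le (hρ.2.trans hal) 2
      refine le_trans ?_ (le_abs_self _)
      nlinarith
  have h3 : ‖∫ ρ in b₁..R, airyPhase x τ ρ / (ρ : ℂ)‖ ≤ 5 / (A * (ε * x)) := by
    rcases hbR.eq_or_lt with h | h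
    · rw [← h, intervalIntegral.integral_same, norm_zero]; exact hAe
    · refine (norm_integral_airyPhase_div_le_of_nonstationary hτ.le hb0 hbR hεx fun ρ hρ => ?_).trans
        ?_
      · have hul : u ≤ b₁ := by
          rcases le_total u R with h' | h'
          · rw [hb₁, min_eq_left h']; exact le_max_right _ _
          · rw [hb₁, min_eq_right h', max_eq_right hAR] at h; exact absurd h (lt_irrefl _)
        have h2 : u ^ 2 ≤ ρ ^ 2 := pow_le_pow_left₀ (hl0.le.trans hlu) (hul.trans hρ.1) 2
        refine le_trans ?_ (neg_le_abs _)
        nlinarith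
      · gcongr
        exact hAa.trans hab
  have h2 : ‖∫ ρ in a₁..b₁, airyPhase x τ ρ / (ρ : ℂ)‖ ≤ 2 * ε := by
    rcases hab.eq_or_lt with h | h
    · rw [← h, intervalIntegral.integral_same, norm_zero]; positivity
    · refine (norm_integral_airyPhase_div_le_sub_div ha0 hab).trans ?_
      have hlR : l ≤ R := by
        by_contra hcon
        push Not at hcon
        have e1 : a₁ = R := by rw [ha₁, min_eq_right hcon.le, max_eq_right hAR]
        linarith
      have hal : l ≤ a₁ := by rw [ha₁, min_eq_left hlR]; exact le_max_right _ _
      have hbu : b₁ - a₁ ≤ u - l := by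
        rw [ha₁, hb₁, min_eq_left hlR]
        rcases le_total A l with h' | h'
        · rw [max_eq_right h']
          have : max A (min u R) ≤ u := max_le (h'.trans hlu) (min_le_left _ _)
          linarith
        · rw [max_eq_left h']
          rcases le_total A (min u R) with h'' | h''
          · rw [max_eq_right h'']
            linarith [min_le_left u R]
          · rw [max_eq_left h'']; linarith
      rw [div_le_iff₀ ha0]
      have : u - l = 2 * ε * l := by rw [hu]; ring
      nlinarith
  have hsplit : ∫ ρ in A..R, airyPhase x τ ρ / (ρ : ℂ) =
      (∫ ρ in A..a₁, airyPhase x τ ρ / (ρ : ℂ)) + (∫ ρ in a₁..b₁, airyPhase x τ ρ / (ρ : ℂ)) +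
        ∫ ρ in b₁..R, airyPhase x τ ρ / (ρ : ℂ) := by
    rw [intervalIntegral.integral_add_adjacent_intervals (hint _ _ hA hAa) (hint _ _ ha0 hab),
      intervalIntegral.integral_add_adjacent_intervals (hint _ _ hA (hAa.trans hab))
        (hint _ _ hb0 hbR)]
  rw [hsplit]
  refine norm_add₃_le.trans ?_
  have e : 10 / (A * (ε * x)) = 5 / (A * (ε * x)) + 5 / (A * (ε * x)) := by ring
  linarith

/-- A van der Corput estimate, uniform in `τ ≥ 0`. -/
lemma norm_integral_airyPhase_div_le {x τ A R : ℝ} (hx : 0 < x) (hτ : 0 ≤ τ) (hA : 1 ≤ A)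
    (hAR : A ≤ R) :
    ‖∫ ρ in A..R, airyPhase x τ ρ / (ρ : ℂ)‖ ≤ (20 / x + 1) / Real.sqrt A := by
  have hs : 1 ≤ Real.sqrt A := Real.one_le_sqrt.mpr hA
  have hs0 : 0 < Real.sqrt A := by linarith
  have hAs : A = Real.sqrt A * Real.sqrt A := (Real.mul_self_sqrt (by linarith)).symm
  -- This ε makes both error terms of order A^{-1/2}; A ≥ 1 ensures ε ≤ 1/2.
  refine (norm_integral_airyPhase_div_le_aux (ε := 1 / (2 * Real.sqrt A)) hx hτ (by linarith) hAR
    (by positivity) ?_).trans_eq ?_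
  · exact one_div_le_one_div_of_le (by norm_num) (by linarith)
  · generalize Real.sqrt A = s at *
    subst hAs
    field_simp
    ring

/-! ### Cauchy's theorem on truncated sectors -/

/-- The point `ρ e^{iθ}`. -/
def polar (ρ θ : ℝ) : ℂ := (ρ : ℂ) * Complex.exp ((θ : ℂ) * Complex.I)

lemma norm_polar {ρ : ℝ} (hρ : 0 ≤ ρ) (θ : ℝ) : ‖polar ρ θ‖ = ρ := by
  rw [polar, norm_mul, Complex.norm_exp_ofReal_mul_I, mul_one, Complex.norm_real,
    Real.norm_of_nonneg hρ]

lemma polar_ne_zero {ρ : ℝ} (hρ : ρ ≠ 0) (θ : ℝ) : polar ρ θ ≠ 0 :=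
  mul_ne_zero (by exact_mod_cast hρ) (Complex.exp_ne_zero _)

lemma continuous_polar_left (θ : ℝ) : Continuous fun ρ => polar ρ θ := by
  unfold polar; fun_prop

lemma continuous_polar_right (ρ : ℝ) : Continuous fun θ => polar ρ θ := by
  unfold polar; fun_prop

lemma polar_exp (u θ : ℝ) : polar (Real.exp u) θ = Complex.exp ((u : ℂ) + (θ : ℂ) * Complex.I) := by
  rw [polar, Complex.exp_add, Complex.ofReal_exp]

/-- The integral `∫ g(k) dk / k` along the part `δ ≤ |k| ≤ R` of the ray `arg k = θ`. -/
def rayLogIntegral (g : ℂ → ℂ) (θ δ R : ℝ) : ℂ := ∫ ρ in δ..R, g (polar ρ θ) / (ρ : ℂ)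

/-- The integral `-i ∫ g(k) dk / k` along the arc `|k| = R`, `θ₁ ≤ arg k ≤ θ₂`. -/
def arcIntegral (g : ℂ → ℂ) (θ₁ θ₂ R : ℝ) : ℂ := ∫ θ in θ₁..θ₂, g (polar R θ)

/-- The substitution ρ = e^u turns dρ/ρ into du, so a ray becomes a horizontal side of a rectangle.
-/
lemma integral_exp_polar {g : ℂ → ℂ} (hg : ∀ k ≠ 0, DifferentiableAt ℂ g k) (θ : ℝ) {δ R : ℝ}
    (hδ : 0 < δ) (hR : δ ≤ R) :
    ∫ u in Real.log δ..Real.log R, g (Complex.exp ((u : ℂ) + (θ : ℂ) * Complex.I)) =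
      rayLogIntegral g θ δ R := by
  have hu : Set.uIcc δ R = Set.Icc δ R := Set.uIcc_of_le hR
  have hG : Continuous fun u : ℝ => g (Complex.exp ((u : ℂ) + (θ : ℂ) * Complex.I)) := by
    refine continuous_iff_continuousAt.mpr fun u => ?_
    exact ContinuousAt.comp (f := fun u : ℝ => Complex.exp ((u : ℂ) + (θ : ℂ) * Complex.I))
      (hg _ (Complex.exp_ne_zero _)).continuousAt (by fun_prop)
  have := intervalIntegral.integral_deriv_smul_comp (f := Real.log) (f' := fun ρ => ρ⁻¹) (a := δ)
    (b := R) (g := fun u : ℝ => g (Complex.exp ((u : ℂ) + (θ : ℂ) * Complex.I)))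
    (fun ρ hρ => Real.hasDerivAt_log (hδ.trans_le (hu ▸ hρ).1).ne')
    (by
      rw [hu]
      exact ContinuousOn.inv₀ continuousOn_id fun ρ hρ => (hδ.trans_le hρ.1).ne') hG
  rw [← this, rayLogIntegral]
  refine integral_congr fun ρ hρ => ?_
  rw [hu] at hρ
  have h0 : 0 < ρ := hδ.trans_le hρ.1
  simp only [Function.comp]
  rw [← polar_exp, Real.exp_log h0, Complex.real_smul, Complex.ofReal_inv, div_eq_inv_mul]

/-- Cauchy's theorem for the truncated sector `δ ≤ |k| ≤ R`, `θ₁ ≤ arg k ≤ θ₂` and the form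
`g(k) dk / k`. -/
lemma rayLogIntegral_sub {g : ℂ → ℂ} (hg : ∀ k ≠ 0, DifferentiableAt ℂ g k) (θ₁ θ₂ : ℝ) {δ R : ℝ}
    (hδ : 0 < δ) (hR : δ ≤ R) :
    rayLogIntegral g θ₁ δ R - rayLogIntegral g θ₂ δ R =
      Complex.I * arcIntegral g θ₁ θ₂ δ - Complex.I * arcIntegral g θ₁ θ₂ R := by
  -- With k = e^ζ the form g dk/k becomes g(e^ζ) dζ, and the truncated sector is the image of a
  -- rectangle in ζ.
  have h := Complex.integral_boundary_rect_eq_zero_of_differentiableOn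
    (fun ζ => g (Complex.exp ζ)) (Real.log δ + θ₁ * Complex.I) (Real.log R + θ₂ * Complex.I)
    (fun ζ _ => ((hg _ (Complex.exp_ne_zero _)).comp ζ
      Complex.differentiableAt_exp).differentiableWithinAt)
  simp only [Complex.add_re, Complex.add_im, Complex.ofReal_re, Complex.ofReal_im, Complex.mul_re,
    Complex.mul_im, Complex.I_re, Complex.I_im, mul_zero, mul_one, sub_self, add_zero, zero_add,
    smul_eq_mul] at h
  rw [integral_exp_polar hg θ₁ hδ hR, integral_exp_polar hg θ₂ hδ hR] at h
  simp only [← polar_exp, Real.exp_log hδ, Real.exp_log (hδ.trans_le hR)] at h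
  rw [← sub_eq_zero, ← h, arcIntegral, arcIntegral]
  ring

/-- A fractional residue: a small arc sees only the value at 0, times its opening angle. -/
lemma tendsto_arcIntegral_zero {g : ℂ → ℂ} {L : ℂ} (hL : Tendsto g (𝓝[≠] 0) (𝓝 L))
    (θ₁ θ₂ : ℝ) (hg : ∀ k ≠ 0, DifferentiableAt ℂ g k) :
    Tendsto (fun δ => arcIntegral g θ₁ θ₂ δ) (𝓝[>] 0) (𝓝 (((θ₂ - θ₁ : ℝ) : ℂ) * L)) := by
  have e : ((θ₂ - θ₁ : ℝ) : ℂ) * L = ∫ _ in θ₁..θ₂, L := by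
    rw [intervalIntegral.integral_const, Complex.real_smul]
  rw [e]
  have hp : ∀ θ : ℝ, Tendsto (fun δ => polar δ θ) (𝓝[>] 0) (𝓝[≠] 0) := fun θ => by
    refine tendsto_nhdsWithin_iff.mpr ⟨?_, ?_⟩
    · have := (continuous_polar_left θ).tendsto 0
      simp only [polar, Complex.ofReal_zero, zero_mul] at this
      exact this.mono_left nhdsWithin_le_nhds
    · filter_upwards [self_mem_nhdsWithin] with δ hδ
      exact polar_ne_zero (ne_of_gt hδ) θ
  have hb := hL.norm.eventually_le_const (lt_add_one ‖L‖)
  rw [eventually_nhdsWithin_iff, Metric.eventually_nhds_iff] at hb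
  obtain ⟨ε, hε, hb⟩ := hb
  refine tendsto_integral_filter_of_dominated_convergence (fun _ => ‖L‖ + 1) ?_ ?_ ?_ ?_
  · filter_upwards [self_mem_nhdsWithin] with δ hδ
    refine Continuous.aestronglyMeasurable (continuous_iff_continuousAt.mpr fun θ => ?_)
    exact ContinuousAt.comp (f := fun θ => polar δ θ)
      (hg _ (polar_ne_zero (ne_of_gt hδ) θ)).continuousAt (continuous_polar_right δ).continuousAt
  · filter_upwards [self_mem_nhdsWithin, nhdsWithin_le_nhds (Iio_mem_nhds hε)] with δ hδ hδ'
    refine Eventually.of_forall fun θ _ => hb ?_ (polar_ne_zero (ne_of_gt hδ) θ)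
    rw [dist_zero_right, norm_polar (le_of_lt hδ)]
    exact hδ'
  · exact intervalIntegrable_const
  · exact Eventually.of_forall fun θ _ => hL.comp (hp θ)

/-! ### Decay of the wave exponentials on large arcs -/

/-- The exponential `e^{ikx - ik³τ}`. -/
def wave (x τ : ℝ) (k : ℂ) : ℂ := Complex.exp (Complex.I * k * x - Complex.I * k ^ 3 * τ)

/-- The quotient `(e^{ikx - ik³τ} - j) / kʲ`, for `j = 0` or `j = 1`. -/
def waveQuot (j : ℕ) (x τ : ℝ) (k : ℂ) : ℂ := (wave x τ k - j) / k ^ j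

/-- The limit of `waveQuot j x τ k` as `k → 0`. -/
def waveQuotZero (j : ℕ) (x : ℝ) : ℂ := (Complex.I * x) ^ j

lemma differentiable_wave (x τ : ℝ) : Differentiable ℂ (wave x τ) := by
  unfold wave; fun_prop

lemma differentiableAt_waveQuot (j : ℕ) (x τ : ℝ) {k : ℂ} (hk : k ≠ 0) :
    DifferentiableAt ℂ (waveQuot j x τ) k :=
  ((differentiable_wave x τ k).sub_const _).div (differentiableAt_id.pow j) (pow_ne_zero _ hk)

lemma tendsto_waveQuot_zero {j : ℕ} (hj : j = 0 ∨ j = 1) (x τ : ℝ) :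
    Tendsto (waveQuot j x τ) (𝓝[≠] 0) (𝓝 (waveQuotZero j x)) := by
  rcases hj with rfl | rfl
  · have := (differentiable_wave x τ).continuous.tendsto 0
    simp only [wave, mul_zero, zero_mul, ne_eq, OfNat.ofNat_ne_zero, not_false_eq_true, zero_pow,
      sub_self, Complex.exp_zero] at this
    refine (this.mono_left nhdsWithin_le_nhds).congr' (Eventually.of_forall fun k => ?_) |>.trans ?_
    · simp [waveQuot, wave]
    · simp [waveQuotZero]
  · have h : HasDerivAt (wave x τ) (Complex.I * x) 0 := by
      have h1 : HasDerivAt (fun k : ℂ => Complex.I * k * x - Complex.I * k ^ 3 * τ)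
          (Complex.I * 1 * x - Complex.I * (((3 : ℕ) : ℂ) * 0 ^ (3 - 1)) * τ) 0 :=
        (((hasDerivAt_id' (0 : ℂ)).const_mul _).mul_const _).fun_sub
          (((hasDerivAt_pow 3 (0 : ℂ)).const_mul _).mul_const _)
      refine h1.cexp.congr_deriv ?_
      simp
    have h3 := hasDerivAt_iff_tendsto_slope.mp h
    rw [waveQuotZero, pow_one]
    refine h3.congr fun k => ?_
    simp [slope_def_field, waveQuot, wave]

/-- Re(-ik³τ) = τR³ sin 3θ, and the triple angle formula expresses everything through sin θ. Decay
can thus be discussed in terms of the sine alone. -/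
lemma norm_wave_polar (x τ R θ : ℝ) :
    ‖wave x τ (polar R θ)‖ =
      Real.exp (-(R * x * Real.sin θ) + τ * R ^ 3 * (Real.sin θ * (3 - 4 * Real.sin θ ^ 2))) := by
  rw [wave, Complex.norm_exp]
  congr 1
  have h3 : polar R θ ^ 3 = polar (R ^ 3) (3 * θ) := by
    rw [polar, polar, mul_pow, ← Complex.exp_nat_mul]
    push_cast
    ring_nf
  have him : ∀ a b : ℝ, (polar a b).im = a * Real.sin b := fun a b => by
    rw [polar, Complex.re_ofReal_mul (r := a) |> fun _ => Complex.im_ofReal_mul a _,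
      Complex.exp_ofReal_mul_I_im]
  rw [h3, Complex.sub_re, Complex.re_mul_ofReal, Complex.re_mul_ofReal, Complex.I_mul_re,
    Complex.I_mul_re, him, him, Real.sin_three_mul]
  ring

/-- The directions (through their sine) in which `e^{ikx - ik³τ}` decays. -/
def DecayDirection (τ s : ℝ) : Prop :=
  (τ = 0 ∧ 0 ≤ s) ∨ (0 < τ ∧ -(1 / 2) ≤ s ∧ s ≤ 0) ∨ (0 ≤ τ ∧ 0 ≤ s ∧ 3 ≤ 4 * s ^ 2)

/-- Three mechanisms. At τ = 0 there is no cubic term. Just below the real axis the growth of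
e^{ikx} is beaten by the cubic term, because 3 - 4s² ≥ 2 and R ≥ x/τ. Between π/3 and 2π/3 the cubic
term has a harmless sign, because 4s² ≥ 3. -/
lemma eventually_norm_wave_le (x τ : ℝ) :
    ∀ᶠ R in atTop, ∀ θ, DecayDirection τ (Real.sin θ) →
      ‖wave x τ (polar R θ)‖ ≤ Real.exp (-(R * x * |Real.sin θ|)) := by
  filter_upwards [eventually_ge_atTop 1, eventually_ge_atTop (x / τ)] with R hR hR' θ h
  rw [norm_wave_polar]
  refine Real.exp_le_exp.mpr ?_
  generalize Real.sin θ = s at *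
  have hR3 : 0 < R ^ 3 := by positivity
  rcases h with ⟨rfl, h0⟩ | ⟨h1, h2, h3⟩ | ⟨h1, h2, h3⟩
  · rw [abs_of_nonneg h0]; simp
  · rw [abs_of_nonpos h3]
    have h4 : x ≤ R * τ := by rwa [div_le_iff₀ h1] at hR'
    have h5 : R * x ≤ τ * R ^ 3 := by nlinarith [mul_nonneg h1.le (sq_nonneg R)]
    have h6 : 2 ≤ 3 - 4 * s ^ 2 := by nlinarith
    have h7 : (R * x) * 2 ≤ τ * R ^ 3 * (3 - 4 * s ^ 2) := by
      apply mul_le_mul h5 h6 (by norm_num) (by positivity)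
    nlinarith
  · rw [abs_of_nonneg h2]
    have : 0 ≤ τ * R ^ 3 * (s * (4 * s ^ 2 - 3)) := by
      apply mul_nonneg (by positivity) (mul_nonneg h2 (by linarith))
    nlinarith

/-- The first bound gives the pointwise limit on large arcs, the second the constant majorant for
dominated convergence. -/
lemma norm_waveQuot_le {j : ℕ} (hj : j = 0 ∨ j = 1) {x τ : ℝ} {k : ℂ} (hk : 1 ≤ ‖k‖)
    (h : ‖wave x τ k‖ ≤ 1) : ‖waveQuot j x τ k‖ ≤ ‖wave x τ k‖ + 2 / ‖k‖ ∧
      ‖waveQuot j x τ k‖ ≤ 2 := by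
  have h0 : 0 < ‖k‖ := by linarith
  rcases hj with rfl | rfl
  · have : 0 < 2 / ‖k‖ := by positivity
    simp only [waveQuot, Nat.cast_zero, sub_zero, pow_zero, div_one]
    constructor <;> linarith
  · have h1 : ‖waveQuot 1 x τ k‖ ≤ 2 / ‖k‖ := by
      rw [waveQuot, norm_div, pow_one, Nat.cast_one]
      gcongr
      refine (norm_sub_le _ _).trans ?_
      rw [norm_one]; linarith
    have h2 : 2 / ‖k‖ ≤ 2 := div_le_self (by norm_num) hk
    exact ⟨by linarith [norm_nonneg (wave x τ k)], by linarith⟩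

/-- In the form dk/k the arc carries the finite measure dθ, so pointwise decay for almost every θ
and dominated convergence suffice. Directions with sin θ = 0, where there is no decay, can occur
only at the endpoints. -/
lemma tendsto_arcIntegral_atTop {j : ℕ} (hj : j = 0 ∨ j = 1) {x : ℝ} (hx : 0 < x) (τ : ℝ)
    {θ₁ θ₂ : ℝ} (hθ : θ₁ ≤ θ₂) (hd : ∀ θ ∈ Set.Icc θ₁ θ₂, DecayDirection τ (Real.sin θ))
    (hs : ∀ θ ∈ Set.Ioo θ₁ θ₂, Real.sin θ ≠ 0) :
    Tendsto (fun R => arcIntegral (waveQuot j x τ) θ₁ θ₂ R) atTop (𝓝 0) := by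
  have e : (0 : ℂ) = ∫ _ in θ₁..θ₂, (0 : ℂ) := by simp
  rw [e]
  have hev := eventually_norm_wave_le x τ
  have hle1 : ∀ R θ : ℝ, 1 ≤ R → Real.exp (-(R * x * |Real.sin θ|)) ≤ 1 := fun R θ hR => by
    rw [Real.exp_le_one_iff, neg_nonpos]; positivity
  refine tendsto_integral_filter_of_dominated_convergence (fun _ => 2) ?_ ?_ ?_ ?_
  · filter_upwards [eventually_gt_atTop 0] with R hR
    refine Continuous.aestronglyMeasurable (continuous_iff_continuousAt.mpr fun θ => ?_)
    exact ContinuousAt.comp (f := fun θ => polar R θ)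
      (differentiableAt_waveQuot j x τ (polar_ne_zero (ne_of_gt hR) θ)).continuousAt
      (continuous_polar_right R).continuousAt
  · filter_upwards [hev, eventually_ge_atTop 1] with R hR hR1
    refine Eventually.of_forall fun θ hθm => ?_
    rw [Set.uIoc_of_le hθ] at hθm
    exact (norm_waveQuot_le hj (by rwa [norm_polar (by linarith)])
      ((hR θ (hd θ (Set.Ioc_subset_Icc_self hθm))).trans (hle1 R θ hR1))).2
  · exact intervalIntegrable_const
  · have hne : ∀ᵐ θ : ℝ, θ ≠ θ₂ := by simp [ae_iff]
    filter_upwards [hne] with θ hθ2 hθm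
    rw [Set.uIoc_of_le hθ] at hθm
    have hsθ : 0 < |Real.sin θ| := abs_pos.mpr (hs θ ⟨hθm.1, lt_of_le_of_ne hθm.2 hθ2⟩)
    have hlim : Tendsto (fun R : ℝ => Real.exp (-(R * x * |Real.sin θ|)) + 2 / R) atTop (𝓝 0) := by
      have h1 : Tendsto (fun R : ℝ => R * x * |Real.sin θ|) atTop atTop :=
        (tendsto_id.atTop_mul_const hx).atTop_mul_const hsθ
      have h2 := Real.tendsto_exp_neg_atTop_nhds_zero.comp h1
      simpa using h2.add (tendsto_const_nhds (x := (2 : ℝ)).div_atTop tendsto_id)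
    refine squeeze_zero_norm' ?_ hlim
    filter_upwards [hev, eventually_ge_atTop 1] with R hR hR1
    have h1 := hR θ (hd θ (Set.Ioc_subset_Icc_self hθm))
    have h2 := (norm_waveQuot_le hj (x := x) (τ := τ) (k := polar R θ)
      (by rwa [norm_polar (by linarith)]) (h1.trans (hle1 R θ hR1))).1
    rw [norm_polar (by linarith)] at h2
    linarith

/-! ### The explicit series for the constant datum -/

/-- The coefficient `(-1)ⁿ⁺¹ (√3 / 2π) Γ(n + 1 - ν)`. -/
def stepCoeff (ν : ℝ) (n : ℕ) : ℝ :=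
  Real.sqrt 3 / (2 * Real.pi) * (-1) ^ (n + 1) * Real.Gamma (n + 1 - ν)

/-- The fractional order `(j + 1) / 3`. -/
def fracOrder (j : ℕ) : ℝ := ((j : ℝ) + 1) / 3

/-- The `n`-th term of the series of `stepPrim j M x τ`. -/
def stepTerm (j M : ℕ) (x τ : ℝ) (n : ℕ) : ℝ :=
  stepCoeff (fracOrder j) n * τ ^ (fracOrder j - (n + 1)) *
    (x ^ (3 * n + 2 + M) / (3 * n + 2 + M).factorial)

/-- The `M`-fold antiderivative in `x` of the response to the boundary datum `1`. -/
def stepPrim (j M : ℕ) (x τ : ℝ) : ℝ :=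
  x ^ (M + j) / (M + j).factorial + ∑' n, stepTerm j M x τ n

lemma fracOrder_pos (j : ℕ) : 0 < fracOrder j := by unfold fracOrder; positivity

lemma fracOrder_lt_one {j : ℕ} (hj : j = 0 ∨ j = 1) : fracOrder j < 1 := by
  rcases hj with rfl | rfl <;> norm_num [fracOrder]

/-- The functional equation of Γ. The factor is the one produced by differentiating τ^{ν-(n+1)}, so
a τ-derivative shifts the index of the series. -/
lemma stepCoeff_succ {ν : ℝ} (hν : ν < 1) (n : ℕ) :
    stepCoeff ν (n + 1) = (ν - (n + 1)) * stepCoeff ν n := by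
  have h : (n : ℝ) + 1 - ν ≠ 0 := by
    have : (0 : ℝ) ≤ n := n.cast_nonneg
    linarith
  have := Real.Gamma_add_one h
  unfold stepCoeff
  rw [show ((n + 1 : ℕ) : ℝ) + 1 - ν = (n + 1 - ν) + 1 by push_cast; ring, this]
  ring

lemma abs_stepCoeff_le {ν : ℝ} (hν : 0 ≤ ν) (hν' : ν < 1) (n : ℕ) :
    |stepCoeff ν n| ≤ |stepCoeff ν 0| * n.factorial := by
  induction n with
  | zero => simp
  | succ n ih =>
    rw [stepCoeff_succ hν', abs_mul, Nat.factorial_succ]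
    have hn : (0 : ℝ) ≤ n := n.cast_nonneg
    have h1 : |ν - (n + 1)| ≤ n + 1 := by rw [abs_le]; constructor <;> linarith
    calc |ν - (n + 1)| * |stepCoeff ν n| ≤ (n + 1) * (|stepCoeff ν 0| * n.factorial) := by gcongr
      _ = _ := by push_cast; ring

lemma factorial_mul_factorial_le (n M : ℕ) :
    n.factorial * n.factorial ≤ (3 * n + 2 + M).factorial := by
  refine (Nat.le_of_dvd (Nat.factorial_pos _) (Nat.factorial_mul_factorial_dvd_factorial_add n n)).trans
    (Nat.factorial_le (by omega))

/-- The coefficient grows like n!, while (3n + 2 + M)! ≥ (n!)²; an exponential series in |x|³/τ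
remains. -/
lemma abs_stepTerm_le {j : ℕ} (hj : j = 0 ∨ j = 1) (M : ℕ) {x τ : ℝ} (hτ : 0 < τ) (n : ℕ) :
    |stepTerm j M x τ n| ≤ |stepCoeff (fracOrder j) 0| * τ ^ (fracOrder j - 1) * |x| ^ (2 + M) *
      ((|x| ^ 3 / τ) ^ n / n.factorial) := by
  have h1 := abs_stepCoeff_le (fracOrder_pos j).le (fracOrder_lt_one hj) n
  have h2 : τ ^ (fracOrder j - (n + 1)) = τ ^ (fracOrder j - 1) / τ ^ n := by
    rw [← Real.rpow_natCast, ← Real.rpow_sub hτ]; congr 1; ring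
  have h3 : (n.factorial : ℝ) / (3 * n + 2 + M).factorial ≤ 1 / n.factorial := by
    rw [div_le_div_iff₀ (by positivity) (by positivity), one_mul]
    exact_mod_cast factorial_mul_factorial_le n M
  rw [stepTerm, abs_mul, abs_mul, abs_div, abs_pow, Nat.abs_cast, abs_of_pos (Real.rpow_pos_of_pos hτ _),
    h2]
  have h4 : 0 < τ ^ (fracOrder j - 1) := Real.rpow_pos_of_pos hτ _
  calc |stepCoeff (fracOrder j) n| * (τ ^ (fracOrder j - 1) / τ ^ n) *
        (|x| ^ (3 * n + 2 + M) / (3 * n + 2 + M).factorial)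
      ≤ (|stepCoeff (fracOrder j) 0| * n.factorial) * (τ ^ (fracOrder j - 1) / τ ^ n) *
        (|x| ^ (3 * n + 2 + M) / (3 * n + 2 + M).factorial) := by gcongr
    _ = |stepCoeff (fracOrder j) 0| * τ ^ (fracOrder j - 1) * |x| ^ (2 + M) * (|x| ^ 3 / τ) ^ n *
        (n.factorial / (3 * n + 2 + M).factorial) := by
          rw [div_pow, ← pow_mul]; ring
    _ ≤ |stepCoeff (fracOrder j) 0| * τ ^ (fracOrder j - 1) * |x| ^ (2 + M) * (|x| ^ 3 / τ) ^ n *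
        (1 / n.factorial) := by gcongr
    _ = _ := by ring

lemma summable_stepTerm {j : ℕ} (hj : j = 0 ∨ j = 1) (M : ℕ) (x : ℝ) {τ : ℝ} (hτ : 0 < τ) :
    Summable fun n => |stepTerm j M x τ n| :=
  Summable.of_nonneg_of_le (fun _ => abs_nonneg _) (abs_stepTerm_le hj M hτ)
    ((Real.summable_pow_div_factorial _).mul_left _)

/-! ### Weights and the integrals over the rotated rays -/

/-- The factor of the integral over `∂Ω₁`. -/
def weight₁ (j : ℕ) : ℂ :=
  if j = 0 then (1 - α) / (2 * (Real.pi : ℂ)) else (1 - α ^ 2) / (2 * (Real.pi : ℂ) * Complex.I)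

/-- The factor of the integral over `∂Ω₂`. -/
def weight₂ (j : ℕ) : ℂ :=
  if j = 0 then (1 - α ^ 2) / (2 * (Real.pi : ℂ)) else (1 - α) / (2 * (Real.pi : ℂ) * Complex.I)

lemma sqrt_three_sq : ((Real.sqrt 3 : ℝ) : ℂ) ^ 2 = 3 := by
  rw [← Complex.ofReal_pow, Real.sq_sqrt (by norm_num)]; norm_num

lemma α_eq : α = -1 / 2 + (Real.sqrt 3 : ℝ) / 2 * Complex.I := by
  have h : (2 * (Real.pi : ℂ) * Complex.I / 3) = ((Real.pi - Real.pi / 3 : ℝ) : ℂ) * Complex.I := by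
    push_cast; ring
  rw [α, h, Complex.exp_mul_I, ← Complex.ofReal_cos, ← Complex.ofReal_sin, Real.cos_pi_sub,
    Real.sin_pi_sub, Real.cos_pi_div_three, Real.sin_pi_div_three]
  push_cast; ring

lemma polar_neg_pi_div_six (ρ : ℝ) :
    polar ρ (-(Real.pi / 6)) = ρ * ((Real.sqrt 3 : ℝ) / 2 - Complex.I / 2) := by
  rw [polar, Complex.exp_mul_I, ← Complex.ofReal_cos, ← Complex.ofReal_sin, Real.cos_neg,
    Real.sin_neg, Real.cos_pi_div_six, Real.sin_pi_div_six]
  push_cast; ring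

lemma polar_pi_div_two (ρ : ℝ) : polar ρ (Real.pi / 2) = ρ * Complex.I := by
  rw [polar, Complex.exp_mul_I, ← Complex.ofReal_cos, ← Complex.ofReal_sin, Real.cos_pi_div_two,
    Real.sin_pi_div_two]
  push_cast; ring

lemma polar_pi_add_pi_div_six (ρ : ℝ) :
    polar ρ (Real.pi / 6 + Real.pi) = ρ * (-((Real.sqrt 3 : ℝ) / 2) - Complex.I / 2) := by
  rw [polar, Complex.exp_mul_I, ← Complex.ofReal_cos, ← Complex.ofReal_sin, Real.cos_add_pi,
    Real.sin_add_pi, Real.cos_pi_div_six, Real.sin_pi_div_six]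
  push_cast; ring

/-- The second factor is the j-th power of the direction e^{-iπ/6}. It cancels the direction in
k^{-j} along that ray, so the remaining factor is the same for j = 0 and j = 1. The next two lemmas
do this for the directions π/2 and 7π/6. -/
lemma weight₁_mul {j : ℕ} (hj : j = 0 ∨ j = 1) :
    2 * (Real.pi : ℂ) * weight₁ j =
      (3 / 2 - (Real.sqrt 3 : ℝ) / 2 * Complex.I) * ((Real.sqrt 3 : ℝ) / 2 - Complex.I / 2) ^ j := by
  have hs := sqrt_three_sq
  have hI := Complex.I_sq
  have hπ : (Real.pi : ℂ) ≠ 0 := by exact_mod_cast Real.pi_ne_zero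
  rcases hj with rfl | rfl
  · rw [weight₁, if_pos rfl, α_eq]; field_simp; ring
  · rw [weight₁, if_neg one_ne_zero, α_eq]
    generalize ((Real.sqrt 3 : ℝ) : ℂ) = s at *
    have hI0 := Complex.I_ne_zero
    generalize Complex.I = i at *
    field_simp
    grind

lemma weight₂_sub_mul {j : ℕ} (hj : j = 0 ∨ j = 1) :
    2 * (Real.pi : ℂ) * (weight₂ j - weight₁ j) =
      ((Real.sqrt 3 : ℝ) * Complex.I) * Complex.I ^ j := by
  have hs := sqrt_three_sq
  have hI := Complex.I_sq
  have hπ : (Real.pi : ℂ) ≠ 0 := by exact_mod_cast Real.pi_ne_zero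
  have hI0 := Complex.I_ne_zero
  rcases hj with rfl | rfl
  · simp only [weight₁, weight₂, if_true, α_eq]
    generalize ((Real.sqrt 3 : ℝ) : ℂ) = s at *
    generalize Complex.I = i at *
    field_simp
    grind
  · simp only [weight₁, weight₂, one_ne_zero, if_false, α_eq]
    generalize ((Real.sqrt 3 : ℝ) : ℂ) = s at *
    generalize Complex.I = i at *
    field_simp
    grind

lemma weight₂_mul {j : ℕ} (hj : j = 0 ∨ j = 1) :
    2 * (Real.pi : ℂ) * weight₂ j =
      (3 / 2 + (Real.sqrt 3 : ℝ) / 2 * Complex.I) *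
        (-((Real.sqrt 3 : ℝ) / 2) - Complex.I / 2) ^ j := by
  have hs := sqrt_three_sq
  have hI := Complex.I_sq
  have hπ : (Real.pi : ℂ) ≠ 0 := by exact_mod_cast Real.pi_ne_zero
  have hI0 := Complex.I_ne_zero
  rcases hj with rfl | rfl
  · simp only [weight₂, if_true, α_eq]
    generalize ((Real.sqrt 3 : ℝ) : ℂ) = s at *
    generalize Complex.I = i at *
    field_simp
    grind
  · simp only [weight₂, one_ne_zero, if_false, α_eq]
    generalize ((Real.sqrt 3 : ℝ) : ℂ) = s at *
    generalize Complex.I = i at *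
    field_simp
    grind

/-- For each weight the arcs around 0 have total opening 2π/3; this evaluates their joint
contribution. -/
lemma weight_add_mul {j : ℕ} (hj : j = 0 ∨ j = 1) (x : ℝ) :
    2 * (Real.pi : ℂ) / 3 * (weight₁ j + weight₂ j) * waveQuotZero j x = (x : ℂ) ^ j := by
  have hπ : (Real.pi : ℂ) ≠ 0 := by exact_mod_cast Real.pi_ne_zero
  have hI0 := Complex.I_ne_zero
  have hs := sqrt_three_sq
  have hI := Complex.I_sq
  rcases hj with rfl | rfl
  · simp only [weight₁, weight₂, if_true, α_eq, waveQuotZero, pow_zero]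
    generalize ((Real.sqrt 3 : ℝ) : ℂ) = s at *
    generalize Complex.I = i at *
    field_simp
    grind
  · simp only [weight₁, weight₂, one_ne_zero, if_false, α_eq, waveQuotZero, pow_one]
    generalize ((Real.sqrt 3 : ℝ) : ℂ) = s at *
    generalize Complex.I = i at *
    field_simp
    grind

/-- The combination of the integrands over the rotated rays, on which `e^{-ik³τ} = e^{-|k|³τ}`. -/
def rotatedSum (j : ℕ) (x τ ρ : ℝ) : ℂ :=
  weight₁ j * (waveQuot j x τ (polar ρ (-(Real.pi / 6))) - waveQuot j x τ (polar ρ (Real.pi / 2))) +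
    weight₂ j * (waveQuot j x τ (polar ρ (Real.pi / 2)) -
      waveQuot j x τ (polar ρ (Real.pi / 6 + Real.pi)))

/-- The hypothesis says i z³ = 1, so along the direction z the cubic exponential is real and
decaying. -/
lemma wave_mul_eq {z : ℂ} (hz : (Complex.I * z) ^ 3 = -1) (x τ ρ : ℝ) :
    wave x τ (ρ * z) = Complex.exp (((ρ * x : ℝ) : ℂ) * (Complex.I * z)) * Real.exp (-τ * ρ ^ 3) := by
  have hz' : Complex.I * z ^ 3 = 1 := by
    have : (Complex.I * z) ^ 3 = -(Complex.I * z ^ 3) := by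
      rw [mul_pow, Complex.I_pow_three]; ring
    rw [this] at hz; linear_combination -hz
  rw [wave, Complex.ofReal_exp, ← Complex.exp_add]
  congr 1
  push_cast
  linear_combination (-(ρ : ℂ) ^ 3 * τ) * hz'

/-- After the directions cancel against the weights, the three weights add up to zero. Hence the
constants `j` subtracted in `waveQuot` disappear. -/
lemma rotatedSum_eq {j : ℕ} (hj : j = 0 ∨ j = 1) (x τ : ℝ) {ρ : ℝ} (hρ : 0 < ρ) :
    2 * (Real.pi : ℂ) * rotatedSum j x τ ρ = Real.exp (-τ * ρ ^ 3) / (ρ : ℂ) ^ j *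
      ((3 / 2 - (Real.sqrt 3 : ℝ) / 2 * Complex.I) *
          Complex.exp (((ρ * x : ℝ) : ℂ) * (1 / 2 + (Real.sqrt 3 : ℝ) / 2 * Complex.I)) +
        (Real.sqrt 3 : ℝ) * Complex.I * Complex.exp (((ρ * x : ℝ) : ℂ) * (-1)) -
        (3 / 2 + (Real.sqrt 3 : ℝ) / 2 * Complex.I) *
          Complex.exp (((ρ * x : ℝ) : ℂ) * (1 / 2 - (Real.sqrt 3 : ℝ) / 2 * Complex.I))) := by
  have hs := sqrt_three_sq
  have hI := Complex.I_sq
  have hρ0 : (ρ : ℂ) ^ j ≠ 0 := pow_ne_zero _ (by exact_mod_cast hρ.ne')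
  have ha : Complex.I * ((Real.sqrt 3 : ℝ) / 2 - Complex.I / 2) =
      1 / 2 + (Real.sqrt 3 : ℝ) / 2 * Complex.I := by linear_combination (-1 / 2) * hI
  have hc : Complex.I * (-((Real.sqrt 3 : ℝ) / 2) - Complex.I / 2) =
      1 / 2 - (Real.sqrt 3 : ℝ) / 2 * Complex.I := by linear_combination (-1 / 2) * hI
  have ea := wave_mul_eq (z := (Real.sqrt 3 : ℝ) / 2 - Complex.I / 2) (by
    rw [ha]
    generalize ((Real.sqrt 3 : ℝ) : ℂ) = s at *
    generalize Complex.I = i at *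
    grind) x τ ρ
  have ec := wave_mul_eq (z := -((Real.sqrt 3 : ℝ) / 2) - Complex.I / 2) (by
    rw [hc]
    generalize ((Real.sqrt 3 : ℝ) : ℂ) = s at *
    generalize Complex.I = i at *
    grind) x τ ρ
  have eb := wave_mul_eq (z := Complex.I) (by rw [Complex.I_mul_I]; norm_num) x τ ρ
  rw [ha] at ea
  rw [hc] at ec
  rw [Complex.I_mul_I] at eb
  have hza : ((Real.sqrt 3 : ℝ) : ℂ) / 2 - Complex.I / 2 ≠ 0 := fun h => by
    have := congrArg Complex.im h; norm_num at this
  have hzc : -(((Real.sqrt 3 : ℝ) : ℂ) / 2) - Complex.I / 2 ≠ 0 := fun h => by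
    have := congrArg Complex.im h; norm_num at this
  have e0 : 2 * (Real.pi : ℂ) * rotatedSum j x τ ρ =
      (2 * (Real.pi : ℂ) * weight₁ j) * waveQuot j x τ (polar ρ (-(Real.pi / 6))) +
      (2 * (Real.pi : ℂ) * (weight₂ j - weight₁ j)) * waveQuot j x τ (polar ρ (Real.pi / 2)) -
      (2 * (Real.pi : ℂ) * weight₂ j) * waveQuot j x τ (polar ρ (Real.pi / 6 + Real.pi)) := by
    rw [rotatedSum]; ring
  have hquot : ∀ w z : ℂ, z ≠ 0 → w * z ^ j * waveQuot j x τ (ρ * z) =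
      w * (wave x τ (ρ * z) - j) / (ρ : ℂ) ^ j := fun w z hz => by
    rw [waveQuot, mul_pow]
    field_simp
  rw [e0, weight₁_mul hj, weight₂_sub_mul hj, weight₂_mul hj, polar_neg_pi_div_six,
    polar_pi_div_two, polar_pi_add_pi_div_six, hquot _ _ hza, hquot _ _ Complex.I_ne_zero,
    hquot _ _ hzc, ea, eb, ec]
  ring

/-- The exponents a, -1, c are the three cube roots of -1, so the weighted power sums D m are
3-periodic up to sign. They vanish at m = 0 and m = 1, so only the powers x^{3n+2} survive. -/
lemma hasSum_rotatedSum {j : ℕ} (hj : j = 0 ∨ j = 1) (x τ : ℝ) {ρ : ℝ} (hρ : 0 < ρ) :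
    HasSum (fun n : ℕ => Complex.I * (((-1) ^ n * (3 * Real.sqrt 3 / (2 * Real.pi)) *
      (x ^ (3 * n + 2) / (3 * n + 2).factorial) *
        (ρ ^ (3 * n + 1 - j) * Real.exp (-τ * ρ ^ 3)) : ℝ) : ℂ)) (rotatedSum j x τ ρ / ρ) := by
  have hs := sqrt_three_sq
  have hI := Complex.I_sq
  have hπ : (Real.pi : ℂ) ≠ 0 := by exact_mod_cast Real.pi_ne_zero
  have hρ0 : (ρ : ℂ) ≠ 0 := by exact_mod_cast hρ.ne'
  set a : ℂ := 1 / 2 + (Real.sqrt 3 : ℝ) / 2 * Complex.I with ha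
  set c : ℂ := 1 / 2 - (Real.sqrt 3 : ℝ) / 2 * Complex.I with hc
  set wa : ℂ := 3 / 2 - (Real.sqrt 3 : ℝ) / 2 * Complex.I with hwa
  set wc : ℂ := 3 / 2 + (Real.sqrt 3 : ℝ) / 2 * Complex.I with hwc
  set wb : ℂ := (Real.sqrt 3 : ℝ) * Complex.I with hwb
  set D : ℕ → ℂ := fun m => wa * a ^ m + wb * (-1) ^ m - wc * c ^ m with hD
  have ha3 : a ^ 3 = -1 := by
    rw [ha]
    generalize ((Real.sqrt 3 : ℝ) : ℂ) = s at *
    generalize Complex.I = i at *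
    grind
  have hc3 : c ^ 3 = -1 := by
    rw [hc]
    generalize ((Real.sqrt 3 : ℝ) : ℂ) = s at *
    generalize Complex.I = i at *
    grind
  have hD3 : ∀ n r : ℕ, D (3 * n + r) = (-1) ^ n * D r := fun n r => by
    simp only [hD, pow_add, pow_mul, ha3, hc3]
    rw [show ((-1 : ℂ)) ^ 3 = -1 by norm_num]
    ring
  have hD0 : D 0 = 0 := by simp only [hD, pow_zero, hwa, hwb, hwc]; ring
  have hD1 : D 1 = 0 := by
    simp only [hD, pow_one, hwa, hwb, hwc, ha, hc]
    generalize ((Real.sqrt 3 : ℝ) : ℂ) = s at *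
    generalize Complex.I = i at *
    grind
  have hD2 : D 2 = 3 * (Real.sqrt 3 : ℝ) * Complex.I := by
    simp only [hD, hwa, hwb, hwc, ha, hc]
    generalize ((Real.sqrt 3 : ℝ) : ℂ) = s at *
    generalize Complex.I = i at *
    grind
  set y : ℂ := ((ρ * x : ℝ) : ℂ) with hy
  have hexp : ∀ z : ℂ, HasSum (fun m : ℕ => (y * z) ^ m / m.factorial) (Complex.exp (y * z)) :=
    fun z => by
      rw [Complex.exp_eq_exp_ℂ]
      exact NormedSpace.expSeries_div_hasSum_exp (y * z)
  have hsum : HasSum (fun m : ℕ => D m * (y ^ m / m.factorial))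
      (wa * Complex.exp (y * a) + wb * Complex.exp (y * (-1)) - wc * Complex.exp (y * c)) := by
    refine ((((hexp a).mul_left wa).add ((hexp (-1)).mul_left wb)).sub
      ((hexp c).mul_left wc)).congr_fun fun m => ?_
    simp only [hD, mul_pow]
    ring
  have hinj : Function.Injective fun n : ℕ => 3 * n + 2 := fun m n h => by
    simp only at h; omega
  rw [← hinj.hasSum_iff] at hsum
  · have h2 := (hsum.mul_left (Real.exp (-τ * ρ ^ 3) / (ρ : ℂ) ^ j)).mul_left
      (1 / (2 * (Real.pi : ℂ) * ρ))
    rw [← rotatedSum_eq hj x τ hρ] at h2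
    rw [show rotatedSum j x τ ρ / ρ =
      1 / (2 * (Real.pi : ℂ) * ρ) * (2 * (Real.pi : ℂ) * rotatedSum j x τ ρ) by field_simp]
    refine h2.congr_fun fun n => ?_
    simp only [Function.comp, hD3, hD2, hy]
    have hpow : (ρ : ℂ) ^ (3 * n + 2) = ρ ^ (3 * n + 1 - j) * (ρ ^ j * ρ) := by
      rw [← pow_succ, ← pow_add]; congr 1; omega
    have hf : ((3 * n + 2).factorial : ℂ) ≠ 0 := by exact_mod_cast Nat.factorial_ne_zero _
    push_cast
    rw [mul_pow, hpow]
    field_simp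
  · intro m hm
    have hm3 : m % 3 = 0 ∨ m % 3 = 1 := by
      by_contra hcon
      push Not at hcon
      exact hm ⟨m / 3, by simp only; omega⟩
    have e := Nat.div_add_mod m 3
    rcases hm3 with h | h
    · rw [← e, h, hD3, hD0]; simp
    · rw [← e, h, hD3, hD1]; simp

lemma integrableOn_pow_mul_exp_neg_mul_cube (m : ℕ) {τ : ℝ} (hτ : 0 < τ) :
    IntegrableOn (fun ρ : ℝ => ρ ^ m * Real.exp (-τ * ρ ^ 3)) (Set.Ioi 0) := by
  have h := integrableOn_rpow_mul_exp_neg_mul_rpow (p := 3) (s := m) (b := τ)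
    (by have : (0 : ℝ) ≤ m := m.cast_nonneg
        linarith) (by norm_num) hτ
  refine h.congr_fun (fun ρ _ => ?_) measurableSet_Ioi
  simp only
  rw [Real.rpow_natCast, show (3 : ℝ) = ((3 : ℕ) : ℝ) by norm_num, Real.rpow_natCast]

lemma integral_pow_mul_exp_neg_mul_cube (m : ℕ) {τ : ℝ} (hτ : 0 < τ) :
    ∫ ρ in Set.Ioi (0 : ℝ), ρ ^ m * Real.exp (-τ * ρ ^ 3) =
      τ ^ (-((m : ℝ) + 1) / 3) * (1 / 3) * Real.Gamma (((m : ℝ) + 1) / 3) := by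
  have h := integral_rpow_mul_exp_neg_mul_rpow (p := 3) (q := m) (b := τ) (by norm_num)
    (by have : (0 : ℝ) ≤ m := m.cast_nonneg
        linarith) hτ
  rw [← h]
  refine setIntegral_congr_fun measurableSet_Ioi (fun ρ _ => ?_)
  rw [Real.rpow_natCast, show (3 : ℝ) = ((3 : ℕ) : ℝ) by norm_num, Real.rpow_natCast]

/-- One parameter removes the truncations at 0 and at infinity together. -/
lemma aecover_Ioc_inv_self :
    AECover (volume.restrict (Set.Ioi (0 : ℝ))) atTop fun R : ℝ => Set.Ioc R⁻¹ R where
  ae_eventually_mem := by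
    filter_upwards [ae_restrict_mem measurableSet_Ioi] with ρ hρ
    have hρ : 0 < ρ := hρ
    filter_upwards [eventually_gt_atTop ρ⁻¹, eventually_ge_atTop ρ] with R h1 h2
    exact ⟨inv_lt_of_inv_lt₀ hρ h1, h2⟩
  measurableSet _ := measurableSet_Ioc

/-- The limit of the integrals over the rotated rays. -/
lemma tendsto_integral_rotatedSum {j : ℕ} (hj : j = 0 ∨ j = 1) {x τ : ℝ} (hx : 0 < x)
    (hτ : 0 < τ) :
    Tendsto (fun R : ℝ => ∫ ρ in R⁻¹..R, rotatedSum j x τ ρ / ρ) atTop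
      (𝓝 (-Complex.I * ((∑' n, stepTerm j 0 x τ n : ℝ) : ℂ))) := by
  set G : ℕ → ℝ → ℝ := fun n ρ => (-1) ^ n * (3 * Real.sqrt 3 / (2 * Real.pi)) *
      (x ^ (3 * n + 2) / (3 * n + 2).factorial) *
        (ρ ^ (3 * n + 1 - j) * Real.exp (-τ * ρ ^ 3)) with hG
  have hj1 : j ≤ 1 := by omega
  have hGi : ∀ n, IntegrableOn (G n) (Set.Ioi 0) := fun n =>
    (integrableOn_pow_mul_exp_neg_mul_cube _ hτ).const_mul _
  have hGint : ∀ n, ∫ ρ in Set.Ioi (0 : ℝ), G n ρ = -stepTerm j 0 x τ n := fun n => by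
    simp only [hG]
    rw [MeasureTheory.integral_const_mul, integral_pow_mul_exp_neg_mul_cube _ hτ]
    have e1 : (((3 * n + 1 - j : ℕ) : ℝ) + 1) / 3 = n + 1 - fracOrder j := by
      rw [Nat.cast_sub (by omega), fracOrder]; push_cast; ring
    have e2 : -(((3 * n + 1 - j : ℕ) : ℝ) + 1) / 3 = fracOrder j - (n + 1) := by
      rw [neg_div, e1]; ring
    rw [e1, e2, stepTerm, stepCoeff, add_zero, pow_succ]
    ring
  -- For x > 0 each term has constant sign on the half-line, so its L¹ norm is the absolute value of
  -- its integral.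
  have hGabs : ∀ n, ∫ ρ in Set.Ioi (0 : ℝ), |G n ρ| = |stepTerm j 0 x τ n| := fun n => by
    rw [← abs_neg, ← hGint]
    have hsgn : ∀ ρ ∈ Set.Ioi (0 : ℝ), |G n ρ| = (-1) ^ n * G n ρ := fun ρ hρ => by
      have hρ : 0 < ρ := hρ
      simp only [hG]
      rw [abs_mul, abs_mul, abs_mul, abs_pow, abs_neg, abs_one, one_pow, one_mul,
        abs_of_pos (by positivity), abs_of_pos (by positivity), abs_of_pos (by positivity)]
      have : ((-1 : ℝ)) ^ n * (-1) ^ n = 1 := by rw [← mul_pow]; norm_num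
      linear_combination (-(3 * Real.sqrt 3 / (2 * Real.pi)) *
        (x ^ (3 * n + 2) / (3 * n + 2).factorial) *
        (ρ ^ (3 * n + 1 - j) * Real.exp (-τ * ρ ^ 3))) * this
    have h1 : ∫ ρ in Set.Ioi (0 : ℝ), |G n ρ| = (-1) ^ n * ∫ ρ in Set.Ioi (0 : ℝ), G n ρ := by
      rw [setIntegral_congr_fun measurableSet_Ioi hsgn, MeasureTheory.integral_const_mul]
    have h2 : 0 ≤ ∫ ρ in Set.Ioi (0 : ℝ), |G n ρ| := integral_nonneg fun _ => abs_nonneg _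
    rw [← abs_of_nonneg h2, h1, abs_mul, abs_pow, abs_neg, abs_one, one_pow, one_mul]
  have hsum := summable_stepTerm hj 0 x hτ
  -- The truncated integrals are dominated, uniformly in R, by the full L¹ norms, which are
  -- summable.
  have hlim : Tendsto (fun R : ℝ => ∑' n, ∫ ρ in Set.Ioc R⁻¹ R, G n ρ ∂(volume.restrict (Set.Ioi 0)))
      atTop (𝓝 (∑' n, -stepTerm j 0 x τ n)) := by
    refine tendsto_tsum_of_dominated_convergence hsum (fun n => ?_) ?_
    · rw [← hGint n]
      exact aecover_Ioc_inv_self.integral_tendsto_of_countably_generated (hGi n)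
    · refine Eventually.of_forall fun R n => ?_
      rw [← hGabs n]
      refine (MeasureTheory.norm_integral_le_integral_norm _).trans ?_
      exact setIntegral_le_integral (hGi n).abs (Eventually.of_forall fun _ => abs_nonneg _)
  rw [tsum_neg] at hlim
  have hlim' := ((Complex.continuous_ofReal.tendsto _).comp hlim).const_mul Complex.I
  have e : -Complex.I * ((∑' n, stepTerm j 0 x τ n : ℝ) : ℂ) =
      Complex.I * ((-∑' n, stepTerm j 0 x τ n : ℝ) : ℂ) := by push_cast; ring
  rw [e]
  refine hlim'.congr' ?_
  filter_upwards [eventually_ge_atTop 1] with R hR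
  have hR0 : 0 < R := by linarith
  have hRi : 0 < R⁻¹ := inv_pos.mpr hR0
  have hle : R⁻¹ ≤ R := (inv_le_one_of_one_le₀ hR).trans hR
  have hrestr : (volume.restrict (Set.Ioi (0 : ℝ))).restrict (Set.Ioc R⁻¹ R) =
      volume.restrict (Set.Ioc R⁻¹ R) := by
    rw [Measure.restrict_restrict measurableSet_Ioc]
    congr 1
    exact Set.inter_eq_left.mpr fun ρ hρ => hRi.trans hρ.1
  have hs := hasSum_integral_of_summable_integral_norm
    (μ := volume.restrict (Set.Ioc R⁻¹ R)) (F := G)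
    (fun n => (hGi n).mono_set fun ρ hρ => hRi.trans hρ.1)
    (hsum.of_nonneg_of_le (fun n => integral_nonneg fun _ => norm_nonneg _) fun n => by
      rw [← hGabs n]
      exact setIntegral_mono_set (hGi n).abs (Eventually.of_forall fun _ => abs_nonneg _)
        (show Set.Ioc R⁻¹ R ≤ Set.Ioi 0 from fun ρ hρ => hRi.trans hρ.1).eventuallyLE)
  simp only [Function.comp, hrestr]
  rw [hs.tsum_eq, intervalIntegral.integral_of_le hle, ← integral_complex_ofReal,
    ← MeasureTheory.integral_const_mul]
  refine setIntegral_congr_fun measurableSet_Ioc fun ρ hρ => ?_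
  have h := hasSum_rotatedSum hj x τ (hRi.trans hρ.1)
  rw [← h.tsum_eq, tsum_mul_left, Complex.ofReal_tsum]

/-! ### Rotation of the contours -/

/-- The difference of the two wave quotients, whose integral along `∂Ω₁` and `∂Ω₂` is the response
to the boundary datum `1`. -/
def stepRay (j : ℕ) (x τ θ R : ℝ) : ℂ :=
  rayLogIntegral (waveQuot j x 0) θ R⁻¹ R - rayLogIntegral (waveQuot j x τ) θ R⁻¹ R

lemma decayDirection_of_sq {τ θ : ℝ} (hτ : 0 ≤ τ) (h₁ : Real.pi / 3 ≤ θ)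
    (h₂ : θ ≤ 2 * Real.pi / 3) : DecayDirection τ (Real.sin θ) := by
  have hπ := Real.pi_pos
  refine Or.inr (Or.inr ⟨hτ, Real.sin_nonneg_of_nonneg_of_le_pi (by linarith) (by linarith), ?_⟩)
  have h : Real.cos θ ^ 2 ≤ (1 / 2) ^ 2 := by
    refine sq_le_sq' ?_ ?_
    · rw [← Real.cos_pi_div_three, ← Real.cos_pi_sub]
      exact Real.cos_le_cos_of_nonneg_of_le_pi (by linarith) (by linarith) (by linarith)
    · rw [← Real.cos_pi_div_three]
      exact Real.cos_le_cos_of_nonneg_of_le_pi (by linarith) (by linarith) (by linarith)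
  nlinarith [Real.sin_sq_add_cos_sq θ]

lemma decayDirection_of_neg {τ φ : ℝ} (hτ : 0 < τ) (h₁ : 0 ≤ φ) (h₂ : φ ≤ Real.pi / 6) :
    DecayDirection τ (-Real.sin φ) := by
  have hπ := Real.pi_pos
  have h0 := Real.sin_nonneg_of_nonneg_of_le_pi h₁ (by linarith)
  have h : Real.sin φ ≤ 1 / 2 := by
    rw [← Real.sin_pi_div_six]
    exact Real.sin_le_sin_of_le_of_le_pi_div_two (by linarith) (by linarith) h₂
  exact Or.inr (Or.inl ⟨hτ, by linarith, by linarith⟩)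

/-- Cauchy's theorem on the sector between the two rays: the outer arc vanishes, and the inner arc
leaves its angle times the value at 0. -/
lemma tendsto_rayLogIntegral_sub {j : ℕ} (hj : j = 0 ∨ j = 1) {x τ : ℝ} (hx : 0 < x)
    {θ₁ θ₂ : ℝ} (hθ : θ₁ ≤ θ₂) (hd : ∀ θ ∈ Set.Icc θ₁ θ₂, DecayDirection τ (Real.sin θ))
    (hs : ∀ θ ∈ Set.Ioo θ₁ θ₂, Real.sin θ ≠ 0) :
    Tendsto (fun R => rayLogIntegral (waveQuot j x τ) θ₁ R⁻¹ R -
      rayLogIntegral (waveQuot j x τ) θ₂ R⁻¹ R) atTop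
      (𝓝 (Complex.I * (((θ₂ - θ₁ : ℝ) : ℂ) * waveQuotZero j x))) := by
  have h1 := (tendsto_arcIntegral_zero (tendsto_waveQuot_zero hj x τ) θ₁ θ₂
    (fun k hk => differentiableAt_waveQuot j x τ hk)).comp tendsto_inv_atTop_nhdsGT_zero
  have h2 := (h1.const_mul Complex.I).sub
    ((tendsto_arcIntegral_atTop hj hx τ hθ hd hs).const_mul Complex.I)
  rw [mul_zero, sub_zero] at h2
  refine h2.congr' ?_
  filter_upwards [eventually_ge_atTop 1] with R hR
  exact (rayLogIntegral_sub (fun k hk => differentiableAt_waveQuot j x τ hk) θ₁ θ₂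
    (inv_pos.mpr (by linarith)) ((inv_le_one_of_one_le₀ hR).trans hR)).symm

lemma intervalIntegrable_waveQuot_polar_div (j : ℕ) (x τ θ : ℝ) {δ R : ℝ} (hδ : 0 < δ)
    (hR : δ ≤ R) :
    IntervalIntegrable (fun ρ : ℝ => waveQuot j x τ (polar ρ θ) / (ρ : ℂ)) volume δ R := by
  refine ContinuousOn.intervalIntegrable fun ρ hρ => ContinuousAt.continuousWithinAt ?_
  rw [Set.uIcc_of_le hR] at hρ
  have h0 : ρ ≠ 0 := (hδ.trans_le hρ.1).ne'
  refine ContinuousAt.div ?_ Complex.continuous_ofReal.continuousAt (by exact_mod_cast h0)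
  exact ContinuousAt.comp (f := fun ρ => polar ρ θ)
    (differentiableAt_waveQuot j x τ (polar_ne_zero h0 θ)).continuousAt
    (continuous_polar_left θ).continuousAt

/-- The boundary integrals for the datum `1` are given by the series `stepPrim j 0 x τ`. -/
lemma tendsto_stepRay {j : ℕ} (hj : j = 0 ∨ j = 1) {x τ : ℝ} (hx : 0 < x) (hτ : 0 < τ) :
    Tendsto (fun R => weight₁ j * (stepRay j x τ 0 R - stepRay j x τ (Real.pi / 3) R) +
      weight₂ j * (stepRay j x τ (2 * Real.pi / 3) R - stepRay j x τ Real.pi R)) atTop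
      (𝓝 (Complex.I * (stepPrim j 0 x τ : ℂ))) := by
  have hπ := Real.pi_pos
  -- The e^{ikx} part (τ = 0) decays in the upper half plane, so it closes inside Ω₁ and Ω₂.
  have a1 := tendsto_rayLogIntegral_sub hj (τ := 0) hx (θ₁ := 0) (θ₂ := Real.pi / 3) (by linarith)
    (fun θ hθ => Or.inl ⟨rfl, Real.sin_nonneg_of_nonneg_of_le_pi hθ.1 (by linarith [hθ.2])⟩)
    (fun θ hθ => (Real.sin_pos_of_pos_of_lt_pi hθ.1 (by linarith [hθ.2])).ne')
  have a2 := tendsto_rayLogIntegral_sub hj (τ := 0) hx (θ₁ := 2 * Real.pi / 3) (θ₂ := Real.pi)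
    (by linarith)
    (fun θ hθ => Or.inl ⟨rfl, Real.sin_nonneg_of_nonneg_of_le_pi (by linarith [hθ.1]) hθ.2⟩)
    (fun θ hθ => (Real.sin_pos_of_pos_of_lt_pi (by linarith [hθ.1]) hθ.2).ne')
  -- For τ > 0 the rays 0, π/3, 2π/3, π are turned to -π/6, π/2, π/2, 7π/6, through sectors in which
  -- the full exponential does not grow.
  have e1 := tendsto_rayLogIntegral_sub hj hx (τ := τ) (θ₁ := -(Real.pi / 6)) (θ₂ := 0)
    (by linarith)
    (fun θ hθ => by
      have := decayDirection_of_neg (φ := -θ) hτ (by linarith [hθ.2]) (by linarith [hθ.1])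
      rwa [Real.sin_neg, neg_neg] at this)
    (fun θ hθ => (Real.sin_neg_of_neg_of_neg_pi_lt hθ.2 (by linarith [hθ.1])).ne)
  have e2 := tendsto_rayLogIntegral_sub hj hx (τ := τ) (θ₁ := Real.pi / 3) (θ₂ := Real.pi / 2)
    (by linarith) (fun θ hθ => decayDirection_of_sq hτ.le hθ.1 (by linarith [hθ.2]))
    (fun θ hθ => (Real.sin_pos_of_pos_of_lt_pi (by linarith [hθ.1]) (by linarith [hθ.2])).ne')
  have e3 := tendsto_rayLogIntegral_sub hj hx (τ := τ) (θ₁ := Real.pi / 2) (θ₂ := 2 * Real.pi / 3)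
    (by linarith) (fun θ hθ => decayDirection_of_sq hτ.le (by linarith [hθ.1]) hθ.2)
    (fun θ hθ => (Real.sin_pos_of_pos_of_lt_pi (by linarith [hθ.1]) (by linarith [hθ.2])).ne')
  have e4 := tendsto_rayLogIntegral_sub hj hx (τ := τ) (θ₁ := Real.pi)
    (θ₂ := Real.pi / 6 + Real.pi) (by linarith)
    (fun θ hθ => by
      have := decayDirection_of_neg (φ := θ - Real.pi) hτ (by linarith [hθ.1]) (by linarith [hθ.2])
      rwa [Real.sin_sub_pi, neg_neg] at this)
    (fun θ hθ => by
      have := Real.sin_pos_of_pos_of_lt_pi (x := θ - Real.pi) (by linarith [hθ.1])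
        (by linarith [hθ.2])
      rw [Real.sin_sub_pi] at this
      linarith)
  have hrot := tendsto_integral_rotatedSum hj hx hτ
  have hlim := ((((((a1.const_mul (weight₁ j)).add (a2.const_mul (weight₂ j))).add
    (e1.const_mul (weight₁ j))).add (e2.const_mul (weight₁ j))).add
    (e3.const_mul (weight₂ j))).add (e4.const_mul (weight₂ j))).sub hrot
  -- The angles attached to each weight sum to π/3 + π/6 + π/6 = 2π/3, as `weight_add_mul` requires.
  have hval : Complex.I * (stepPrim j 0 x τ : ℂ) =
      weight₁ j * (Complex.I * (((Real.pi / 3 - 0 : ℝ) : ℂ) * waveQuotZero j x)) +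
      weight₂ j * (Complex.I * (((Real.pi - 2 * Real.pi / 3 : ℝ) : ℂ) * waveQuotZero j x)) +
      weight₁ j * (Complex.I * (((0 - -(Real.pi / 6) : ℝ) : ℂ) * waveQuotZero j x)) +
      weight₁ j * (Complex.I * (((Real.pi / 2 - Real.pi / 3 : ℝ) : ℂ) * waveQuotZero j x)) +
      weight₂ j * (Complex.I * (((2 * Real.pi / 3 - Real.pi / 2 : ℝ) : ℂ) * waveQuotZero j x)) +
      weight₂ j * (Complex.I * (((Real.pi / 6 + Real.pi - Real.pi : ℝ) : ℂ) * waveQuotZero j x)) -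
      -Complex.I * ((∑' n, stepTerm j 0 x τ n : ℝ) : ℂ) := by
    have hw := weight_add_mul hj x
    have hf : ((0 + j).factorial : ℝ) = 1 := by rcases hj with rfl | rfl <;> simp
    rw [stepPrim, hf, zero_add, div_one]
    push_cast
    rw [← hw]
    ring
  rw [hval]
  refine hlim.congr' ?_
  filter_upwards [eventually_ge_atTop 1] with R hR
  have hRi : 0 < R⁻¹ := inv_pos.mpr (by linarith)
  have hle : R⁻¹ ≤ R := (inv_le_one_of_one_le₀ hR).trans hR
  have hI := fun θ => intervalIntegrable_waveQuot_polar_div j x τ θ hRi hle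
  have hr : ∫ ρ in R⁻¹..R, rotatedSum j x τ ρ / ρ =
      weight₁ j * (rayLogIntegral (waveQuot j x τ) (-(Real.pi / 6)) R⁻¹ R -
        rayLogIntegral (waveQuot j x τ) (Real.pi / 2) R⁻¹ R) +
      weight₂ j * (rayLogIntegral (waveQuot j x τ) (Real.pi / 2) R⁻¹ R -
        rayLogIntegral (waveQuot j x τ) (Real.pi / 6 + Real.pi) R⁻¹ R) := by
    simp only [rayLogIntegral]
    rw [← intervalIntegral.integral_sub (hI _) (hI _), ← intervalIntegral.integral_sub (hI _) (hI _),
      ← intervalIntegral.integral_const_mul, ← intervalIntegral.integral_const_mul,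
      ← intervalIntegral.integral_add (((hI _).sub (hI _)).const_mul _)
        (((hI _).sub (hI _)).const_mul _)]
    refine integral_congr fun ρ _ => ?_
    simp only [rotatedSum]
    ring
  rw [hr]
  simp only [stepRay]
  ring

/-! ### Superposition in time -/

/-- The truncated ray integral for the boundary datum `1`. -/
def unitRay (p : ℕ) (x θ R τ : ℝ) : ℂ := raySegmentIntegral θ (integrand p (fun _ => 1) x τ) R

lemma continuous_integrand_one (p : ℕ) (x : ℝ) :
    Continuous fun q : ℝ × ℂ => integrand p (fun _ => 1) x q.1 q.2 := by
  have h : Continuous fun q : ℝ × ℂ => timeTransform (fun _ => 1) (Complex.I * q.2 ^ 3) q.1 := by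
    refine continuous_parametric_intervalIntegral_of_continuous
      (f := fun (q : ℝ × ℂ) (s : ℝ) => Complex.exp (Complex.I * q.2 ^ 3 * (s : ℂ)) * 1) ?_
      continuous_fst
    unfold Function.uncurry
    fun_prop
  unfold integrand
  fun_prop

/-- The integrand of `raySegmentIntegral` for the datum `1`. -/
def rayIntegrand (p : ℕ) (x θ τ ρ : ℝ) : ℂ :=
  integrand p (fun _ => 1) x τ (polar ρ θ) * Complex.exp ((θ : ℂ) * Complex.I)

lemma continuous_rayIntegrand (p : ℕ) (x θ : ℝ) :
    Continuous fun q : ℝ × ℝ => rayIntegrand p x θ q.1 q.2 := by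
  have h := continuous_integrand_one p x
  have h2 : Continuous fun q : ℝ × ℝ => ((q.1, polar q.2 θ) : ℝ × ℂ) :=
    continuous_fst.prodMk ((continuous_polar_left θ).comp continuous_snd)
  exact (h.comp h2).mul continuous_const

lemma unitRay_eq (p : ℕ) (x θ R τ : ℝ) : unitRay p x θ R τ = ∫ ρ in (0 : ℝ)..R, rayIntegrand p x θ τ ρ :=
  rfl

lemma continuous_unitRay (p : ℕ) (x θ R : ℝ) : Continuous fun τ => unitRay p x θ R τ :=
  continuous_parametric_intervalIntegral_of_continuous (X := ℝ) (f := fun τ ρ => rayIntegrand p x θ τ ρ)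
    (continuous_rayIntegrand p x θ) continuous_const

lemma exp_mul_timeTransform (f : ℂ → ℂ) (w : ℂ) (t : ℝ) :
    Complex.exp (-(w * t)) * timeTransform f w t =
      ∫ s in (0 : ℝ)..t, Complex.exp (-(w * ((t - s : ℝ) : ℂ))) * f s := by
  rw [timeTransform, ← intervalIntegral.integral_const_mul]
  refine integral_congr fun s _ => ?_
  rw [← mul_assoc, ← Complex.exp_add]
  congr 2
  push_cast; ring

lemma exp_mul_timeTransform_one (w : ℂ) (t : ℝ) :
    Complex.exp (-(w * t)) * timeTransform (fun _ => 1) w t =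
      ∫ s in (0 : ℝ)..t, Complex.exp (-(w * (s : ℂ))) := by
  rw [exp_mul_timeTransform]
  have := intervalIntegral.integral_comp_sub_left (a := 0) (b := t)
    (fun s : ℝ => Complex.exp (-(w * (s : ℂ)))) t
  rw [sub_self, sub_zero] at this
  rw [← this]
  exact integral_congr fun s _ => by simp

lemma integrand_eq (p : ℕ) (f : ℂ → ℂ) (x t : ℝ) (k : ℂ) :
    integrand p f x t k = Complex.exp (Complex.I * k * x) * k ^ p *
      (Complex.exp (-(Complex.I * k ^ 3 * t)) * timeTransform f (Complex.I * k ^ 3) t) := by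
  rw [integrand, sub_eq_add_neg, Complex.exp_add]; ring

/-- Integration by parts in time: the response to a datum is a superposition of responses to the
datum `1`. -/
lemma integrand_eq_add_integral (p : ℕ) {f : ℂ → ℂ} {g : ℝ → ℂ} (x : ℝ) {t : ℝ} (ht : 0 ≤ t)
    (hf : ∀ s ∈ Set.Icc 0 t, HasDerivAt (fun s : ℝ => f s) (g s) s)
    (hg : ContinuousOn g (Set.Icc 0 t)) (k : ℂ) :
    integrand p f x t k = integrand p (fun _ => 1) x t k * f 0 +
      ∫ τ in (0 : ℝ)..t, integrand p (fun _ => 1) x τ k * g (t - τ) := by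
  set w : ℂ := Complex.I * k ^ 3 with hw
  set E : ℝ → ℂ := fun τ => ∫ s in (0 : ℝ)..τ, Complex.exp (-(w * (s : ℂ))) with hE
  have hEc : Continuous fun s : ℝ => Complex.exp (-(w * (s : ℂ))) := by fun_prop
  have hEd : ∀ τ : ℝ, HasDerivAt E (Complex.exp (-(w * (τ : ℂ)))) τ := fun τ =>
    integral_hasDerivAt_right (hEc.intervalIntegrable _ _)
      hEc.stronglyMeasurable.stronglyMeasurableAtFilter hEc.continuousAt
  have hE0 : E 0 = 0 := by simp [hE]
  have hu : Set.uIcc 0 t = Set.Icc 0 t := Set.uIcc_of_le ht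
  -- The antiderivative of the kernel is E(t - s), normalised by E 0 = 0. The boundary term at s = t
  -- drops out, and the one at s = 0 is the response to the constant f(0).
  have hibp := integral_mul_deriv_eq_deriv_mul (a := 0) (b := t) (u := fun s => E (t - s))
    (u' := fun s => -Complex.exp (-(w * ((t - s : ℝ) : ℂ)))) (v := fun s : ℝ => f s) (v' := g)
    (fun s _ => by
      have := (hEd (t - s)).scomp s ((hasDerivAt_id' s).const_sub t)
      simpa [Function.comp_def] using this)
    (fun s hs => hf s (hu ▸ hs))
    (Continuous.intervalIntegrable (by fun_prop) _ _)
    (ContinuousOn.intervalIntegrable (by rwa [hu]))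
  have hsub := intervalIntegral.integral_comp_sub_left (a := 0) (b := t)
    (fun τ : ℝ => E τ * g (t - τ)) t
  simp only [sub_sub_cancel, sub_self, sub_zero] at hsub
  rw [hsub] at hibp
  simp only [sub_self, hE0, sub_zero, zero_mul, zero_sub, neg_mul,
    intervalIntegral.integral_neg, sub_neg_eq_add] at hibp
  have h1 : ∀ τ : ℝ, integrand p (fun _ => 1) x τ k =
      Complex.exp (Complex.I * k * x) * k ^ p * E τ := fun τ => by
    rw [integrand_eq, exp_mul_timeTransform_one]
  have h2 : ∫ τ in (0 : ℝ)..t, integrand p (fun _ => 1) x τ k * g (t - τ) =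
      Complex.exp (Complex.I * k * x) * k ^ p * ∫ τ in (0 : ℝ)..t, E τ * g (t - τ) := by
    rw [← intervalIntegral.integral_const_mul]
    exact integral_congr fun τ _ => by simp only [h1]; ring
  rw [h2, hibp, h1, integrand_eq, exp_mul_timeTransform, Complex.ofReal_zero]
  ring

/-- The formula for the integrand, integrated along the truncated ray; Fubini is available because
the domain is a compact rectangle. -/
lemma raySegmentIntegral_eq_add_integral (p : ℕ) {f : ℂ → ℂ} {g : ℝ → ℂ} (x θ : ℝ) {t R : ℝ}
    (ht : 0 ≤ t) (hR : 0 ≤ R)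
    (hf : ∀ s ∈ Set.Icc 0 t, HasDerivAt (fun s : ℝ => f s) (g s) s)
    (hg : ContinuousOn g (Set.Icc 0 t)) :
    raySegmentIntegral θ (integrand p f x t) R = unitRay p x θ R t * f 0 +
      ∫ τ in (0 : ℝ)..t, unitRay p x θ R τ * g (t - τ) := by
  have hF := continuous_rayIntegrand p x θ
  have hgt : ContinuousOn (fun τ => g (t - τ)) (Set.Icc 0 t) :=
    hg.comp (by fun_prop) fun τ hτ => ⟨by linarith [hτ.2], by linarith [hτ.1]⟩
  have hC : ContinuousOn (fun q : ℝ × ℝ => rayIntegrand p x θ q.2 q.1 * g (t - q.2))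
      (Set.Icc 0 R ×ˢ Set.Icc 0 t) := by
    refine (hF.comp (continuous_snd.prodMk continuous_fst)).continuousOn.mul ?_
    exact hgt.comp continuous_snd.continuousOn fun q hq => hq.2
  have hint : IntegrableOn (fun q : ℝ × ℝ => rayIntegrand p x θ q.2 q.1 * g (t - q.2))
      (Set.uIoc 0 R ×ˢ Set.uIoc 0 t) := by
    refine (hC.integrableOn_compact (isCompact_Icc.prod isCompact_Icc)).mono_set ?_
    rw [Set.uIoc_of_le ht, Set.uIoc_of_le hR]
    exact Set.prod_mono Set.Ioc_subset_Icc_self Set.Ioc_subset_Icc_self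
  have hswap := intervalIntegral_intervalIntegral_swap
    (F := fun ρ τ => rayIntegrand p x θ τ ρ * g (t - τ)) hint
  have h1 : raySegmentIntegral θ (integrand p f x t) R =
      ∫ ρ in (0 : ℝ)..R, (rayIntegrand p x θ t ρ * f 0 +
        ∫ τ in (0 : ℝ)..t, rayIntegrand p x θ τ ρ * g (t - τ)) := by
    rw [raySegmentIntegral]
    refine integral_congr fun ρ _ => ?_
    rw [integrand_eq_add_integral p x ht hf hg, add_mul, ← intervalIntegral.integral_mul_const]
    congr 1
    · rw [rayIntegrand, polar]; ring
    · exact integral_congr fun τ _ => by simp only [rayIntegrand, polar]; ring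
  have h2 : IntervalIntegrable (fun ρ => ∫ τ in (0 : ℝ)..t, rayIntegrand p x θ τ ρ * g (t - τ))
      volume 0 R := by
    rw [intervalIntegrable_iff, Set.uIoc_of_le hR]
    rw [Set.uIoc_of_le hR, IntegrableOn, Measure.volume_eq_prod, ← Measure.prod_restrict] at hint
    have := hint.integral_prod_left
    simp only [Set.uIoc_of_le ht] at this
    refine this.congr (Eventually.of_forall fun ρ => ?_)
    simp only [intervalIntegral.integral_of_le ht]
  rw [h1, intervalIntegral.integral_add
    ((Continuous.intervalIntegrable (by fun_prop) _ _)) h2,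
    intervalIntegral.integral_mul_const, ← unitRay_eq, hswap]
  congr 1
  exact integral_congr fun τ _ => by
    simp only [unitRay_eq, intervalIntegral.integral_mul_const]

lemma integrand_one_eq (p : ℕ) (x τ : ℝ) (k : ℂ) :
    integrand p (fun _ => 1) x τ k = k ^ p * ∫ s in (0 : ℝ)..τ, wave x s k := by
  rw [integrand_eq, exp_mul_timeTransform_one, mul_comm (Complex.exp _) (k ^ p), mul_assoc,
    ← intervalIntegral.integral_const_mul]
  congr 1
  refine integral_congr fun s _ => ?_
  simp only [wave]
  rw [sub_eq_add_neg, Complex.exp_add]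

/-- The time integral is elementary. The subtracted `j` cancels in the difference; it is there to
keep each quotient bounded at k = 0 separately, so that the two halves can be rotated independently.
-/
lemma integrand_one_mul {j : ℕ} (hj : j = 0 ∨ j = 1) (x τ : ℝ) {k : ℂ} (hk : k ≠ 0) :
    integrand (2 - j) (fun _ => 1) x τ k * k =
      -Complex.I * (waveQuot j x 0 k - waveQuot j x τ k) := by
  have hw : Complex.I * k ^ 3 ≠ 0 := mul_ne_zero Complex.I_ne_zero (pow_ne_zero _ hk)
  have h1 : ∫ s in (0 : ℝ)..τ, wave x s k =
      Complex.exp (Complex.I * k * x) * ((Complex.exp (-(Complex.I * k ^ 3) * τ) - 1) /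
        (-(Complex.I * k ^ 3))) := by
    have := integral_exp_mul_complex (a := 0) (b := τ) (neg_ne_zero.mpr hw)
    rw [Complex.ofReal_zero, mul_zero, Complex.exp_zero] at this
    rw [← this, ← intervalIntegral.integral_const_mul]
    refine integral_congr fun s _ => ?_
    simp only [wave]
    rw [← Complex.exp_add]
    congr 1; ring
  have h2 : wave x τ k = Complex.exp (Complex.I * k * x) * Complex.exp (-(Complex.I * k ^ 3) * τ) := by
    rw [wave, ← Complex.exp_add]; congr 1; ring
  have h3 : wave x 0 k = Complex.exp (Complex.I * k * x) := by
    rw [wave, Complex.ofReal_zero, mul_zero, sub_zero]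
  rw [integrand_one_eq, h1, waveQuot, waveQuot, h2, h3]
  have hI := Complex.I_sq
  have hI0 := Complex.I_ne_zero
  generalize Complex.exp (Complex.I * k * x) = a
  generalize Complex.exp (-(Complex.I * k ^ 3) * τ) = b
  rcases hj with rfl | rfl
  · generalize Complex.I = i at *
    simp only [Nat.sub_zero, pow_zero, Nat.cast_zero, div_one]
    field_simp
    linear_combination (a - a * b) * hI
  · generalize Complex.I = i at *
    simp only [show 2 - 1 = 1 from rfl, pow_one, Nat.cast_one]
    field_simp
    linear_combination (a - a * b) * hI

lemma rayIntegrand_eq {j : ℕ} (hj : j = 0 ∨ j = 1) (x θ τ : ℝ) {ρ : ℝ} (hρ : ρ ≠ 0) :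
    rayIntegrand (2 - j) x θ τ ρ =
      -Complex.I * (waveQuot j x 0 (polar ρ θ) - waveQuot j x τ (polar ρ θ)) / ρ := by
  have hρ' : (ρ : ℂ) ≠ 0 := by exact_mod_cast hρ
  rw [← integrand_one_mul hj x τ (polar_ne_zero hρ θ), rayIntegrand, eq_div_iff hρ']
  simp only [polar]; ring

lemma intervalIntegrable_rayIntegrand (p : ℕ) (x θ τ a b : ℝ) :
    IntervalIntegrable (rayIntegrand p x θ τ) volume a b :=
  ((continuous_rayIntegrand p x θ).comp
    (continuous_const.prodMk continuous_id)).intervalIntegrable a b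

lemma unitRay_sub (p : ℕ) (x θ A R τ : ℝ) :
    unitRay p x θ R τ - unitRay p x θ A τ = ∫ ρ in A..R, rayIntegrand p x θ τ ρ :=
  intervalIntegral.integral_interval_sub_left (intervalIntegrable_rayIntegrand p x θ τ 0 R)
    (intervalIntegrable_rayIntegrand p x θ τ 0 A)

lemma unitRay_sub_eq_stepRay {j : ℕ} (hj : j = 0 ∨ j = 1) (x θ τ : ℝ) {R : ℝ} (hR : 1 ≤ R) :
    unitRay (2 - j) x θ R τ - unitRay (2 - j) x θ R⁻¹ τ = -Complex.I * stepRay j x τ θ R := by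
  have hRi : 0 < R⁻¹ := inv_pos.mpr (by linarith)
  have hle : R⁻¹ ≤ R := (inv_le_one_of_one_le₀ hR).trans hR
  rw [unitRay_sub, stepRay, rayLogIntegral, rayLogIntegral,
    ← intervalIntegral.integral_sub (intervalIntegrable_waveQuot_polar_div j x 0 θ hRi hle)
      (intervalIntegrable_waveQuot_polar_div j x τ θ hRi hle),
    ← intervalIntegral.integral_const_mul]
  refine integral_congr fun ρ hρ => ?_
  rw [Set.uIcc_of_le hle] at hρ
  rw [rayIntegrand_eq hj x θ τ (hRi.trans_le hρ.1).ne']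
  ring

/-! ### Convergence of the ray integrals, uniformly in time -/

/-- The directions of the rays that bound `Ω₁` and `Ω₂`. -/
def IsBoundaryRay (θ : ℝ) : Prop :=
  Real.sin θ * (3 - 4 * Real.sin θ ^ 2) = 0 ∧ 0 ≤ Real.sin θ ∧
    (Real.sin θ = 0 → θ = 0 ∨ θ = Real.pi)

lemma isBoundaryRay_zero : IsBoundaryRay 0 := by simp [IsBoundaryRay]

lemma isBoundaryRay_pi : IsBoundaryRay Real.pi := by simp [IsBoundaryRay]

lemma isBoundaryRay_pi_div_three : IsBoundaryRay (Real.pi / 3) := by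
  have h3 : Real.sqrt 3 ^ 2 = 3 := Real.sq_sqrt (by norm_num)
  have h0 : 0 < Real.sqrt 3 := Real.sqrt_pos.mpr (by norm_num)
  rw [IsBoundaryRay, Real.sin_pi_div_three]
  refine ⟨?_, by positivity, fun h => absurd h (by positivity)⟩
  rw [div_pow, h3]; norm_num

lemma isBoundaryRay_two_pi_div_three : IsBoundaryRay (2 * Real.pi / 3) := by
  have e : 2 * Real.pi / 3 = Real.pi - Real.pi / 3 := by ring
  have h := isBoundaryRay_pi_div_three
  have h0 : 0 < Real.sqrt 3 := Real.sqrt_pos.mpr (by norm_num)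
  rw [IsBoundaryRay, e, Real.sin_pi_sub]
  refine ⟨h.1, h.2.1, fun h' => ?_⟩
  rw [Real.sin_pi_div_three] at h'
  exact absurd h' (by positivity)

lemma norm_wave_of_isBoundaryRay {θ : ℝ} (hθ : IsBoundaryRay θ) (x τ ρ : ℝ) :
    ‖wave x τ (polar ρ θ)‖ = Real.exp (-(ρ * x * Real.sin θ)) := by
  rw [norm_wave_polar, hθ.1, mul_zero, add_zero]

lemma norm_wave_le_one {θ : ℝ} (hθ : IsBoundaryRay θ) {x ρ : ℝ} (hx : 0 ≤ x) (hρ : 0 ≤ ρ) (τ : ℝ) :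
    ‖wave x τ (polar ρ θ)‖ ≤ 1 := by
  rw [norm_wave_of_isBoundaryRay hθ, Real.exp_le_one_iff, neg_nonpos]
  exact mul_nonneg (mul_nonneg hρ hx) hθ.2.1

lemma norm_rayIntegrand_le {θ : ℝ} (hθ : IsBoundaryRay θ) (p : ℕ) {x τ ρ : ℝ} (hx : 0 ≤ x)
    (hτ : 0 ≤ τ) (hρ : 0 ≤ ρ) : ‖rayIntegrand p x θ τ ρ‖ ≤ ρ ^ p * τ := by
  rw [rayIntegrand, integrand_one_eq, norm_mul, norm_mul, norm_pow, norm_polar hρ,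
    Complex.norm_exp_ofReal_mul_I, mul_one]
  gcongr
  have := intervalIntegral.norm_integral_le_of_norm_le_const (a := 0) (b := τ)
    (f := fun s : ℝ => wave x s (polar ρ θ)) (C := 1) fun s _ => norm_wave_le_one hθ hx hρ s
  rwa [one_mul, sub_zero, abs_of_nonneg hτ] at this

/-- The powers of R make the piece near k = 0 negligible; the factor τ makes truncated responses
vanish at time 0. -/
lemma norm_unitRay_le {θ : ℝ} (hθ : IsBoundaryRay θ) (p : ℕ) {x τ R : ℝ} (hx : 0 ≤ x)
    (hτ : 0 ≤ τ) (hR : 0 ≤ R) : ‖unitRay p x θ R τ‖ ≤ R ^ p * τ * R := by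
  have := intervalIntegral.norm_integral_le_of_norm_le_const (a := 0) (b := R)
    (f := rayIntegrand p x θ τ) (C := R ^ p * τ) fun ρ hρ => by
      rw [Set.uIoc_of_le hR] at hρ
      refine (norm_rayIntegrand_le hθ p hx hτ hρ.1.le).trans ?_
      have := hρ.1.le
      gcongr
      exact hρ.2
  rwa [sub_zero, abs_of_nonneg hR] at this

/-- The true rate 1/A is weakened to A^{-1/2}, to share one form with the van der Corput bound. -/
lemma norm_integral_le_of_norm_le_div_sq {F : ℝ → ℂ} {C A R : ℝ} (hC : 0 ≤ C) (hA : 1 ≤ A)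
    (hAR : A ≤ R) (hF : ∀ ρ ∈ Set.Icc A R, ‖F ρ‖ ≤ C / ρ ^ 2) :
    ‖∫ ρ in A..R, F ρ‖ ≤ C / Real.sqrt A := by
  have hA0 : 0 < A := by linarith
  have hne : ∀ ρ ∈ Set.Icc A R, ρ ≠ 0 := fun ρ hρ => (hA0.trans_le hρ.1).ne'
  have hd : ∀ ρ ∈ Set.uIcc A R, HasDerivAt (fun ρ : ℝ => -(C * ρ⁻¹)) (C / ρ ^ 2) ρ := fun ρ hρ => by
    rw [Set.uIcc_of_le hAR] at hρ
    refine (((hasDerivAt_inv (hne ρ hρ)).const_mul C).neg).congr_deriv ?_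
    rw [mul_neg, neg_neg, div_eq_mul_inv]
  have hi : IntervalIntegrable (fun ρ : ℝ => C / ρ ^ 2) volume A R := by
    refine ContinuousOn.intervalIntegrable ?_
    rw [Set.uIcc_of_le hAR]
    exact continuousOn_const.div (by fun_prop) fun ρ hρ => pow_ne_zero _ (hne ρ hρ)
  refine (norm_integral_le_of_norm_le hAR (Eventually.of_forall fun ρ hρ =>
    hF ρ (Set.Ioc_subset_Icc_self hρ)) hi).trans ?_
  rw [integral_eq_sub_of_hasDerivAt hd hi]
  have h1 : 0 ≤ C * R⁻¹ := mul_nonneg hC (inv_nonneg.mpr (by linarith))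
  have h2 : C * A⁻¹ ≤ C / Real.sqrt A := by
    rw [div_eq_mul_inv]
    gcongr
    exact Real.sqrt_le_iff.mpr ⟨by linarith, by nlinarith⟩
  linarith

lemma wave_polar_zero (x τ ρ : ℝ) : wave x τ (polar ρ 0) = airyPhase x τ ρ := by
  rw [wave, airyPhase, polar]
  congr 1
  simp
  ring

lemma wave_polar_pi (x τ ρ : ℝ) :
    wave x τ (polar ρ Real.pi) = (starRingEnd ℂ) (airyPhase x τ ρ) := by
  rw [wave, airyPhase, polar, ← Complex.exp_conj]
  congr 1
  simp
  ring

lemma norm_integral_conj_airyPhase (x τ A R : ℝ) :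
    ‖∫ ρ in A..R, (starRingEnd ℂ) (airyPhase x τ ρ) / (ρ : ℂ)‖ =
      ‖∫ ρ in A..R, airyPhase x τ ρ / (ρ : ℂ)‖ := by
  have h : ∫ ρ in A..R, (starRingEnd ℂ) (airyPhase x τ ρ) / (ρ : ℂ) =
      (starRingEnd ℂ) (∫ ρ in A..R, airyPhase x τ ρ / (ρ : ℂ)) := by
    rw [← intervalIntegral.intervalIntegral_conj]
    exact integral_congr fun ρ _ => by simp
  rw [h, RCLike.norm_conj]

/-- The truncated ray integrals for the datum `1` converge uniformly in time. -/
lemma exists_norm_unitRay_sub_le {j : ℕ} (hj : j = 0 ∨ j = 1) {x θ : ℝ} (hx : 0 < x)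
    (hθ : IsBoundaryRay θ) :
    ∃ C, 0 ≤ C ∧ ∀ τ, 0 ≤ τ → ∀ A R, 1 ≤ A → A ≤ R →
      ‖unitRay (2 - j) x θ R τ - unitRay (2 - j) x θ A τ‖ ≤ C / Real.sqrt A := by
  have hnorm : ∀ τ ρ : ℝ, 0 < ρ → ‖rayIntegrand (2 - j) x θ τ ρ‖ ≤
      2 * Real.exp (-(ρ * x * Real.sin θ)) / ρ ^ (j + 1) := fun τ ρ hρ => by
    have e : waveQuot j x 0 (polar ρ θ) - waveQuot j x τ (polar ρ θ) =
        (wave x 0 (polar ρ θ) - wave x τ (polar ρ θ)) / polar ρ θ ^ j := by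
      simp only [waveQuot]; ring
    rw [rayIntegrand_eq hj x θ τ hρ.ne', e, norm_div, norm_mul, norm_neg, Complex.norm_I, one_mul,
      norm_div, norm_pow, norm_polar hρ.le, Complex.norm_real, Real.norm_of_nonneg hρ.le, div_div,
      ← pow_succ]
    gcongr
    refine (norm_sub_le _ _).trans ?_
    rw [norm_wave_of_isBoundaryRay hθ, norm_wave_of_isBoundaryRay hθ]
    linarith
  rcases hθ.2.1.eq_or_lt with hs | hs
  -- On the real rays nothing decays exponentially. For j = 0 the integrand is only of size 1/ρ and
  -- cancellation is needed; for j = 1 it is of size 1/ρ² and converges absolutely.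
  · rcases hj with rfl | rfl
    · refine ⟨2 * (20 / x + 1), by positivity, fun τ hτ A R hA hAR => ?_⟩
      have hA0 : 0 < A := by linarith
      have hi : ∀ τ, IntervalIntegrable (fun ρ : ℝ => airyPhase x τ ρ / (ρ : ℂ)) volume A R :=
        fun τ => ContinuousOn.intervalIntegrable (by
          rw [Set.uIcc_of_le hAR]; exact continuousOn_airyPhase_div x τ hA0)
      have hq : ∀ τ k, waveQuot 0 x τ k = wave x τ k := fun τ k => by simp [waveQuot]
      have hb : ∀ τ, 0 ≤ τ → ‖∫ ρ in A..R, wave x τ (polar ρ θ) / (ρ : ℂ)‖ ≤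
          (20 / x + 1) / Real.sqrt A := fun τ hτ => by
        refine le_trans (le_of_eq ?_) (norm_integral_airyPhase_div_le hx hτ hA hAR)
        rcases hθ.2.2 hs.symm with rfl | rfl
        · simp only [wave_polar_zero]
        · simp only [wave_polar_pi]
          exact norm_integral_conj_airyPhase x τ A R
      have hwi : ∀ τ, IntervalIntegrable (fun ρ : ℝ => wave x τ (polar ρ θ) / (ρ : ℂ)) volume A R :=
        fun τ => by
          simpa only [hq] using intervalIntegrable_waveQuot_polar_div 0 x τ θ hA0 hAR
      have e : ∫ ρ in A..R, rayIntegrand (2 - 0) x θ τ ρ = -Complex.I *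
          ((∫ ρ in A..R, wave x 0 (polar ρ θ) / (ρ : ℂ)) -
            ∫ ρ in A..R, wave x τ (polar ρ θ) / (ρ : ℂ)) := by
        rw [← intervalIntegral.integral_sub (hwi 0) (hwi τ), ← intervalIntegral.integral_const_mul]
        refine integral_congr fun ρ hρ => ?_
        rw [Set.uIcc_of_le hAR] at hρ
        rw [rayIntegrand_eq (Or.inl rfl) x θ τ (hA0.trans_le hρ.1).ne', hq, hq]
        ring
      rw [unitRay_sub, e, norm_mul, norm_neg, Complex.norm_I, one_mul]
      refine (norm_sub_le _ _).trans ?_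
      have := hb 0 le_rfl
      have := hb τ hτ
      rw [mul_div_assoc]
      linarith
    · refine ⟨2, by norm_num, fun τ hτ A R hA hAR => ?_⟩
      rw [unitRay_sub]
      refine norm_integral_le_of_norm_le_div_sq (by norm_num) hA hAR fun ρ hρ => ?_
      have := hnorm τ ρ (by linarith [hρ.1])
      rwa [← hs, mul_zero, neg_zero, Real.exp_zero, mul_one] at this
  -- On the oblique rays e^{ikx} decays; e^{-y} ≤ 1/y is enough to reach 1/ρ².
  · refine ⟨2 / (x * Real.sin θ), by positivity, fun τ hτ A R hA hAR => ?_⟩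
    rw [unitRay_sub]
    refine norm_integral_le_of_norm_le_div_sq (by positivity) hA hAR fun ρ hρ => ?_
    have hρ1 : 1 ≤ ρ := hA.trans hρ.1
    have hρ0 : 0 < ρ := by linarith
    refine (hnorm τ ρ hρ0).trans ?_
    have hy : 0 < ρ * x * Real.sin θ := by positivity
    have h1 : Real.exp (-(ρ * x * Real.sin θ)) ≤ 1 / (ρ * x * Real.sin θ) := by
      rw [Real.exp_neg, ← one_div]
      exact one_div_le_one_div_of_le hy (by linarith [Real.add_one_le_exp (ρ * x * Real.sin θ)])
    have h2 : ρ ≤ ρ ^ (j + 1) := le_self_pow₀ hρ1 (by omega)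
    calc 2 * Real.exp (-(ρ * x * Real.sin θ)) / ρ ^ (j + 1)
        ≤ 2 * (1 / (ρ * x * Real.sin θ)) / ρ := by gcongr
      _ = 2 / (x * Real.sin θ) / ρ ^ 2 := by field_simp

lemma tendsto_const_div_sqrt (C : ℝ) : Tendsto (fun A : ℝ => C / Real.sqrt A) atTop (𝓝 0) :=
  tendsto_const_nhds.div_atTop Real.tendsto_sqrt_atTop

lemma exists_tendsto_of_norm_sub_le {F : ℝ → ℂ} {C : ℝ}
    (hF : ∀ A R, 1 ≤ A → A ≤ R → ‖F R - F A‖ ≤ C / Real.sqrt A) :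
    ∃ L, Tendsto F atTop (𝓝 L) := by
  refine cauchySeq_tendsto_of_complete (Metric.cauchySeq_iff'.mpr fun ε hε => ?_)
  obtain ⟨N, hN1, hN⟩ := ((eventually_ge_atTop 1).and
    ((tendsto_const_div_sqrt C).eventually_lt_const hε)).exists
  refine ⟨N, fun R hR => ?_⟩
  rw [dist_eq_norm]
  exact (hF N R hN1 hR).trans_lt hN

/-! ### The response to the constant datum and to a general datum -/

/-- The combination of the ray integrals for the datum `1`. -/
def unitResponse (j : ℕ) (x R τ : ℝ) : ℂ :=
  weight₁ j * (unitRay (2 - j) x 0 R τ - unitRay (2 - j) x (Real.pi / 3) R τ) +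
    weight₂ j * (unitRay (2 - j) x (2 * Real.pi / 3) R τ - unitRay (2 - j) x Real.pi R τ)

lemma continuous_unitResponse (j : ℕ) (x R : ℝ) : Continuous fun τ => unitResponse j x R τ := by
  have := fun θ => continuous_unitRay (2 - j) x θ R
  exact (continuous_const.mul ((this _).sub (this _))).add
    (continuous_const.mul ((this _).sub (this _)))

lemma norm_weighted_le {w₁ w₂ a b c d : ℂ} {A B C D : ℝ} (ha : ‖a‖ ≤ A) (hb : ‖b‖ ≤ B)
    (hc : ‖c‖ ≤ C) (hd : ‖d‖ ≤ D) :
    ‖w₁ * (a - b) + w₂ * (c - d)‖ ≤ ‖w₁‖ * (A + B) + ‖w₂‖ * (C + D) := by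
  refine (norm_add_le _ _).trans ?_
  rw [norm_mul, norm_mul]
  gcongr
  · exact (norm_sub_le _ _).trans (add_le_add ha hb)
  · exact (norm_sub_le _ _).trans (add_le_add hc hd)

lemma norm_unitResponse_le (j : ℕ) {x τ R : ℝ} (hx : 0 ≤ x) (hτ : 0 ≤ τ) (hR : 0 ≤ R) :
    ‖unitResponse j x R τ‖ ≤ 2 * (‖weight₁ j‖ + ‖weight₂ j‖) * (R ^ (2 - j) * τ * R) := by
  have h := fun θ (hθ : IsBoundaryRay θ) => norm_unitRay_le hθ (2 - j) hx hτ hR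
  refine (norm_weighted_le (h _ isBoundaryRay_zero) (h _ isBoundaryRay_pi_div_three)
    (h _ isBoundaryRay_two_pi_div_three) (h _ isBoundaryRay_pi)).trans (le_of_eq ?_)
  ring

lemma exists_norm_unitResponse_sub_le {j : ℕ} (hj : j = 0 ∨ j = 1) {x : ℝ} (hx : 0 < x) :
    ∃ C, 0 ≤ C ∧ ∀ τ, 0 ≤ τ → ∀ A R, 1 ≤ A → A ≤ R →
      ‖unitResponse j x R τ - unitResponse j x A τ‖ ≤ C / Real.sqrt A := by
  obtain ⟨C₁, hC₁, h₁⟩ := exists_norm_unitRay_sub_le hj hx isBoundaryRay_zero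
  obtain ⟨C₂, hC₂, h₂⟩ := exists_norm_unitRay_sub_le hj hx isBoundaryRay_pi_div_three
  obtain ⟨C₃, hC₃, h₃⟩ := exists_norm_unitRay_sub_le hj hx isBoundaryRay_two_pi_div_three
  obtain ⟨C₄, hC₄, h₄⟩ := exists_norm_unitRay_sub_le hj hx isBoundaryRay_pi
  refine ⟨‖weight₁ j‖ * (C₁ + C₂) + ‖weight₂ j‖ * (C₃ + C₄), by positivity,
    fun τ hτ A R hA hAR => ?_⟩
  refine le_trans (le_of_eq (congrArg _ ?_)) ((norm_weighted_le (w₁ := weight₁ j) (w₂ := weight₂ j)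
    (h₁ τ hτ A R hA hAR) (h₂ τ hτ A R hA hAR) (h₃ τ hτ A R hA hAR)
    (h₄ τ hτ A R hA hAR)).trans (le_of_eq ?_))
  · simp only [unitResponse]; ring
  · ring

/-- The contour computation runs over R⁻¹ ≤ |k| ≤ R; the missing piece |k| ≤ R⁻¹ tends to 0. -/
lemma tendsto_unitResponse {j : ℕ} (hj : j = 0 ∨ j = 1) {x τ : ℝ} (hx : 0 < x) (hτ : 0 < τ) :
    Tendsto (fun R => unitResponse j x R τ) atTop (𝓝 (stepPrim j 0 x τ : ℂ)) := by
  have h1 := (tendsto_stepRay hj hx hτ).const_mul (-Complex.I)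
  have e : -Complex.I * (Complex.I * (stepPrim j 0 x τ : ℂ)) = stepPrim j 0 x τ := by
    rw [← mul_assoc, neg_mul, Complex.I_mul_I, neg_neg, one_mul]
  rw [e] at h1
  have h2 : Tendsto (fun R : ℝ => unitResponse j x R⁻¹ τ) atTop (𝓝 0) := by
    have hlim : Tendsto (fun R : ℝ => 2 * (‖weight₁ j‖ + ‖weight₂ j‖) *
        (R⁻¹ ^ (2 - j) * τ * R⁻¹)) atTop (𝓝 0) := by
      have h0 := tendsto_inv_atTop_zero (𝕜 := ℝ)
      simpa using (((h0.pow (2 - j)).mul_const τ).mul h0).const_mul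
        (2 * (‖weight₁ j‖ + ‖weight₂ j‖))
    refine squeeze_zero_norm' ?_ hlim
    filter_upwards [eventually_gt_atTop 0] with R hR
    exact norm_unitResponse_le j hx.le hτ.le (inv_nonneg.mpr hR.le)
  have h3 := h1.add h2
  rw [add_zero] at h3
  refine h3.congr' ?_
  filter_upwards [eventually_ge_atTop 1] with R hR
  have h := fun θ => unitRay_sub_eq_stepRay hj x θ τ hR
  simp only [unitResponse]
  linear_combination -(weight₁ j) * (h 0 - h (Real.pi / 3)) -
    weight₂ j * (h (2 * Real.pi / 3) - h Real.pi)

/-- Letting R → ∞ in the Cauchy estimate keeps a rate independent of τ. This controls `stepPrim` as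
τ → 0, where its series has negative powers of τ and gives no direct bound. -/
lemma norm_stepPrim_sub_le {j : ℕ} (hj : j = 0 ∨ j = 1) {x : ℝ} (hx : 0 < x) :
    ∃ C, 0 ≤ C ∧ ∀ τ, 0 < τ → ∀ A, 1 ≤ A →
      ‖(stepPrim j 0 x τ : ℂ) - unitResponse j x A τ‖ ≤ C / Real.sqrt A := by
  obtain ⟨C, hC, h⟩ := exists_norm_unitResponse_sub_le hj hx
  refine ⟨C, hC, fun τ hτ A hA => ?_⟩
  refine le_of_tendsto ((tendsto_unitResponse hj hx hτ).sub_const _).norm ?_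
  filter_upwards [eventually_ge_atTop A] with R hR
  exact h τ hτ.le A R hA hR

/-- The response to the datum `1` vanishes at time `0`. -/
lemma tendsto_stepPrim_zero {j : ℕ} (hj : j = 0 ∨ j = 1) {x : ℝ} (hx : 0 < x) :
    Tendsto (fun τ => stepPrim j 0 x τ) (𝓝[>] 0) (𝓝 0) := by
  obtain ⟨C, hC, h⟩ := norm_stepPrim_sub_le hj hx
  rw [Metric.tendsto_nhds]
  intro ε hε
  -- A is fixed first, uniformly in τ; then τ is made small using continuity of the truncated
  -- response, which is 0 at τ = 0.
  obtain ⟨A, hA1, hA⟩ := ((eventually_ge_atTop 1).and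
    ((tendsto_const_div_sqrt C).eventually_lt_const (half_pos hε))).exists
  have h0 : unitResponse j x A 0 = 0 := by
    have := norm_unitResponse_le j hx.le (le_refl (0 : ℝ)) (by linarith : 0 ≤ A)
    rw [mul_zero, zero_mul, mul_zero] at this
    exact norm_le_zero_iff.mp this
  have hc := ((continuous_unitResponse j x A).tendsto 0).norm
  rw [h0, norm_zero] at hc
  filter_upwards [self_mem_nhdsWithin,
    nhdsWithin_le_nhds (hc.eventually_lt_const (half_pos hε))] with τ hτ hτ'
  have h1 := h τ hτ A hA1
  rw [dist_zero_right, ← Complex.norm_real]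
  calc ‖(stepPrim j 0 x τ : ℂ)‖
      = ‖((stepPrim j 0 x τ : ℂ) - unitResponse j x A τ) + unitResponse j x A τ‖ := by
        rw [sub_add_cancel]
    _ ≤ _ := norm_add_le _ _
    _ < ε := by linarith

/-- The Cauchy estimate for the datum 1 is uniform in τ, so it survives the superposition in time.
-/
lemma exists_raySegmentIntegral_tendsto {j : ℕ} (hj : j = 0 ∨ j = 1) {x θ t : ℝ} (hx : 0 < x)
    (hθ : IsBoundaryRay θ) (ht : 0 ≤ t) {f : ℂ → ℂ} {g : ℝ → ℂ}
    (hf : ∀ s ∈ Set.Icc 0 t, HasDerivAt (fun s : ℝ => f s) (g s) s)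
    (hg : ContinuousOn g (Set.Icc 0 t)) :
    ∃ L, Tendsto (raySegmentIntegral θ (integrand (2 - j) f x t)) atTop (𝓝 L) := by
  obtain ⟨C, hC, h⟩ := exists_norm_unitRay_sub_le hj hx hθ
  have hgt : ContinuousOn (fun τ => g (t - τ)) (Set.uIcc 0 t) := by
    rw [Set.uIcc_of_le ht]
    exact hg.comp (by fun_prop) fun τ hτ => ⟨by linarith [hτ.2], by linarith [hτ.1]⟩
  have hi : ∀ R, IntervalIntegrable (fun τ => unitRay (2 - j) x θ R τ * g (t - τ)) volume 0 t :=
    fun R => ContinuousOn.intervalIntegrable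
      ((continuous_unitRay (2 - j) x θ R).continuousOn.mul hgt)
  refine exists_tendsto_of_norm_sub_le (C := C * (‖f 0‖ + ∫ τ in (0 : ℝ)..t, ‖g (t - τ)‖))
    fun A R hA hAR => ?_
  have hA0 : 0 < A := by linarith
  rw [raySegmentIntegral_eq_add_integral (2 - j) x θ ht (by linarith) hf hg,
    raySegmentIntegral_eq_add_integral (2 - j) x θ ht (by linarith) hf hg, add_sub_add_comm,
    ← sub_mul, ← intervalIntegral.integral_sub (hi R) (hi A)]
  refine (norm_add_le _ _).trans ?_
  rw [mul_add, add_div]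
  refine add_le_add ?_ ?_
  · rw [norm_mul, mul_div_right_comm]
    exact mul_le_mul_of_nonneg_right (h t ht A R hA hAR) (norm_nonneg _)
  · rw [mul_div_right_comm, ← intervalIntegral.integral_const_mul]
    refine norm_integral_le_of_norm_le ht (Eventually.of_forall fun τ hτ => ?_)
      (ContinuousOn.intervalIntegrable (continuousOn_const.mul hgt.norm))
    rw [← sub_mul, norm_mul]
    exact mul_le_mul_of_nonneg_right (h τ hτ.1.le A R hA hAR) (norm_nonneg _)

/-- The boundary integrals converge, and they are a superposition of responses to the datum `1`. -/
theorem boundary_integrals_eq {j : ℕ} (hj : j = 0 ∨ j = 1) {x t : ℝ} (hx : 0 < x)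
    (ht : 0 < t) {f : ℂ → ℂ} {g : ℝ → ℂ}
    (hf : ∀ s ∈ Set.Icc 0 t, HasDerivAt (fun s : ℝ => f s) (g s) s)
    (hg : ContinuousOn g (Set.Icc 0 t)) :
    ConvergesΩ (integrand (2 - j) f x t) ∧
      weight₁ j * integralΩ₁ (integrand (2 - j) f x t) +
        weight₂ j * integralΩ₂ (integrand (2 - j) f x t) =
      stepPrim j 0 x t * f 0 + ∫ τ in (0 : ℝ)..t, (stepPrim j 0 x τ : ℂ) * g (t - τ) := by
  obtain ⟨L₁, hL₁⟩ := exists_raySegmentIntegral_tendsto hj hx isBoundaryRay_zero ht.le hf hg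
  obtain ⟨L₂, hL₂⟩ := exists_raySegmentIntegral_tendsto hj hx isBoundaryRay_pi_div_three ht.le hf hg
  obtain ⟨L₃, hL₃⟩ :=
    exists_raySegmentIntegral_tendsto hj hx isBoundaryRay_two_pi_div_three ht.le hf hg
  obtain ⟨L₄, hL₄⟩ := exists_raySegmentIntegral_tendsto hj hx isBoundaryRay_pi ht.le hf hg
  have h₁ : Tendsto (sectorBoundaryPartial 0 (Real.pi / 3) (integrand (2 - j) f x t)) atTop
    (𝓝 (L₁ - L₂)) := hL₁.sub hL₂
  have h₂ : Tendsto (sectorBoundaryPartial (2 * Real.pi / 3) Real.pi (integrand (2 - j) f x t)) atTop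
    (𝓝 (L₃ - L₄)) := hL₃.sub hL₄
  refine ⟨⟨⟨_, h₁⟩, ⟨_, h₂⟩⟩, ?_⟩
  rw [integralΩ₁, integralΩ₂, sectorBoundaryIntegral, sectorBoundaryIntegral, h₁.limUnder_eq,
    h₂.limUnder_eq]
  refine tendsto_nhds_unique ((h₁.const_mul (weight₁ j)).add (h₂.const_mul (weight₂ j))) ?_
  have hgt : ContinuousOn (fun τ => g (t - τ)) (Set.uIcc 0 t) := by
    rw [Set.uIcc_of_le ht.le]
    exact hg.comp (by fun_prop) fun τ hτ => ⟨by linarith [hτ.2], by linarith [hτ.1]⟩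
  obtain ⟨C, hC, hCb⟩ := exists_norm_unitResponse_sub_le hj hx
  -- Comparison with the truncation at radius 1 gives a majorant independent of R and τ, for
  -- dominated convergence.
  have hb1 : ∀ R, 1 ≤ R → ∀ τ ∈ Set.Icc 0 t, ‖unitResponse j x R τ‖ ≤
      C + 2 * (‖weight₁ j‖ + ‖weight₂ j‖) * t := fun R hR τ hτ => by
    have h1 := hCb τ hτ.1 1 R le_rfl hR
    have h2 := norm_unitResponse_le j hx.le hτ.1 (zero_le_one' ℝ)
    rw [Real.sqrt_one, div_one] at h1
    rw [one_pow, one_mul, mul_one] at h2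
    have h3 : 2 * (‖weight₁ j‖ + ‖weight₂ j‖) * τ ≤ 2 * (‖weight₁ j‖ + ‖weight₂ j‖) * t := by
      gcongr; exact hτ.2
    calc ‖unitResponse j x R τ‖
        = ‖(unitResponse j x R τ - unitResponse j x 1 τ) + unitResponse j x 1 τ‖ := by
          rw [sub_add_cancel]
      _ ≤ _ := norm_add_le _ _
      _ ≤ _ := by linarith
  have hlim : Tendsto (fun R => unitResponse j x R t * f 0 +
      ∫ τ in (0 : ℝ)..t, unitResponse j x R τ * g (t - τ)) atTop
      (𝓝 (stepPrim j 0 x t * f 0 + ∫ τ in (0 : ℝ)..t, (stepPrim j 0 x τ : ℂ) * g (t - τ))) := by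
    refine ((tendsto_unitResponse hj hx ht).mul_const _).add ?_
    refine tendsto_integral_filter_of_dominated_convergence
      (fun τ => (C + 2 * (‖weight₁ j‖ + ‖weight₂ j‖) * t) * ‖g (t - τ)‖) ?_ ?_ ?_ ?_
    · refine Eventually.of_forall fun R => ?_
      rw [Set.uIoc_of_le ht.le]
      rw [Set.uIcc_of_le ht.le] at hgt
      exact (((continuous_unitResponse j x R).continuousOn.mul hgt).mono
        Set.Ioc_subset_Icc_self).aestronglyMeasurable measurableSet_Ioc
    · filter_upwards [eventually_ge_atTop 1] with R hR
      refine Eventually.of_forall fun τ hτ => ?_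
      rw [Set.uIoc_of_le ht.le] at hτ
      rw [norm_mul]
      exact mul_le_mul_of_nonneg_right (hb1 R hR τ (Set.Ioc_subset_Icc_self hτ)) (norm_nonneg _)
    · exact ContinuousOn.intervalIntegrable (continuousOn_const.mul hgt.norm)
    · refine Eventually.of_forall fun τ hτ => ?_
      rw [Set.uIoc_of_le ht.le] at hτ
      exact (tendsto_unitResponse hj hx hτ.1).mul_const _
  refine hlim.congr' ?_
  filter_upwards [eventually_ge_atTop 0] with R hR
  have hi : ∀ θ, IntervalIntegrable (fun τ => unitRay (2 - j) x θ R τ * g (t - τ)) volume 0 t :=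
    fun θ => ContinuousOn.intervalIntegrable
      ((continuous_unitRay (2 - j) x θ R).continuousOn.mul hgt)
  have hray := fun θ => raySegmentIntegral_eq_add_integral (2 - j) x θ ht.le hR hf hg
  have e : ∫ τ in (0 : ℝ)..t, unitResponse j x R τ * g (t - τ) =
      weight₁ j * ((∫ τ in (0 : ℝ)..t, unitRay (2 - j) x 0 R τ * g (t - τ)) -
        ∫ τ in (0 : ℝ)..t, unitRay (2 - j) x (Real.pi / 3) R τ * g (t - τ)) +
      weight₂ j * ((∫ τ in (0 : ℝ)..t, unitRay (2 - j) x (2 * Real.pi / 3) R τ * g (t - τ)) -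
        ∫ τ in (0 : ℝ)..t, unitRay (2 - j) x Real.pi R τ * g (t - τ)) := by
    rw [← intervalIntegral.integral_sub (hi _) (hi _), ← intervalIntegral.integral_sub (hi _) (hi _),
      ← intervalIntegral.integral_const_mul, ← intervalIntegral.integral_const_mul,
      ← intervalIntegral.integral_add (((hi _).sub (hi _)).const_mul _)
        (((hi _).sub (hi _)).const_mul _)]
    refine integral_congr fun τ _ => ?_
    simp only [unitResponse]
    ring
  rw [e]
  simp only [sectorBoundaryPartial, hray, unitResponse]
  ring

/-! ### The iterated antiderivatives of the step response -/

lemma hasDerivAt_pow_succ_div_factorial (m : ℕ) (x : ℝ) :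
    HasDerivAt (fun x : ℝ => x ^ (m + 1) / (m + 1).factorial) (x ^ m / m.factorial) x := by
  refine ((hasDerivAt_pow (m + 1) x).div_const _).congr_deriv ?_
  rw [Nat.factorial_succ, Nat.add_sub_cancel]
  have h1 : (m.factorial : ℝ) ≠ 0 := by positivity
  have h2 : ((m : ℝ) + 1) ≠ 0 := by positivity
  push_cast
  field_simp

lemma abs_stepTerm_le_of_le {j : ℕ} (hj : j = 0 ∨ j = 1) (M : ℕ) {x K a τ : ℝ} (hx : |x| ≤ K)
    (ha : 0 < a) (hτ : a ≤ τ) (n : ℕ) :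
    |stepTerm j M x τ n| ≤ |stepCoeff (fracOrder j) 0| * a ^ (fracOrder j - 1) * K ^ (2 + M) *
      ((K ^ 3 / a) ^ n / n.factorial) := by
  have hK : 0 ≤ K := (abs_nonneg x).trans hx
  have hτ0 : 0 < τ := ha.trans_le hτ
  refine (abs_stepTerm_le hj M hτ0 n).trans ?_
  have h1 : τ ^ (fracOrder j - 1) ≤ a ^ (fracOrder j - 1) :=
    Real.rpow_le_rpow_of_nonpos ha hτ (by linarith [fracOrder_lt_one hj])
  have h2 : 0 < a ^ (fracOrder j - 1) := Real.rpow_pos_of_pos ha _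
  gcongr

lemma summable_stepTerm_bound (j M : ℕ) (K a : ℝ) :
    Summable fun n : ℕ => |stepCoeff (fracOrder j) 0| * a ^ (fracOrder j - 1) * K ^ (2 + M) *
      ((K ^ 3 / a) ^ n / n.factorial) :=
  (Real.summable_pow_div_factorial _).mul_left _

lemma hasDerivAt_stepPrim_left {j : ℕ} (hj : j = 0 ∨ j = 1) (M : ℕ) {τ : ℝ} (hτ : 0 < τ) (x : ℝ) :
    HasDerivAt (fun x => stepPrim j (M + 1) x τ) (stepPrim j M x τ) x := by
  have h1 : HasDerivAt (fun x : ℝ => x ^ (M + 1 + j) / (M + 1 + j).factorial)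
      (x ^ (M + j) / (M + j).factorial) x := by
    rw [show M + 1 + j = M + j + 1 by ring]
    exact hasDerivAt_pow_succ_div_factorial (M + j) x
  refine h1.add ?_
  have hpre : IsPreconnected (Metric.ball (0 : ℝ) (|x| + 1)) := (convex_ball _ _).isPreconnected
  refine hasDerivAt_tsum_of_isPreconnected (t := Metric.ball (0 : ℝ) (|x| + 1)) (y₀ := x)
    (g := fun n x => stepTerm j (M + 1) x τ n) (g' := fun n x => stepTerm j M x τ n)
    (summable_stepTerm_bound j M (|x| + 1) τ) Metric.isOpen_ball
    hpre (fun n y _ => ?_) (fun n y hy => ?_) ?_ ?_ ?_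
  · have := (hasDerivAt_pow_succ_div_factorial (3 * n + 2 + M) y).const_mul
      (stepCoeff (fracOrder j) n * τ ^ (fracOrder j - (n + 1)))
    exact this
  · rw [mem_ball_zero_iff, Real.norm_eq_abs] at hy
    exact abs_stepTerm_le_of_le hj M hy.le hτ le_rfl n
  · simp
  · exact (summable_stepTerm hj (M + 1) x hτ).of_abs
  · simp

lemma stepPrim_succ_zero (j M : ℕ) (τ : ℝ) : stepPrim j (M + 1) 0 τ = 0 := by
  simp [stepPrim, stepTerm]

lemma continuous_stepPrim_left {j : ℕ} (hj : j = 0 ∨ j = 1) (M : ℕ) {τ : ℝ} (hτ : 0 < τ) :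
    Continuous fun x => stepPrim j M x τ := by
  refine (by fun_prop : Continuous fun x : ℝ => x ^ (M + j) / ((M + j).factorial : ℝ)).add ?_
  refine continuous_iff_continuousAt.mpr fun x => ?_
  have h : ContinuousOn (fun x => ∑' n, stepTerm j M x τ n) (Metric.ball 0 (|x| + 1)) := by
    refine continuousOn_tsum (fun n => ?_) (summable_stepTerm_bound j M (|x| + 1) τ)
      fun n y hy => ?_
    · unfold stepTerm; fun_prop
    · rw [mem_ball_zero_iff, Real.norm_eq_abs] at hy
      exact abs_stepTerm_le_of_le hj M hy.le hτ le_rfl n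
  exact h.continuousAt (Metric.isOpen_ball.mem_nhds (by simp))

lemma stepPrim_succ_eq_integral {j : ℕ} (hj : j = 0 ∨ j = 1) (M : ℕ) {τ : ℝ} (hτ : 0 < τ) (x : ℝ) :
    stepPrim j (M + 1) x τ = ∫ y in (0 : ℝ)..x, stepPrim j M y τ := by
  rw [integral_eq_sub_of_hasDerivAt (fun y _ => hasDerivAt_stepPrim_left hj M hτ y)
    ((continuous_stepPrim_left hj M hτ).intervalIntegrable _ _), stepPrim_succ_zero, sub_zero]

lemma hasDerivAt_stepTerm_right {j : ℕ} (hj : j = 0 ∨ j = 1) (M : ℕ) (x : ℝ) {τ : ℝ} (hτ : 0 < τ)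
    (n : ℕ) : HasDerivAt (fun τ => stepTerm j (M + 3) x τ n) (stepTerm j M x τ (n + 1)) τ := by
  have h := ((Real.hasDerivAt_rpow_const (x := τ) (p := fracOrder j - (n + 1))
    (Or.inl hτ.ne')).const_mul (stepCoeff (fracOrder j) n)).mul_const
    (x ^ (3 * n + 2 + (M + 3)) / (3 * n + 2 + (M + 3)).factorial)
  refine h.congr_deriv ?_
  rw [stepTerm, stepCoeff_succ (fracOrder_lt_one hj), show 3 * (n + 1) + 2 + M = 3 * n + 2 + (M + 3) by ring,
    show fracOrder j - (((n + 1 : ℕ) : ℝ) + 1) = fracOrder j - (n + 1) - 1 by push_cast; ring]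
  ring

/-- The evolution equation `∂_τ u = ∂ₓ³ u`, integrated in space. -/
lemma hasDerivAt_stepPrim_right {j : ℕ} (hj : j = 0 ∨ j = 1) (M : ℕ) (x : ℝ) {τ : ℝ} (hτ : 0 < τ) :
    HasDerivAt (fun τ => stepPrim j (M + 3) x τ)
      (stepPrim j M x τ - x ^ (M + j) / (M + j).factorial -
        stepCoeff (fracOrder j) 0 * τ ^ (fracOrder j - 1) * (x ^ (M + 2) / (M + 2).factorial)) τ := by
  have hS := (summable_stepTerm hj M x hτ).of_abs
  -- Differentiating termwise in τ reproduces the series for M without its term n = 0; that term and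
  -- the monomial are subtracted.
  have e : stepPrim j M x τ - x ^ (M + j) / (M + j).factorial -
      stepCoeff (fracOrder j) 0 * τ ^ (fracOrder j - 1) * (x ^ (M + 2) / (M + 2).factorial) =
      ∑' n, stepTerm j M x τ (n + 1) := by
    rw [stepPrim, hS.tsum_eq_zero_add, stepTerm]
    simp only [Nat.cast_zero, zero_add, mul_zero, add_comm 2 M]
    ring
  rw [e]
  have hb : Summable fun n : ℕ => |stepCoeff (fracOrder j) 0| * (τ / 2) ^ (fracOrder j - 1) *
      |x| ^ (2 + M) * ((|x| ^ 3 / (τ / 2)) ^ (n + 1) / (n + 1).factorial) :=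
    (summable_nat_add_iff 1).mpr (summable_stepTerm_bound j M |x| (τ / 2))
  have h := hasDerivAt_tsum_of_isPreconnected (t := Set.Ioi (τ / 2)) (y₀ := τ) (y := τ)
    (g := fun n τ => stepTerm j (M + 3) x τ n) (g' := fun n τ => stepTerm j M x τ (n + 1))
    hb isOpen_Ioi isPreconnected_Ioi
    (fun n σ hσ => hasDerivAt_stepTerm_right hj M x ((half_pos hτ).trans hσ) n)
    (fun n σ hσ => abs_stepTerm_le_of_le hj M le_rfl (half_pos hτ) (le_of_lt hσ) (n + 1))
    (half_lt_self hτ) (summable_stepTerm hj (M + 3) x hτ).of_abs (half_lt_self hτ)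
  exact h.const_add _

lemma continuousOn_stepPrim_right {j : ℕ} (hj : j = 0 ∨ j = 1) (M : ℕ) (x : ℝ) :
    ContinuousOn (fun τ => stepPrim j M x τ) (Set.Ioi 0) := by
  refine continuousOn_const.add fun τ hτ => ContinuousAt.continuousWithinAt ?_
  have hτ : 0 < τ := hτ
  have h : ContinuousOn (fun τ => ∑' n, stepTerm j M x τ n) (Set.Ioi (τ / 2)) := by
    refine continuousOn_tsum (fun n => ?_) (summable_stepTerm_bound j M |x| (τ / 2))
      fun n σ hσ => abs_stepTerm_le_of_le hj M le_rfl (half_pos hτ) (le_of_lt hσ) n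
    unfold stepTerm
    refine (continuousOn_const.mul (ContinuousOn.rpow_const continuousOn_id fun σ hσ => ?_)).mul
      continuousOn_const
    exact Or.inl ((half_pos hτ).trans hσ).ne'
  exact h.continuousAt (isOpen_Ioi.mem_nhds (half_lt_self hτ))

/-- Self-similarity: since 3ν = j + 1, every term is homogeneous of degree j under x ↦ λx, τ ↦ λ³τ.
-/
lemma stepPrim_zero_eq_mul (j : ℕ) {x τ : ℝ} (hx : 0 < x) (hτ : 0 < τ) :
    stepPrim j 0 x τ = x ^ j * stepPrim j 0 1 (τ / x ^ 3) := by
  rw [stepPrim, stepPrim, mul_add, ← tsum_mul_left]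
  congr 1
  · rw [one_pow, zero_add]; ring
  · refine tsum_congr fun n => ?_
    rw [stepTerm, stepTerm, Real.div_rpow hτ.le (by positivity), one_pow, add_zero]
    have e : (x ^ 3) ^ (fracOrder j - (n + 1)) = x ^ j / x ^ (3 * n + 2) := by
      rw [← Real.rpow_natCast, ← Real.rpow_natCast, ← Real.rpow_natCast, ← Real.rpow_mul hx.le,
        ← Real.rpow_sub hx]
      congr 1
      rw [fracOrder]; push_cast; ring
    rw [e]
    have h1 : x ^ (3 * n + 2) ≠ 0 := by positivity
    have h2 : x ^ j ≠ 0 := by positivity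
    field_simp

/-- For τ ≤ 1 the bound comes from the oscillatory integrals, for τ ≥ 1 from the series. -/
lemma exists_abs_stepPrim_one_le {j : ℕ} (hj : j = 0 ∨ j = 1) :
    ∃ B, 0 ≤ B ∧ ∀ τ, 0 < τ → |stepPrim j 0 1 τ| ≤ B := by
  obtain ⟨C, hC, h⟩ := norm_stepPrim_sub_le hj (zero_lt_one' ℝ)
  set B₁ := C + 2 * (‖weight₁ j‖ + ‖weight₂ j‖) with hB₁
  set B₂ := 1 + ∑' n : ℕ, |stepCoeff (fracOrder j) 0| * (1 : ℝ) ^ (fracOrder j - 1) *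
    (1 : ℝ) ^ (2 + 0) * (((1 : ℝ) ^ 3 / 1) ^ n / n.factorial) with hB₂
  have hB₁0 : 0 ≤ B₁ := by positivity
  refine ⟨max B₁ B₂, hB₁0.trans (le_max_left _ _), fun τ hτ => ?_⟩
  rcases le_total τ 1 with h1 | h1
  · refine le_trans ?_ (le_max_left _ _)
    have h2 := h τ hτ 1 le_rfl
    rw [Real.sqrt_one, div_one] at h2
    have h3 := norm_unitResponse_le j (zero_le_one' ℝ) hτ.le (zero_le_one' ℝ)
    rw [one_pow, one_mul, mul_one] at h3
    have h4 : 2 * (‖weight₁ j‖ + ‖weight₂ j‖) * τ ≤ 2 * (‖weight₁ j‖ + ‖weight₂ j‖) :=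
      mul_le_of_le_one_right (by positivity) h1
    rw [← Real.norm_eq_abs, ← Complex.norm_real]
    calc ‖(stepPrim j 0 1 τ : ℂ)‖
        = ‖((stepPrim j 0 1 τ : ℂ) - unitResponse j 1 1 τ) + unitResponse j 1 1 τ‖ := by
          rw [sub_add_cancel]
      _ ≤ _ := norm_add_le _ _
      _ ≤ _ := by linarith
  · refine le_trans ?_ (le_max_right _ _)
    refine (abs_add_le _ _).trans (add_le_add ?_ ?_)
    · rw [one_pow, abs_of_nonneg (by positivity)]
      exact div_le_one_of_le₀ (by exact_mod_cast Nat.factorial_pos _) (by positivity)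
    · have := tsum_of_norm_bounded (f := fun n => stepTerm j 0 1 τ n)
        (summable_stepTerm_bound j 0 1 1).hasSum
        (fun n => abs_stepTerm_le_of_le hj 0 (by simp) zero_lt_one h1 n)
      exact this

/-- Scaling reduces M = 0 to x = 1, and every integration from 0 improves the power. The factor 1/M!
and the uniformity in τ are what make the remainder of the expansion vanish. -/
lemma exists_abs_stepPrim_le {j : ℕ} (hj : j = 0 ∨ j = 1) {x : ℝ} (hx : 0 < x) :
    ∃ B, 0 ≤ B ∧ ∀ M, ∀ y ∈ Set.Ioc 0 x, ∀ τ, 0 < τ →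
      |stepPrim j M y τ| ≤ B * (y ^ M / M.factorial) := by
  obtain ⟨B, hB, h⟩ := exists_abs_stepPrim_one_le hj
  refine ⟨x ^ j * B, by positivity, fun M => ?_⟩
  induction M with
  | zero =>
    intro y hy τ hτ
    have hy0 := hy.1
    rw [stepPrim_zero_eq_mul j hy.1 hτ, abs_mul, abs_of_pos (by positivity), pow_zero,
      Nat.factorial_zero, Nat.cast_one, div_one, mul_one]
    have h1 : y ^ j ≤ x ^ j := pow_le_pow_left₀ hy.1.le hy.2 j
    have h2 := h (τ / y ^ 3) (by positivity)
    gcongr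
  | succ M ih =>
    intro y hy τ hτ
    rw [stepPrim_succ_eq_integral hj M hτ]
    have hd : ∀ s ∈ Set.uIcc 0 y, HasDerivAt (fun s : ℝ => x ^ j * B * (s ^ (M + 1) / (M + 1).factorial))
        (x ^ j * B * (s ^ M / M.factorial)) s := fun s _ =>
      (hasDerivAt_pow_succ_div_factorial M s).const_mul _
    have hi : IntervalIntegrable (fun s : ℝ => x ^ j * B * (s ^ M / M.factorial)) volume 0 y :=
      Continuous.intervalIntegrable (by fun_prop) _ _
    have := intervalIntegral.norm_integral_le_of_norm_le
      (f := fun s => stepPrim j M s τ) hy.1.le (Eventually.of_forall fun s hs =>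
      ih s ⟨hs.1, hs.2.trans hy.2⟩ τ hτ) hi
    rw [integral_eq_sub_of_hasDerivAt hd hi, zero_pow (Nat.succ_ne_zero M), zero_div, mul_zero,
      sub_zero] at this
    exact this

/-- Removes the boundary term at τ = 0 in the expansion step; each antiderivative inherits the limit
by dominated convergence. -/
lemma tendsto_stepPrim_nhdsGT_zero {j : ℕ} (hj : j = 0 ∨ j = 1) (M : ℕ) {x : ℝ} (hx : 0 < x) :
    Tendsto (fun τ => stepPrim j M x τ) (𝓝[>] 0) (𝓝 0) := by
  induction M generalizing x with
  | zero => exact tendsto_stepPrim_zero hj hx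
  | succ M ih =>
    obtain ⟨B, hB, h⟩ := exists_abs_stepPrim_le hj hx
    suffices h0 : Tendsto (fun τ => stepPrim j (M + 1) x τ) (𝓝[>] 0)
        (𝓝 (∫ _ in (0 : ℝ)..x, (0 : ℝ))) by simpa using h0
    refine Tendsto.congr' (f₁ := fun τ => ∫ y in (0 : ℝ)..x, stepPrim j M y τ) ?_ ?_
    · filter_upwards [self_mem_nhdsWithin] with τ hτ
      exact (stepPrim_succ_eq_integral hj M hτ x).symm
    · refine tendsto_integral_filter_of_dominated_convergence
        (fun y => B * (y ^ M / M.factorial)) ?_ ?_ ?_ ?_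
      · filter_upwards [self_mem_nhdsWithin] with τ hτ
        exact (continuous_stepPrim_left hj M hτ).aestronglyMeasurable
      · filter_upwards [self_mem_nhdsWithin] with τ hτ
        refine Eventually.of_forall fun y hy => ?_
        rw [Set.uIoc_of_le hx.le] at hy
        exact h M y hy τ hτ
      · exact Continuous.intervalIntegrable (by fun_prop) _ _
      · refine Eventually.of_forall fun y hy => ?_
        rw [Set.uIoc_of_le hx.le] at hy
        exact ih hy.1

lemma intervalIntegrable_stepPrim_mul {j : ℕ} (hj : j = 0 ∨ j = 1) (M : ℕ) {x t : ℝ} (hx : 0 < x)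
    (ht : 0 ≤ t) {g : ℝ → ℂ} (hg : ContinuousOn g (Set.Icc 0 t)) :
    IntervalIntegrable (fun τ => (stepPrim j M x τ : ℂ) * g τ) volume 0 t := by
  obtain ⟨B, hB, h⟩ := exists_abs_stepPrim_le hj hx
  have hs : IntervalIntegrable (fun τ => (stepPrim j M x τ : ℂ)) volume 0 t := by
    rw [intervalIntegrable_iff, Set.uIoc_of_le ht]
    refine IntegrableOn.of_bound measure_Ioc_lt_top ?_ (B * (x ^ M / M.factorial)) ?_
    · refine ContinuousOn.aestronglyMeasurable ?_ measurableSet_Ioc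
      exact Complex.continuous_ofReal.comp_continuousOn
        ((continuousOn_stepPrim_right hj M x).mono fun τ hτ => hτ.1)
    · filter_upwards [ae_restrict_mem measurableSet_Ioc] with τ hτ
      rw [Complex.norm_real]
      exact h M x ⟨hx, le_rfl⟩ τ hτ.1
  exact hs.mul_continuousOn (by rwa [Set.uIcc_of_le ht])

lemma intervalIntegrable_rpow_mul {ν t : ℝ} (hν : 0 < ν) (ht : 0 ≤ t) {g : ℝ → ℂ}
    (hg : ContinuousOn g (Set.Icc 0 t)) :
    IntervalIntegrable (fun τ => ((τ ^ (ν - 1) : ℝ) : ℂ) * g τ) volume 0 t := by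
  have h := intervalIntegrable_rpow' (a := 0) (b := t) (r := ν - 1) (by linarith)
  have h' : IntervalIntegrable (fun τ => ((τ ^ (ν - 1) : ℝ) : ℂ)) volume 0 t :=
    ⟨h.1.ofReal, h.2.ofReal⟩
  exact h'.mul_continuousOn (by rwa [Set.uIcc_of_le ht])

/-- One step of the expansion of the response in powers of `x`. -/
lemma integral_stepPrim_mul_eq {j : ℕ} (hj : j = 0 ∨ j = 1) (M : ℕ) {x t : ℝ} (hx : 0 < x)
    (ht : 0 < t) {F G H : ℝ → ℂ} (hF : ∀ s ∈ Set.Icc 0 t, HasDerivAt F (G s) s)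
    (hG : ∀ s ∈ Set.Icc 0 t, HasDerivAt G (H s) s) (hH : ContinuousOn H (Set.Icc 0 t)) :
    ∫ τ in (0 : ℝ)..t, (stepPrim j M x τ : ℂ) * G (t - τ) =
      ((x ^ (M + j) / (M + j).factorial : ℝ) : ℂ) * (F t - F 0) +
      ((stepCoeff (fracOrder j) 0 * (x ^ (M + 2) / (M + 2).factorial) : ℝ) : ℂ) *
        (∫ τ in (0 : ℝ)..t, ((τ ^ (fracOrder j - 1) : ℝ) : ℂ) * G (t - τ)) +
      (stepPrim j (M + 3) x t : ℂ) * G 0 +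
      ∫ τ in (0 : ℝ)..t, (stepPrim j (M + 3) x τ : ℂ) * H (t - τ) := by
  have hmap : Set.MapsTo (fun τ => t - τ) (Set.Icc 0 t) (Set.Icc 0 t) :=
    fun τ hτ => ⟨by linarith [hτ.2], by linarith [hτ.1]⟩
  have hGc : ContinuousOn G (Set.Icc 0 t) := fun s hs => (hG s hs).continuousAt.continuousWithinAt
  have hGt : ContinuousOn (fun τ => G (t - τ)) (Set.Icc 0 t) := hGc.comp (by fun_prop) hmap
  have hHt : ContinuousOn (fun τ => H (t - τ)) (Set.Icc 0 t) := hH.comp (by fun_prop) hmap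
  set c : ℝ := x ^ (M + j) / (M + j).factorial with hc
  set d : ℝ := stepCoeff (fracOrder j) 0 * (x ^ (M + 2) / (M + 2).factorial) with hd
  have i0 := intervalIntegrable_stepPrim_mul hj M hx ht.le hGt
  have i1 : IntervalIntegrable (fun τ => (c : ℂ) * G (t - τ)) volume 0 t :=
    ContinuousOn.intervalIntegrable (by
      rw [Set.uIcc_of_le ht.le]; exact continuousOn_const.mul hGt)
  have i2 := (intervalIntegrable_rpow_mul (fracOrder_pos j) ht.le hGt).const_mul (d : ℂ)
  have i3 := intervalIntegrable_stepPrim_mul hj (M + 3) hx ht.le hHt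
  have hder : ∀ τ ∈ Set.Ioo 0 t, HasDerivAt (fun τ => (stepPrim j (M + 3) x τ : ℂ) * G (t - τ))
      ((stepPrim j M x τ : ℂ) * G (t - τ) - c * G (t - τ) -
        d * (((τ ^ (fracOrder j - 1) : ℝ) : ℂ) * G (t - τ)) -
        (stepPrim j (M + 3) x τ : ℂ) * H (t - τ)) τ := fun τ hτ => by
    have h1 := (hasDerivAt_stepPrim_right hj M x hτ.1).ofReal_comp
    have h2 : HasDerivAt (fun τ => G (t - τ)) (-H (t - τ)) τ := by
      have := (hG (t - τ) (hmap ⟨hτ.1.le, hτ.2.le⟩)).scomp τ ((hasDerivAt_id' τ).const_sub t)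
      simpa [Function.comp_def] using this
    refine (h1.mul h2).congr_deriv ?_
    simp only [hc, hd]
    push_cast
    ring
  have hlim0 : Tendsto (fun τ => (stepPrim j (M + 3) x τ : ℂ) * G (t - τ)) (𝓝[>] 0) (𝓝 0) := by
    have h1 := (Complex.continuous_ofReal.tendsto 0).comp (tendsto_stepPrim_nhdsGT_zero hj (M + 3) hx)
    have h2 : Tendsto (fun τ => G (t - τ)) (𝓝[>] 0) (𝓝 (G t)) := by
      have h3 : ContinuousAt G (t - 0) := by
        rw [sub_zero]; exact (hG t ⟨ht.le, le_rfl⟩).continuousAt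
      have h4 : ContinuousAt (fun τ => G (t - τ)) 0 :=
        ContinuousAt.comp (f := fun τ => t - τ) h3 (by fun_prop)
      have h5 := h4.tendsto
      rw [sub_zero] at h5
      exact h5.mono_left nhdsWithin_le_nhds
    simpa using h1.mul h2
  have hlimt : Tendsto (fun τ => (stepPrim j (M + 3) x τ : ℂ) * G (t - τ)) (𝓝[<] t)
      (𝓝 ((stepPrim j (M + 3) x t : ℂ) * G 0)) := by
    have h1 : ContinuousAt (fun τ => (stepPrim j (M + 3) x τ : ℂ)) t :=
      (hasDerivAt_stepPrim_right hj M x ht).ofReal_comp.continuousAt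
    have h3 : ContinuousAt G (t - t) := by
      rw [sub_self]; exact (hG 0 ⟨le_rfl, ht.le⟩).continuousAt
    have h4 : ContinuousAt (fun τ => G (t - τ)) t :=
      ContinuousAt.comp (f := fun τ => t - τ) h3 (by fun_prop)
    have h5 : Tendsto (fun τ => (stepPrim j (M + 3) x τ : ℂ) * G (t - τ)) (𝓝 t)
        (𝓝 ((stepPrim j (M + 3) x t : ℂ) * G (t - t))) := (h1.mul h4).tendsto
    rw [sub_self] at h5
    exact h5.mono_left nhdsWithin_le_nhds
  -- The derivative formula holds only for τ > 0, where τ^{ν-1} is finite, so one-sided limits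
  -- replace the endpoint values.
  have hmain := integral_eq_sub_of_hasDerivAt_of_tendsto ht hder (((i0.sub i1).sub i2).sub i3)
    hlim0 hlimt
  rw [intervalIntegral.integral_sub ((i0.sub i1).sub i2) i3,
    intervalIntegral.integral_sub (i0.sub i1) i2, intervalIntegral.integral_sub i0 i1,
    intervalIntegral.integral_const_mul, intervalIntegral.integral_const_mul, sub_zero] at hmain
  have hFG : ∫ τ in (0 : ℝ)..t, G (t - τ) = F t - F 0 := by
    rw [intervalIntegral.integral_comp_sub_left (fun s => G s), sub_self, sub_zero]
    refine integral_eq_sub_of_hasDerivAt (fun s hs => hF s ?_) (ContinuousOn.intervalIntegrable ?_)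
    · rwa [Set.uIcc_of_le ht.le] at hs
    · rwa [Set.uIcc_of_le ht.le]
  rw [hFG] at hmain
  linear_combination hmain

/-! ### Differentiation of Abel integrals -/

/-- The Abel integral `∫₀ᵗ h(s) / (t - s)^μ ds`. -/
def abelIntegral (μ : ℝ) (h : ℝ → ℂ) (t : ℝ) : ℂ :=
  ∫ s in (0 : ℝ)..t, h s / (((t - s) ^ μ : ℝ) : ℂ)

/-- Substituting s = tσ takes t out of the singular kernel and the limits, so that differentiation
under the integral sign is possible. -/
lemma abelIntegral_eq_rpow_mul (μ : ℝ) (h : ℝ → ℂ) {t : ℝ} (ht : 0 < t) :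
    abelIntegral μ h t = ((t ^ (1 - μ) : ℝ) : ℂ) *
      ∫ σ in (0 : ℝ)..1, (((1 - σ) ^ (-μ) : ℝ) : ℂ) * h (t * σ) := by
  have hsub := intervalIntegral.integral_comp_mul_left (a := 0) (b := 1)
    (fun s => h s / (((t - s) ^ μ : ℝ) : ℂ)) ht.ne'
  rw [mul_zero, mul_one] at hsub
  have e : abelIntegral μ h t = t • (t⁻¹ • ∫ s in (0 : ℝ)..t, h s / (((t - s) ^ μ : ℝ) : ℂ)) := by
    rw [smul_smul, mul_inv_cancel₀ ht.ne', one_smul, abelIntegral]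
  rw [e, ← hsub, Complex.real_smul, ← intervalIntegral.integral_const_mul,
    ← intervalIntegral.integral_const_mul]
  refine integral_congr fun σ hσ => ?_
  rw [Set.uIcc_of_le zero_le_one] at hσ
  have h1 : 0 ≤ 1 - σ := by linarith [hσ.2]
  have h2 : (t - t * σ) ^ μ = t ^ μ * (1 - σ) ^ μ := by
    rw [← Real.mul_rpow ht.le h1]; congr 1; ring
  have h3 : t ^ (1 - μ) = t / t ^ μ := by rw [Real.rpow_sub ht, Real.rpow_one]
  rw [h2, h3, Real.rpow_neg h1]
  push_cast
  simp only [div_eq_mul_inv, mul_inv]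
  ring

lemma intervalIntegrable_one_sub_rpow_neg {μ : ℝ} (hμ : μ < 1) :
    IntervalIntegrable (fun σ : ℝ => (1 - σ) ^ (-μ)) volume 0 1 := by
  have h := (intervalIntegrable_rpow' (a := 0) (b := 1) (r := -μ) (by linarith)).comp_sub_left 1
  simp only [sub_zero, sub_self] at h
  exact h.symm

lemma intervalIntegrable_one_sub_rpow_neg_mul {μ : ℝ} (hμ : μ < 1) {g : ℝ → ℂ}
    (hg : ContinuousOn g (Set.Icc 0 1)) :
    IntervalIntegrable (fun σ : ℝ => (((1 - σ) ^ (-μ) : ℝ) : ℂ) * g σ) volume 0 1 := by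
  have h := intervalIntegrable_one_sub_rpow_neg hμ
  have h' : IntervalIntegrable (fun σ : ℝ => (((1 - σ) ^ (-μ) : ℝ) : ℂ)) volume 0 1 :=
    ⟨h.1.ofReal, h.2.ofReal⟩
  exact h'.mul_continuousOn (by rwa [Set.uIcc_of_le zero_le_one])

/-- Differentiation of an Abel integral. -/
lemma hasDerivAt_abelIntegral {μ : ℝ} (hμ : μ < 1) {b t : ℝ} (ht : 0 < t) (htb : t < b)
    {h h' : ℝ → ℂ} (hh : ∀ s ∈ Set.Icc 0 b, HasDerivAt h (h' s) s)
    (hh' : ContinuousOn h' (Set.Icc 0 b)) :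
    HasDerivAt (abelIntegral μ h) (((t ^ (-μ) : ℝ) : ℂ) * h 0 + abelIntegral μ h' t) t := by
  have hb : 0 < b := ht.trans htb
  have hhc : ContinuousOn h (Set.Icc 0 b) := fun s hs => (hh s hs).continuousAt.continuousWithinAt
  have hmem : ∀ t' ∈ Set.Ioo 0 b, ∀ σ ∈ Set.Icc (0 : ℝ) 1, t' * σ ∈ Set.Icc 0 b :=
    fun t' ht' σ hσ => ⟨mul_nonneg ht'.1.le hσ.1,
      (mul_le_of_le_one_right ht'.1.le hσ.2).trans ht'.2.le⟩
  have hmaps : ∀ t' ∈ Set.Ioo 0 b, Set.MapsTo (fun σ => t' * σ) (Set.Icc (0 : ℝ) 1) (Set.Icc 0 b) :=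
    hmem
  have hcomp : ∀ t' ∈ Set.Ioo 0 b, ContinuousOn (fun σ => h (t' * σ)) (Set.Icc (0 : ℝ) 1) :=
    fun t' ht' => hhc.comp (by fun_prop) (hmaps t' ht')
  have hcomp' : ∀ t' ∈ Set.Ioo 0 b, ContinuousOn (fun σ => h' (t' * σ)) (Set.Icc (0 : ℝ) 1) :=
    fun t' ht' => hh'.comp (by fun_prop) (hmaps t' ht')
  obtain ⟨C, hC⟩ := isCompact_Icc.exists_bound_of_continuousOn hh'
  have htm : t ∈ Set.Ioo 0 b := ⟨ht, htb⟩
  have hw := intervalIntegrable_one_sub_rpow_neg hμ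
  have hcσ : ContinuousOn (fun σ : ℝ => ((σ : ℝ) : ℂ)) (Set.Icc (0 : ℝ) 1) :=
    Complex.continuous_ofReal.continuousOn
  have hA := (hasDerivAt_integral_of_dominated_loc_of_deriv_le (μ := volume) (a := 0) (b := 1)
    (F := fun t' σ => (((1 - σ) ^ (-μ) : ℝ) : ℂ) * h (t' * σ))
    (F' := fun t' σ => (((1 - σ) ^ (-μ) : ℝ) : ℂ) * ((σ : ℂ) * h' (t' * σ)))
    (x₀ := t) (s := Set.Ioo 0 b) (bound := fun σ => (1 - σ) ^ (-μ) * C) (isOpen_Ioo.mem_nhds htm)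
    (by
      filter_upwards [isOpen_Ioo.mem_nhds htm] with t' ht'
      have := (intervalIntegrable_one_sub_rpow_neg_mul hμ (hcomp t' ht')).1.aestronglyMeasurable
      rwa [Set.uIoc_of_le zero_le_one])
    (intervalIntegrable_one_sub_rpow_neg_mul hμ (hcomp t htm))
    (by
      have := (intervalIntegrable_one_sub_rpow_neg_mul hμ
        (hcσ.mul (hcomp' t htm))).1.aestronglyMeasurable
      rwa [Set.uIoc_of_le zero_le_one])
    (by
      refine Eventually.of_forall fun σ hσ t' ht' => ?_
      rw [Set.uIoc_of_le zero_le_one] at hσ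
      have h1 : 0 ≤ 1 - σ := by linarith [hσ.2]
      have h2 := hC _ (hmem t' ht' σ ⟨hσ.1.le, hσ.2⟩)
      have h3 : 0 ≤ (1 - σ) ^ (-μ) := Real.rpow_nonneg h1 _
      rw [norm_mul, norm_mul, Complex.norm_real, Complex.norm_real, Real.norm_of_nonneg h3,
        Real.norm_of_nonneg hσ.1.le]
      refine mul_le_mul_of_nonneg_left ?_ h3
      exact (mul_le_of_le_one_left (norm_nonneg _) hσ.2).trans h2)
    (hw.mul_const C)
    (by
      refine Eventually.of_forall fun σ hσ t' ht' => ?_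
      rw [Set.uIoc_of_le zero_le_one] at hσ
      have h1 := (hh _ (hmem t' ht' σ ⟨hσ.1.le, hσ.2⟩)).scomp t' ((hasDerivAt_id' t').mul_const σ)
      rw [one_mul, Complex.real_smul] at h1
      exact h1.const_mul _)).2
  have hpow : HasDerivAt (fun t : ℝ => ((t ^ (1 - μ) : ℝ) : ℂ)) ((((1 - μ) * t ^ (-μ) : ℝ)) : ℂ) t := by
    have := (Real.hasDerivAt_rpow_const (x := t) (p := 1 - μ) (Or.inl ht.ne')).ofReal_comp
    rwa [show 1 - μ - 1 = -μ by ring] at this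
  have hprod := hpow.mul hA
  have heq : abelIntegral μ h =ᶠ[𝓝 t] fun t' => ((t' ^ (1 - μ) : ℝ) : ℂ) *
      ∫ σ in (0 : ℝ)..1, (((1 - σ) ^ (-μ) : ℝ) : ℂ) * h (t' * σ) := by
    filter_upwards [isOpen_Ioi.mem_nhds ht] with t' ht'
    exact abelIntegral_eq_rpow_mul μ h ht'
  refine (hprod.congr_of_eventuallyEq heq).congr_deriv ?_
  rw [abelIntegral_eq_rpow_mul μ h' ht]
  -- Integration by parts against (1 - σ)^{1-μ}: it produces h(0), and its factor 1 - σ complements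
  -- the factor σ that comes from differentiating h(tσ).
  have hlast : ((1 - μ : ℝ) : ℂ) * ∫ σ in (0 : ℝ)..1, (((1 - σ) ^ (-μ) : ℝ) : ℂ) * h (t * σ) =
      h 0 + t * ∫ σ in (0 : ℝ)..1, (((1 - σ) ^ (-μ) : ℝ) : ℂ) * ((1 - (σ : ℂ)) * h' (t * σ)) := by
    have i1 := (intervalIntegrable_one_sub_rpow_neg_mul hμ (hcomp t htm)).const_mul ((1 - μ : ℝ) : ℂ)
    have i2 := (intervalIntegrable_one_sub_rpow_neg_mul hμ
      (g := fun σ : ℝ => (1 - (σ : ℂ)) * h' (t * σ))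
      (((continuousOn_const (c := (1 : ℂ))).sub hcσ).mul (hcomp' t htm))).const_mul (t : ℂ)
    have hder : ∀ σ ∈ Set.Ioo (0 : ℝ) 1,
        HasDerivAt (fun σ : ℝ => -((((1 - σ) ^ (1 - μ) : ℝ) : ℂ) * h (t * σ)))
          (((1 - μ : ℝ) : ℂ) * ((((1 - σ) ^ (-μ) : ℝ) : ℂ) * h (t * σ)) -
            (t : ℂ) * ((((1 - σ) ^ (-μ) : ℝ) : ℂ) * ((1 - (σ : ℂ)) * h' (t * σ)))) σ := by
      intro σ hσ
      have h1 : 0 < 1 - σ := by linarith [hσ.2]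
      have d1 := ((Real.hasDerivAt_rpow_const (x := 1 - σ) (p := 1 - μ) (Or.inl h1.ne')).comp σ
        ((hasDerivAt_id' σ).const_sub 1)).ofReal_comp
      have d2 := (hh _ (hmem t htm σ ⟨hσ.1.le, hσ.2.le⟩)).scomp σ ((hasDerivAt_id' σ).const_mul t)
      rw [mul_one, Complex.real_smul] at d2
      refine (d1.mul d2).neg.congr_deriv ?_
      have e1 : (1 - σ) ^ (1 - μ) = (1 - σ) ^ (-μ) * (1 - σ) := by
        rw [← Real.rpow_add_one h1.ne']; congr 1; ring
      simp only [Function.comp]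
      rw [e1, show 1 - μ - 1 = -μ by ring]
      push_cast
      ring
    have hcont : ContinuousOn (fun σ : ℝ => -((((1 - σ) ^ (1 - μ) : ℝ) : ℂ) * h (t * σ)))
        (Set.Icc 0 1) := by
      refine ContinuousOn.neg (ContinuousOn.mul ?_ (hcomp t htm))
      refine Complex.continuous_ofReal.comp_continuousOn ?_
      exact ContinuousOn.rpow_const (by fun_prop) fun σ _ => Or.inr (by linarith)
    have := integral_eq_sub_of_hasDerivAt_of_le zero_le_one hcont hder (i1.sub i2)
    rw [intervalIntegral.integral_sub i1 i2, intervalIntegral.integral_const_mul,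
      intervalIntegral.integral_const_mul, sub_self, Real.zero_rpow (by linarith), sub_zero,
      Real.one_rpow, mul_zero, Complex.ofReal_zero, Complex.ofReal_one, zero_mul, one_mul, neg_zero,
      zero_sub, neg_neg] at this
    linear_combination this
  have hsplit : ∫ σ in (0 : ℝ)..1, (((1 - σ) ^ (-μ) : ℝ) : ℂ) * ((1 - (σ : ℂ)) * h' (t * σ)) =
      (∫ σ in (0 : ℝ)..1, (((1 - σ) ^ (-μ) : ℝ) : ℂ) * h' (t * σ)) -
        ∫ σ in (0 : ℝ)..1, (((1 - σ) ^ (-μ) : ℝ) : ℂ) * ((σ : ℂ) * h' (t * σ)) := by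
    rw [← intervalIntegral.integral_sub
      (intervalIntegrable_one_sub_rpow_neg_mul hμ (hcomp' t htm))
      (intervalIntegrable_one_sub_rpow_neg_mul hμ (g := fun σ : ℝ => (σ : ℂ) * h' (t * σ))
        (hcσ.mul (hcomp' t htm)))]
    exact integral_congr fun σ _ => by ring
  rw [hsplit] at hlast
  have e2 : t ^ (1 - μ) = t ^ (-μ) * t := by
    rw [← Real.rpow_add_one ht.ne']; congr 1; ring
  rw [e2]
  push_cast at hlast ⊢
  linear_combination ((t ^ (-μ) : ℝ) : ℂ) * hlast

/-! ### Riemann–Liouville derivatives -/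

/-- If every function of a sequence has the next one as its derivative on an open set, then all of
them are smooth there and the sequence consists of the iterated derivatives of its first term. -/
lemma contDiffOn_and_iteratedDeriv_of_hasDerivAt_succ {U : Set ℝ} (hU : IsOpen U) {R : ℕ → ℝ → ℂ}
    (hR : ∀ n, ∀ t ∈ U, HasDerivAt (R n) (R (n + 1) t) t) (n : ℕ) :
    (∀ k, ContDiffOn ℝ n (R k) U) ∧ ∀ t ∈ U, iteratedDeriv n (R 0) t = R n t := by
  have hd : ∀ k, DifferentiableOn ℝ (R k) U := fun k t ht =>
    (hR k t ht).differentiableAt.differentiableWithinAt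
  induction n with
  | zero =>
    exact ⟨fun k => contDiffOn_zero.mpr (hd k).continuousOn, fun t _ => by rw [iteratedDeriv_zero]⟩
  | succ n ih =>
    refine ⟨fun k => ?_, fun t ht => ?_⟩
    · rw [Nat.cast_add, Nat.cast_one, contDiffOn_succ_iff_deriv_of_isOpen hU]
      refine ⟨hd k, fun h => by simp at h, ?_⟩
      exact (ih.1 (k + 1)).congr fun t ht => (hR k t ht).deriv
    · rw [iteratedDeriv_succ]
      have : iteratedDeriv n (R 0) =ᶠ[𝓝 t] R n := by
        filter_upwards [hU.mem_nhds ht] with s hs using ih.2 s hs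
      rw [this.deriv_eq, (hR n t ht).deriv]

/-- The coefficient of the Riemann–Liouville derivatives at the initial time. -/
def fracWeight (ν : ℝ) (i : ℕ) (t : ℝ) : ℝ := stepCoeff ν i * t ^ (ν - (i + 1))

lemma hasDerivAt_fracWeight {ν : ℝ} (hν : ν < 1) (i : ℕ) {t : ℝ} (ht : 0 < t) :
    HasDerivAt (fracWeight ν i) (fracWeight ν (i + 1) t) t := by
  refine ((Real.hasDerivAt_rpow_const (x := t) (p := ν - (i + 1)) (Or.inl ht.ne')).const_mul
    (stepCoeff ν i)).congr_deriv ?_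
  rw [fracWeight, stepCoeff_succ hν, show ν - (((i + 1 : ℕ) : ℝ) + 1) = ν - (i + 1) - 1 by
    push_cast; ring]
  ring

/-- Rewrites the bracket with k = m - 1 and the constants of `stepTerm`, up to a global sign, so
that it can be matched with the expansion and differentiated. -/
lemma fracBracket_eq {ν : ℝ} (hν : ν < 1) (n : ℕ) (f : ℂ → ℂ) {t : ℝ} (ht : 0 < t) :
    fracBracket (1 - ν) n f t =
      -((∑ k ∈ Finset.range n, (fracWeight ν (n - 1 - k) t : ℂ) * iteratedDeriv k f 0) +
        (stepCoeff ν 0 : ℂ) * abelIntegral (1 - ν) (fun s => iteratedDeriv n f s) t) := by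
  have hΓ : Real.Gamma (1 - ν) ≠ 0 := (Real.Gamma_pos_of_pos (by linarith)).ne'
  have hc : Real.sqrt 3 * Real.Gamma (1 - ν) / (2 * Real.pi) = -stepCoeff ν 0 := by
    rw [stepCoeff, Nat.cast_zero, zero_add, zero_add]; ring
  rw [fracBracket, mul_add, neg_add]
  congr 1
  · rw [Finset.mul_sum, ← Finset.sum_neg_distrib, ← Finset.Ico_succ_right_eq_Icc, Finset.sum_Ico_eq_sum_range]
    refine Finset.sum_congr (by simp) fun k hk => ?_
    rw [Nat.add_sub_cancel_left, show n - (1 + k) = n - 1 - k by omega, ← mul_assoc, ← neg_mul]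
    congr 1
    rw [← Complex.ofReal_mul, ← Complex.ofReal_neg]
    congr 1
    set i := n - 1 - k
    have h1 : t ^ ((i : ℝ) + (1 - ν)) ≠ 0 := (Real.rpow_pos_of_pos ht _).ne'
    rw [fracWeight, stepCoeff, show ν - ((i : ℝ) + 1) = -((i : ℝ) + (1 - ν)) by ring,
      Real.rpow_neg ht.le, show (i : ℝ) + 1 - ν = i + (1 - ν) by ring]
    field_simp
    ring
  · rw [hc, Complex.ofReal_neg, neg_mul]
    rfl

/-- The old weights advance by one index, and the Abel integral emits t^{ν-1} f^{(n)}(0), exactly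
the new term k = n. -/
lemma hasDerivAt_fracBracket {ν : ℝ} (hν : ν < 1) (hν' : 0 < ν) {f : ℂ → ℂ} {b : ℝ}
    (hf : ∀ n, ∀ s ∈ Set.Icc 0 b,
      HasDerivAt (fun s : ℝ => iteratedDeriv n f s) (iteratedDeriv (n + 1) f s) s)
    (n : ℕ) {t : ℝ} (ht : t ∈ Set.Ioo 0 b) :
    HasDerivAt (fracBracket (1 - ν) n f) (fracBracket (1 - ν) (n + 1) f t) t := by
  have h1 := hasDerivAt_abelIntegral (μ := 1 - ν) (by linarith) ht.1 ht.2 (hf n)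
    (fun s hs => (hf (n + 1) s hs).continuousAt.continuousWithinAt)
  have h2 : HasDerivAt (fun t => ∑ k ∈ Finset.range n,
      (fracWeight ν (n - 1 - k) t : ℂ) * iteratedDeriv k f 0)
      (∑ k ∈ Finset.range n, (fracWeight ν (n - 1 - k + 1) t : ℂ) * iteratedDeriv k f 0) t :=
    HasDerivAt.fun_sum fun k _ =>
      ((hasDerivAt_fracWeight hν (n - 1 - k) ht.1).ofReal_comp).mul_const _
  have h3 := (h2.add (h1.const_mul (stepCoeff ν 0 : ℂ))).neg
  have heq : fracBracket (1 - ν) n f =ᶠ[𝓝 t] fun t =>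
      -((∑ k ∈ Finset.range n, (fracWeight ν (n - 1 - k) t : ℂ) * iteratedDeriv k f 0) +
        (stepCoeff ν 0 : ℂ) * abelIntegral (1 - ν) (fun s => iteratedDeriv n f s) t) := by
    filter_upwards [isOpen_Ioi.mem_nhds ht.1] with t' ht' using fracBracket_eq hν n f ht'
  refine (h3.congr_of_eventuallyEq heq).congr_deriv ?_
  rw [fracBracket_eq hν (n + 1) f ht.1, Finset.sum_range_succ, Nat.add_sub_cancel, Nat.sub_self]
  have h4 : ∑ k ∈ Finset.range n, (fracWeight ν (n - 1 - k + 1) t : ℂ) * iteratedDeriv k f 0 =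
      ∑ k ∈ Finset.range n, (fracWeight ν (n - k) t : ℂ) * iteratedDeriv k f 0 := by
    refine Finset.sum_congr rfl fun k hk => ?_
    rw [show n - 1 - k + 1 = n - k by have := Finset.mem_range.mp hk; omega]
  rw [h4, fracWeight, show ν - (((0 : ℕ) : ℝ) + 1) = -(1 - ν) by push_cast; ring]
  push_cast
  ring

/-- The reflection formula, with sin(π/3) = sin(2π/3) = √3/2; this accounts for the factor √3/(2π).
-/
lemma stepCoeff_fracOrder_zero {j : ℕ} (hj : j = 0 ∨ j = 1) :
    stepCoeff (fracOrder j) 0 = -(1 / Real.Gamma (fracOrder j)) := by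
  have h1 : 0 < Real.Gamma (fracOrder j) := Real.Gamma_pos_of_pos (fracOrder_pos j)
  have h2 := Real.Gamma_mul_Gamma_one_sub (fracOrder j)
  have h3 : Real.sin (Real.pi * fracOrder j) = Real.sqrt 3 / 2 := by
    rcases hj with rfl | rfl
    · rw [← Real.sin_pi_div_three]; congr 1; simp [fracOrder]; ring
    · rw [← Real.sin_pi_div_three, ← Real.sin_pi_sub]; congr 1; simp [fracOrder]; ring
  rw [h3] at h2
  have h4 : (0 : ℝ) < Real.sqrt 3 := by positivity
  have h5 : Real.Gamma (1 - fracOrder j) = Real.pi / (Real.sqrt 3 / 2) / Real.Gamma (fracOrder j) := by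
    rw [← h2]; field_simp
  rw [stepCoeff, Nat.cast_zero, zero_add, zero_add, h5]
  have := Real.pi_pos
  field_simp

lemma rlIntegral_eq_fracBracket {j : ℕ} (hj : j = 0 ∨ j = 1) (f : ℂ → ℂ) {t : ℝ} (ht : 0 < t) :
    rlIntegral (fracOrder j) f t = fracBracket (1 - fracOrder j) 0 f t := by
  rw [fracBracket_eq (fracOrder_lt_one hj) 0 f ht, Finset.range_zero, Finset.sum_empty, zero_add,
    stepCoeff_fracOrder_zero hj, rlIntegral, abelIntegral, Complex.ofReal_neg, neg_mul, neg_neg]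
  congr 1
  refine integral_congr fun s hs => ?_
  rw [Set.uIcc_of_le ht.le] at hs
  rw [iteratedDeriv_zero, show fracOrder j - 1 = -(1 - fracOrder j) by ring,
    Real.rpow_neg (by linarith [hs.2]), Complex.ofReal_inv]
  ring

/-- The Riemann–Liouville integral is smooth, and its derivatives are given by `fracBracket`. -/
lemma contDiffAt_rlIntegral_and_rlDeriv_eq {j : ℕ} (hj : j = 0 ∨ j = 1) {f : ℂ → ℂ} {b : ℝ}
    (hf : ∀ n, ∀ s ∈ Set.Icc 0 b,
      HasDerivAt (fun s : ℝ => iteratedDeriv n f s) (iteratedDeriv (n + 1) f s) s)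
    (n : ℕ) {t : ℝ} (ht : t ∈ Set.Ioo 0 b) :
    ContDiffAt ℝ n (rlIntegral (fracOrder j) f) t ∧
      rlDeriv n (fracOrder j) f t = fracBracket (1 - fracOrder j) n f t := by
  obtain ⟨h1, h2⟩ := contDiffOn_and_iteratedDeriv_of_hasDerivAt_succ (isOpen_Ioo (a := (0 : ℝ)) (b := b))
    (R := fun n => fracBracket (1 - fracOrder j) n f)
    (fun n t ht => hasDerivAt_fracBracket (fracOrder_lt_one hj) (fracOrder_pos j) hf n ht) n
  have heq : rlIntegral (fracOrder j) f =ᶠ[𝓝 t] fracBracket (1 - fracOrder j) 0 f := by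
    filter_upwards [isOpen_Ioi.mem_nhds ht.1] with s hs using rlIntegral_eq_fracBracket hj f hs
  refine ⟨((h1 0).contDiffAt (isOpen_Ioo.mem_nhds ht)).congr_of_eventuallyEq heq, ?_⟩
  rw [rlDeriv, heq.iteratedDeriv_eq, h2 t ht]

/-! ### Cauchy estimates and summation of the expansion -/

lemma mem_nbhd_of_dist_le {T r s : ℝ} (hs : s ∈ Set.Icc 0 T) {z : ℂ} (hz : dist z s ≤ r) :
    z ∈ nbhd T r :=
  (Metric.infDist_le_dist_of_mem (Set.mem_image_of_mem _ hs)).trans hz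

/-- The room beyond T makes t = T an interior point when fractional derivatives are taken. -/
lemma ofReal_mem_nbhd {T r s : ℝ} (hT : 0 ≤ T) (hs : s ∈ Set.Icc 0 (T + r)) (hr : 0 ≤ r) :
    (s : ℂ) ∈ nbhd T r := by
  rcases le_total s T with h | h
  · exact mem_nbhd_of_dist_le (s := s) ⟨hs.1, h⟩ (by simpa using hr)
  · refine mem_nbhd_of_dist_le (s := T) ⟨hT, le_rfl⟩ ?_
    rw [Complex.dist_eq, ← Complex.ofReal_sub, Complex.norm_real, Real.norm_eq_abs,
      abs_of_nonneg (by linarith)]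
    linarith [hs.2]

lemma hasDerivAt_iteratedDeriv_ofReal {f : ℂ → ℂ} {s : ℝ} (hf : AnalyticAt ℂ f s) (n : ℕ) :
    HasDerivAt (fun s : ℝ => iteratedDeriv n f s) (iteratedDeriv (n + 1) f s) s := by
  have h : AnalyticAt ℂ (iteratedDeriv n f) s := by
    rw [iteratedDeriv_eq_iterate]; exact hf.iterated_deriv n
  rw [iteratedDeriv_succ]
  exact h.differentiableAt.hasDerivAt.comp_ofReal

/-- Cauchy's estimate on discs of radius r centred on the segment; the union of these discs is
compact, so one constant serves all of them. -/
lemma exists_norm_iteratedDeriv_le {T r : ℝ} (hr : 0 < r) {f : ℂ → ℂ}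
    (hf : AnalyticOnNhd ℂ f (nbhd T r)) :
    ∃ C, 0 ≤ C ∧ ∀ n, ∀ s ∈ Set.Icc 0 T, ‖iteratedDeriv n f (s : ℂ)‖ ≤ C * (n.factorial / r ^ n) := by
  have hK : IsCompact ((fun p : ℝ × ℂ => (p.1 : ℂ) + p.2) ''
      (Set.Icc (0 : ℝ) T ×ˢ Metric.closedBall (0 : ℂ) r)) :=
    (isCompact_Icc.prod (isCompact_closedBall _ _)).image (by fun_prop)
  have hsub : ((fun p : ℝ × ℂ => (p.1 : ℂ) + p.2) ''
      (Set.Icc (0 : ℝ) T ×ˢ Metric.closedBall (0 : ℂ) r)) ⊆ nbhd T r := by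
    rintro _ ⟨p, hp, rfl⟩
    exact mem_nbhd_of_dist_le hp.1 (by simpa using hp.2)
  obtain ⟨C, hC⟩ := hK.exists_bound_of_continuousOn (hf.continuousOn.mono hsub)
  refine ⟨max C 0, le_max_right _ _, fun n s hs => ?_⟩
  have hball : Metric.closedBall (s : ℂ) r ⊆ nbhd T r := fun z hz => mem_nbhd_of_dist_le hs hz
  have hd : DiffContOnCl ℂ f (Metric.ball (s : ℂ) r) := by
    refine DifferentiableOn.diffContOnCl fun z hz => ?_
    rw [closure_ball _ hr.ne'] at hz
    exact (hf z (hball hz)).differentiableAt.differentiableWithinAt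
  have := Complex.norm_iteratedDeriv_le_of_forall_mem_sphere_norm_le n hr hd (C := max C 0) fun z hz => by
    refine (hC z ⟨(s, z - s), ⟨hs, ?_⟩, by simp⟩).trans (le_max_left _ _)
    rw [mem_closedBall_zero_iff, ← dist_eq_norm]
    exact (Metric.sphere_subset_closedBall hz)
  refine this.trans (le_of_eq ?_)
  ring

/-- The term of the series that comes from the value of the `n`-th derivative at time `t`. -/
def valueTerm (j : ℕ) (f : ℂ → ℂ) (t : ℝ) (z : ℂ) (n : ℕ) : ℂ :=
  iteratedDeriv n f t / (3 * n + j).factorial * z ^ (3 * n + j)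

/-- The terms of the series that come from the derivatives at the initial time. -/
def initialTerm (j : ℕ) (f : ℂ → ℂ) (t : ℝ) (z : ℂ) (p : ℕ × ℕ) : ℂ :=
  fracWeight (fracOrder j) p.2 t * iteratedDeriv p.1 f 0 / (3 * (p.1 + p.2) + 2).factorial *
    z ^ (3 * (p.1 + p.2) + 2)

/-- The term of the series that comes from the Abel integral of the `(n + 1)`-st derivative. -/
def abelTerm (j : ℕ) (f : ℂ → ℂ) (t : ℝ) (z : ℂ) (n : ℕ) : ℂ :=
  stepCoeff (fracOrder j) 0 * abelIntegral (1 - fracOrder j) (fun s => iteratedDeriv (n + 1) f s) t /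
    (3 * n + 2).factorial * z ^ (3 * n + 2)

/-- The term of the series with the exponent `3 n + 2`. -/
def bracketTerm (j : ℕ) (f : ℂ → ℂ) (t : ℝ) (z : ℂ) (n : ℕ) : ℂ :=
  -fracBracket (1 - fracOrder j) (n + 1) f t / (3 * n + 2).factorial * z ^ (3 * n + 2)

/-- The initial values f^{(k)}(0) with weight index i contribute to the exponent 3(k + i) + 2, so a
coefficient collects an antidiagonal. -/
lemma bracketTerm_eq {j : ℕ} (hj : j = 0 ∨ j = 1) (f : ℂ → ℂ) {t : ℝ} (ht : 0 < t) (z : ℂ) (n : ℕ) :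
    bracketTerm j f t z n =
      (∑ p ∈ Finset.HasAntidiagonal.antidiagonal n, initialTerm j f t z p) + abelTerm j f t z n := by
  rw [bracketTerm, fracBracket_eq (fracOrder_lt_one hj) (n + 1) f ht, neg_neg, add_div, add_mul,
    Nat.add_sub_cancel, abelTerm, Finset.Nat.sum_antidiagonal_eq_sum_range_succ_mk, Finset.sum_div,
    Finset.sum_mul]
  congr 1
  refine Finset.sum_congr rfl fun k hk => ?_
  rw [initialTerm, Nat.add_sub_cancel' (Nat.lt_succ_iff.mp (Finset.mem_range.mp hk))]

lemma abelIntegral_eq_integral_rpow (ν : ℝ) (h : ℝ → ℂ) {t : ℝ} (ht : 0 ≤ t) :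
    abelIntegral (1 - ν) h t = ∫ τ in (0 : ℝ)..t, ((τ ^ (ν - 1) : ℝ) : ℂ) * h (t - τ) := by
  have := intervalIntegral.integral_comp_sub_left (a := 0) (b := t)
    (fun s => h s / (((t - s) ^ (1 - ν) : ℝ) : ℂ)) t
  rw [sub_self, sub_zero] at this
  rw [abelIntegral, ← this]
  refine integral_congr fun τ hτ => ?_
  rw [Set.uIcc_of_le ht] at hτ
  rw [sub_sub_cancel, show ν - 1 = -(1 - ν) by ring, Real.rpow_neg hτ.1, Complex.ofReal_inv]
  ring

lemma norm_abelIntegral_le {ν : ℝ} (hν : 0 < ν) {h : ℝ → ℂ} {t D : ℝ} (ht : 0 ≤ t)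
    (hD : ∀ s ∈ Set.Icc 0 t, ‖h s‖ ≤ D) : ‖abelIntegral (1 - ν) h t‖ ≤ t ^ ν / ν * D := by
  rw [abelIntegral_eq_integral_rpow ν h ht]
  have hi := intervalIntegrable_rpow' (a := 0) (b := t) (r := ν - 1) (by linarith)
  refine (intervalIntegral.norm_integral_le_of_norm_le (g := fun τ => τ ^ (ν - 1) * D) ht
    (Eventually.of_forall fun τ hτ => ?_) (hi.mul_const D)).trans (le_of_eq ?_)
  · rw [norm_mul, Complex.norm_real, Real.norm_of_nonneg (Real.rpow_nonneg hτ.1.le _)]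
    exact mul_le_mul_of_nonneg_left (hD _ ⟨by linarith [hτ.2], by linarith [hτ.1]⟩)
      (Real.rpow_nonneg hτ.1.le _)
  · rw [intervalIntegral.integral_mul_const, integral_rpow (Or.inl (by linarith)), sub_add_cancel,
      Real.zero_rpow hν.ne', sub_zero]

lemma factorial_mul_factorial_le_of_add_le {m n N : ℕ} (h : m + n ≤ N) :
    m.factorial * n.factorial ≤ N.factorial :=
  (Nat.le_of_dvd (Nat.factorial_pos _) (Nat.factorial_mul_factorial_dvd_factorial_add m n)).trans
    (Nat.factorial_le h)

section Sums

variable {j : ℕ} {f : ℂ → ℂ} {t r C : ℝ}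

lemma norm_valueTerm_le (hr : 0 < r) (z : ℂ) (n : ℕ)
    (hC : ‖iteratedDeriv n f t‖ ≤ C * (n.factorial / r ^ n)) (hC0 : 0 ≤ C) :
    ‖valueTerm j f t z n‖ ≤ C * ‖z‖ ^ j * ((‖z‖ ^ 3 / r) ^ n / n.factorial) := by
  have h3 : (n.factorial : ℝ) / (3 * n + j).factorial ≤ 1 / n.factorial := by
    rw [div_le_div_iff₀ (by positivity) (by positivity), one_mul]
    exact_mod_cast factorial_mul_factorial_le_of_add_le (by omega)
  rw [valueTerm, norm_mul, norm_div, norm_pow, Complex.norm_natCast]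
  calc ‖iteratedDeriv n f t‖ / (3 * n + j).factorial * ‖z‖ ^ (3 * n + j)
      ≤ C * (n.factorial / r ^ n) / (3 * n + j).factorial * ‖z‖ ^ (3 * n + j) := by gcongr
    _ = C * ‖z‖ ^ j * (‖z‖ ^ 3 / r) ^ n * (n.factorial / (3 * n + j).factorial) := by
      rw [div_pow, ← pow_mul]; ring
    _ ≤ C * ‖z‖ ^ j * (‖z‖ ^ 3 / r) ^ n * (1 / n.factorial) := by gcongr
    _ = _ := by ring

lemma norm_abelTerm_le (hr : 0 < r) (ht : 0 ≤ t) (z : ℂ) (n : ℕ)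
    (hC : ∀ s ∈ Set.Icc 0 t, ‖iteratedDeriv (n + 1) f (s : ℂ)‖ ≤ C * ((n + 1).factorial / r ^ (n + 1)))
    (hC0 : 0 ≤ C) :
    ‖abelTerm j f t z n‖ ≤ |stepCoeff (fracOrder j) 0| * (t ^ fracOrder j / fracOrder j) * (C / r) *
      ‖z‖ ^ 2 * ((‖z‖ ^ 3 / r) ^ n / n.factorial) := by
  have hν := fracOrder_pos j
  have h1 := norm_abelIntegral_le hν (h := fun s => iteratedDeriv (n + 1) f s) ht hC
  have h3 : ((n + 1).factorial : ℝ) / (3 * n + 2).factorial ≤ 1 / n.factorial := by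
    rw [div_le_div_iff₀ (by positivity) (by positivity), one_mul]
    exact_mod_cast factorial_mul_factorial_le_of_add_le (by omega)
  have h4 : 0 ≤ t ^ fracOrder j := Real.rpow_nonneg ht _
  rw [abelTerm, norm_mul, norm_div, norm_mul, norm_pow, Complex.norm_natCast, Complex.norm_real,
    Real.norm_eq_abs]
  calc |stepCoeff (fracOrder j) 0| *
        ‖abelIntegral (1 - fracOrder j) (fun s => iteratedDeriv (n + 1) f s) t‖ /
        (3 * n + 2).factorial * ‖z‖ ^ (3 * n + 2)
      ≤ |stepCoeff (fracOrder j) 0| * (t ^ fracOrder j / fracOrder j *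
        (C * ((n + 1).factorial / r ^ (n + 1)))) / (3 * n + 2).factorial * ‖z‖ ^ (3 * n + 2) := by
        gcongr
    _ = |stepCoeff (fracOrder j) 0| * (t ^ fracOrder j / fracOrder j) * (C / r) *
      ‖z‖ ^ 2 * (‖z‖ ^ 3 / r) ^ n * ((n + 1).factorial / (3 * n + 2).factorial) := by
      rw [div_pow, ← pow_mul]
      field_simp
      ring
    _ ≤ |stepCoeff (fracOrder j) 0| * (t ^ fracOrder j / fracOrder j) * (C / r) *
      ‖z‖ ^ 2 * (‖z‖ ^ 3 / r) ^ n * (1 / n.factorial) := by gcongr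
    _ = _ := by ring

/-- (3(k + i) + 2)! dominates (k! i!)²: half absorbs the growth of the derivative and of the weight,
the rest leaves a product of two exponential series. The double family is therefore absolutely
summable. -/
lemma norm_initialTerm_le (hj : j = 0 ∨ j = 1) (hr : 0 < r) (ht : 0 < t) (z : ℂ) (p : ℕ × ℕ)
    (hC : ‖iteratedDeriv p.1 f 0‖ ≤ C * (p.1.factorial / r ^ p.1)) (hC0 : 0 ≤ C) :
    ‖initialTerm j f t z p‖ ≤ |stepCoeff (fracOrder j) 0| * t ^ (fracOrder j - 1) * C * ‖z‖ ^ 2 *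
      ((‖z‖ ^ 3 / r) ^ p.1 / p.1.factorial * ((‖z‖ ^ 3 / t) ^ p.2 / p.2.factorial)) := by
  obtain ⟨k, i⟩ := p
  dsimp only at hC ⊢
  have h1 := abs_stepCoeff_le (fracOrder_pos j).le (fracOrder_lt_one hj) i
  have h2 : t ^ (fracOrder j - (i + 1)) = t ^ (fracOrder j - 1) / t ^ i := by
    rw [← Real.rpow_natCast, ← Real.rpow_sub ht]; congr 1; ring
  have h3 : (i.factorial * k.factorial : ℝ) / (3 * (k + i) + 2).factorial ≤
      1 / (i.factorial * k.factorial) := by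
    rw [div_le_div_iff₀ (by positivity) (by positivity), one_mul]
    have h5 := factorial_mul_factorial_le_of_add_le (le_refl (i + k))
    exact_mod_cast (Nat.mul_le_mul h5 h5).trans (factorial_mul_factorial_le_of_add_le (by omega))
  have h4 : 0 < t ^ (fracOrder j - 1) := Real.rpow_pos_of_pos ht _
  have h6 : |t ^ (fracOrder j - (i + 1))| = t ^ (fracOrder j - 1) / t ^ i := by
    rw [h2, abs_of_nonneg (by positivity)]
  rw [initialTerm, norm_mul, norm_div, norm_mul, norm_pow, Complex.norm_natCast, Complex.norm_real,
    Real.norm_eq_abs, fracWeight, abs_mul, h6]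
  calc |stepCoeff (fracOrder j) i| * (t ^ (fracOrder j - 1) / t ^ i) * ‖iteratedDeriv k f 0‖ /
        (3 * (k + i) + 2).factorial * ‖z‖ ^ (3 * (k + i) + 2)
      ≤ (|stepCoeff (fracOrder j) 0| * i.factorial) * (t ^ (fracOrder j - 1) / t ^ i) *
        (C * (k.factorial / r ^ k)) / (3 * (k + i) + 2).factorial * ‖z‖ ^ (3 * (k + i) + 2) := by
        gcongr
    _ = |stepCoeff (fracOrder j) 0| * t ^ (fracOrder j - 1) * C * ‖z‖ ^ 2 *
        (‖z‖ ^ 3 / r) ^ k * (‖z‖ ^ 3 / t) ^ i *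
        ((i.factorial * k.factorial : ℝ) / (3 * (k + i) + 2).factorial) := by
      rw [div_pow, div_pow, ← pow_mul, ← pow_mul]; ring
    _ ≤ |stepCoeff (fracOrder j) 0| * t ^ (fracOrder j - 1) * C * ‖z‖ ^ 2 *
        (‖z‖ ^ 3 / r) ^ k * (‖z‖ ^ 3 / t) ^ i * (1 / (i.factorial * k.factorial)) := by gcongr
    _ = _ := by
      rw [div_mul_div_comm]; ring

lemma summable_initialTerm (hj : j = 0 ∨ j = 1) (hr : 0 < r) (ht : 0 < t) (hC0 : 0 ≤ C)
    (hC : ∀ n, ∀ s ∈ Set.Icc 0 t, ‖iteratedDeriv n f (s : ℂ)‖ ≤ C * (n.factorial / r ^ n)) (z : ℂ) :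
    Summable (initialTerm j f t z) := by
  refine Summable.of_norm_bounded ?_ fun p => norm_initialTerm_le hj hr ht z p (by
    simpa using hC p.1 0 ⟨le_rfl, ht.le⟩) hC0
  exact ((Real.summable_pow_div_factorial _).mul_of_nonneg (Real.summable_pow_div_factorial _)
    (fun n => by positivity) (fun n => by positivity)).mul_left _

lemma summable_valueTerm (hr : 0 < r) (ht : 0 < t) (hC0 : 0 ≤ C)
    (hC : ∀ n, ∀ s ∈ Set.Icc 0 t, ‖iteratedDeriv n f (s : ℂ)‖ ≤ C * (n.factorial / r ^ n)) (z : ℂ) :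
    Summable (valueTerm j f t z) :=
  Summable.of_norm_bounded ((Real.summable_pow_div_factorial _).mul_left _)
    fun n => norm_valueTerm_le hr z n (hC n t ⟨ht.le, le_rfl⟩) hC0

lemma summable_abelTerm (hr : 0 < r) (ht : 0 < t) (hC0 : 0 ≤ C)
    (hC : ∀ n, ∀ s ∈ Set.Icc 0 t, ‖iteratedDeriv n f (s : ℂ)‖ ≤ C * (n.factorial / r ^ n)) (z : ℂ) :
    Summable (abelTerm j f t z) :=
  Summable.of_norm_bounded ((Real.summable_pow_div_factorial _).mul_left _)
    fun n => norm_abelTerm_le hr ht.le z n (hC (n + 1)) hC0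

lemma hasSum_sum_antidiagonal {u : ℕ × ℕ → ℂ} {a : ℂ} (hu : HasSum u a) :
    HasSum (fun n => ∑ p ∈ Finset.HasAntidiagonal.antidiagonal n, u p) a := by
  have h := (Finset.HasAntidiagonal.sigmaAntidiagonalEquivProd (A := ℕ)).hasSum_iff.mpr hu
  refine h.sigma fun n => ?_
  have h2 := hasSum_fintype fun p : Finset.HasAntidiagonal.antidiagonal n => u p
  rw [Finset.sum_coe_sort (Finset.HasAntidiagonal.antidiagonal n) u] at h2
  exact h2

lemma hasSum_bracketTerm (hj : j = 0 ∨ j = 1) (hr : 0 < r) (ht : 0 < t) (hC0 : 0 ≤ C)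
    (hC : ∀ n, ∀ s ∈ Set.Icc 0 t, ‖iteratedDeriv n f (s : ℂ)‖ ≤ C * (n.factorial / r ^ n)) (z : ℂ) :
    HasSum (bracketTerm j f t z) (∑' p, initialTerm j f t z p + ∑' n, abelTerm j f t z n) := by
  have h := (hasSum_sum_antidiagonal (summable_initialTerm hj hr ht hC0 hC z).hasSum).add
    (summable_abelTerm (j := j) hr ht hC0 hC z).hasSum
  exact h.congr_fun fun n => bracketTerm_eq hj f ht z n

/-- The remainder after `N` steps of the expansion. -/
def remainder (j : ℕ) (f : ℂ → ℂ) (x t : ℝ) (N : ℕ) : ℂ :=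
  stepPrim j (3 * N) x t * iteratedDeriv N f 0 +
    ∫ τ in (0 : ℝ)..t, (stepPrim j (3 * N) x τ : ℂ) * iteratedDeriv (N + 1) f ((t - τ : ℝ) : ℂ)

lemma initialTerm_eq_stepTerm (j : ℕ) (f : ℂ → ℂ) (x t : ℝ) (N i : ℕ) :
    initialTerm j f t x (N, i) = stepTerm j (3 * N) x t i * iteratedDeriv N f 0 := by
  rw [initialTerm, stepTerm, fracWeight]
  dsimp only
  rw [show 3 * (N + i) + 2 = 3 * i + 2 + 3 * N by ring]
  push_cast
  ring

/-- One step of the expansion. The leading monomial of `stepPrim` times f^{(N)}(0) cancels against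
the lower limit F 0, so only the value at t remains. -/
lemma remainder_eq (hj : j = 0 ∨ j = 1) {x : ℝ} (hx : 0 < x) (ht : 0 < t)
    (hf : ∀ n, ∀ s ∈ Set.Icc 0 t,
      HasDerivAt (fun s : ℝ => iteratedDeriv n f s) (iteratedDeriv (n + 1) f s) s) (N : ℕ) :
    remainder j f x t N = valueTerm j f t x N + ∑' i, initialTerm j f t x (N, i) +
      abelTerm j f t x N + remainder j f x t (N + 1) := by
  have h := integral_stepPrim_mul_eq hj (3 * N) hx ht (hf N) (hf (N + 1))
    (fun s hs => (hf (N + 2) s hs).continuousAt.continuousWithinAt)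
  have h2 : ∑' i, initialTerm j f t x (N, i) =
      ((∑' i, stepTerm j (3 * N) x t i : ℝ) : ℂ) * iteratedDeriv N f 0 := by
    rw [Complex.ofReal_tsum, ← tsum_mul_right]
    exact tsum_congr fun i => initialTerm_eq_stepTerm j f x t N i
  rw [remainder, h, remainder, h2, abelTerm, abelIntegral_eq_integral_rpow _ _ ht.le, valueTerm,
    stepPrim, show 3 * (N + 1) = 3 * N + 3 by ring, show N + 1 + 1 = N + 2 by ring]
  push_cast
  ring

lemma tendsto_remainder (hj : j = 0 ∨ j = 1) {x : ℝ} (hx : 0 < x) (hr : 0 < r) (ht : 0 < t)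
    (hC0 : 0 ≤ C)
    (hC : ∀ n, ∀ s ∈ Set.Icc 0 t, ‖iteratedDeriv n f (s : ℂ)‖ ≤ C * (n.factorial / r ^ n)) :
    Tendsto (remainder j f x t) atTop (𝓝 0) := by
  obtain ⟨B, hB, hP⟩ := exists_abs_stepPrim_le hj hx
  -- The comparison (n + 1)! n! ≤ (3n)! used below needs n ≥ 1.
  rw [← tendsto_add_atTop_iff_nat 1]
  have hlim := (((summable_nat_add_iff 1).mpr
    (Real.summable_pow_div_factorial (x ^ 3 / r))).mul_left (B * C * (1 + t / r))).tendsto_atTop_zero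
  refine squeeze_zero_norm (fun N => ?_) hlim
  set n := N + 1 with hn
  have hb : ∀ τ, 0 < τ → |stepPrim j (3 * n) x τ| ≤ B * (x ^ (3 * n) / (3 * n).factorial) :=
    fun τ hτ => hP (3 * n) x ⟨hx, le_rfl⟩ τ hτ
  have h1 : (n.factorial : ℝ) / (3 * n).factorial ≤ 1 / n.factorial := by
    rw [div_le_div_iff₀ (by positivity) (by positivity), one_mul]
    exact_mod_cast factorial_mul_factorial_le_of_add_le (by omega)
  have h2 : ((n + 1).factorial : ℝ) / (3 * n).factorial ≤ 1 / n.factorial := by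
    rw [div_le_div_iff₀ (by positivity) (by positivity), one_mul]
    exact_mod_cast factorial_mul_factorial_le_of_add_le (by omega)
  have e1 : ‖(stepPrim j (3 * n) x t : ℂ) * iteratedDeriv n f 0‖ ≤
      B * C * ((x ^ 3 / r) ^ n / n.factorial) := by
    rw [norm_mul, Complex.norm_real, Real.norm_eq_abs]
    have h3 : ‖iteratedDeriv n f 0‖ ≤ C * (n.factorial / r ^ n) := by
      simpa using hC n 0 ⟨le_rfl, ht.le⟩
    calc _ ≤ B * (x ^ (3 * n) / (3 * n).factorial) * (C * (n.factorial / r ^ n)) := by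
          have := hb t ht
          gcongr
      _ = B * C * (x ^ 3 / r) ^ n * (n.factorial / (3 * n).factorial) := by
          rw [div_pow, ← pow_mul]; ring
      _ ≤ B * C * (x ^ 3 / r) ^ n * (1 / n.factorial) := by gcongr
      _ = _ := by ring
  have e2 : ‖∫ τ in (0 : ℝ)..t,
      (stepPrim j (3 * n) x τ : ℂ) * iteratedDeriv (n + 1) f ((t - τ : ℝ) : ℂ)‖ ≤
      B * C * (t / r) * ((x ^ 3 / r) ^ n / n.factorial) := by
    have h4 : ∀ τ ∈ Set.uIoc 0 t,
        ‖(stepPrim j (3 * n) x τ : ℂ) * iteratedDeriv (n + 1) f ((t - τ : ℝ) : ℂ)‖ ≤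
        B * (x ^ (3 * n) / (3 * n).factorial) * (C * ((n + 1).factorial / r ^ (n + 1))) := by
      intro τ hτ
      rw [Set.uIoc_of_le ht.le] at hτ
      rw [norm_mul, Complex.norm_real, Real.norm_eq_abs]
      have h5 := hb τ hτ.1
      have h6 := hC (n + 1) (t - τ) ⟨by linarith [hτ.2], by linarith [hτ.1]⟩
      gcongr
    refine (intervalIntegral.norm_integral_le_of_norm_le_const h4).trans ?_
    rw [sub_zero, abs_of_pos ht]
    calc _ = B * C * (t / r) * (x ^ 3 / r) ^ n * ((n + 1).factorial / (3 * n).factorial) := by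
          rw [div_pow, ← pow_mul]; field_simp; ring
      _ ≤ B * C * (t / r) * (x ^ 3 / r) ^ n * (1 / n.factorial) := by gcongr
      _ = _ := by ring
  calc ‖remainder j f x t n‖ ≤ _ := norm_add_le _ _
    _ ≤ _ := add_le_add e1 e2
    _ = _ := by ring

/-- The expansion of the response in powers of `x`. -/
lemma remainder_zero_eq (hj : j = 0 ∨ j = 1) {x : ℝ} (hx : 0 < x) (hr : 0 < r) (ht : 0 < t)
    (hC0 : 0 ≤ C)
    (hC : ∀ n, ∀ s ∈ Set.Icc 0 t, ‖iteratedDeriv n f (s : ℂ)‖ ≤ C * (n.factorial / r ^ n))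
    (hf : ∀ n, ∀ s ∈ Set.Icc 0 t,
      HasDerivAt (fun s : ℝ => iteratedDeriv n f s) (iteratedDeriv (n + 1) f s) s) :
    remainder j f x t 0 = ∑' n, valueTerm j f t x n +
      (∑' p, initialTerm j f t x p + ∑' n, abelTerm j f t x n) := by
  have hI := summable_initialTerm hj hr ht hC0 hC (x : ℂ)
  -- The steps of the expansion yield the initial terms row by row, the power series by
  -- antidiagonals; absolute summability identifies the two sums.
  have h1 := ((summable_valueTerm (j := j) hr ht hC0 hC (x : ℂ)).hasSum.add
    (hI.hasSum.prod_fiberwise fun N => (hI.prod_factor N).hasSum)).add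
    (summable_abelTerm (j := j) hr ht hC0 hC (x : ℂ)).hasSum
  have h2 := h1.tendsto_sum_nat
  have h3 : ∀ K, ∑ N ∈ Finset.range K, (valueTerm j f t x N + ∑' i, initialTerm j f t x (N, i) +
      abelTerm j f t x N) = remainder j f x t 0 - remainder j f x t K := by
    intro K
    rw [← Finset.sum_range_sub']
    refine Finset.sum_congr rfl fun N _ => ?_
    rw [remainder_eq hj hx ht hf N]
    ring
  have h4 : Tendsto (fun K => remainder j f x t 0 - remainder j f x t K) atTop
      (𝓝 (remainder j f x t 0 - 0)) := tendsto_const_nhds.sub (tendsto_remainder hj hx hr ht hC0 hC)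
  rw [sub_zero] at h4
  rw [tendsto_nhds_unique h4 (h2.congr h3), add_assoc]

end Sums

/-! ### Assembly of the power series and the main theorem -/

/-- The coefficients of the series in powers of `x`. -/
def seriesCoeff (j : ℕ) (f : ℂ → ℂ) (t : ℝ) (m : ℕ) : ℂ :=
  if m % 3 = j then iteratedDeriv (m / 3) f (t : ℂ) / (m.factorial : ℂ)
  else if m % 3 = 2 then -fracBracket (1 - fracOrder j) ((m + 1) / 3) f t / (m.factorial : ℂ)
  else 0

lemma hasSum_of_hasSum_residue {u : ℕ → ℂ} {a : ℂ} {v : ℕ → ℂ} {i : ℕ} (hi : i < 3)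
    (hv : HasSum v a) (h : ∀ n, u (3 * n + i) = v n) :
    HasSum (fun m => if m % 3 = i then u m else 0) a := by
  have hinj : Function.Injective fun n : ℕ => 3 * n + i := fun a b hab => by
    simp only at hab; omega
  refine (hinj.hasSum_iff fun m hm => ?_).mp (hv.congr_fun fun n => ?_)
  · rw [if_neg]
    rintro rfl
    exact hm ⟨m / 3, by simp only; omega⟩
  · have : (3 * n + i) % 3 = i := by omega
    simp only [Function.comp, if_pos this, h]

lemma hasSum_seriesCoeff {j : ℕ} (hj : j = 0 ∨ j = 1) {f : ℂ → ℂ} {t : ℝ} {z a b : ℂ}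
    (ha : HasSum (valueTerm j f t z) a) (hb : HasSum (bracketTerm j f t z) b) :
    HasSum (fun m => seriesCoeff j f t m * z ^ m) (a + b) := by
  have h1 := hasSum_of_hasSum_residue (i := j) (by omega) ha
    (u := fun m => iteratedDeriv (m / 3) f (t : ℂ) / (m.factorial : ℂ) * z ^ m) fun n => by
      rw [show (3 * n + j) / 3 = n by omega, valueTerm]
  have h2 := hasSum_of_hasSum_residue (i := 2) (by omega) hb
    (u := fun m => -fracBracket (1 - fracOrder j) ((m + 1) / 3) f t / (m.factorial : ℂ) * z ^ m)
    fun n => by rw [show (3 * n + 2 + 1) / 3 = n + 1 by omega, bracketTerm]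
  refine (h1.add h2).congr_fun fun m => ?_
  rw [seriesCoeff]
  by_cases e1 : m % 3 = j
  · have e2 : ¬ m % 3 = 2 := by omega
    simp only [if_pos e1, if_neg e2, add_zero]
  · by_cases e2 : m % 3 = 2
    · simp only [if_neg e1, if_pos e2, zero_add]
    · simp only [if_neg e1, if_neg e2, add_zero, zero_mul]

/-- Convergence at the real point ‖z‖ + 1 gives a summable majorant on the disc of that radius. -/
lemma differentiable_tsum_of_summable {c : ℕ → ℂ} (h : ∀ z : ℂ, Summable fun m => c m * z ^ m) :
    Differentiable ℂ fun z => ∑' m, c m * z ^ m := by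
  intro z
  have hd := Complex.differentiableOn_tsum_of_summable_norm (F := fun m z => c m * z ^ m)
    (U := Metric.ball 0 (‖z‖ + 1)) (h (‖z‖ + 1 : ℝ)).norm (fun m => by fun_prop) Metric.isOpen_ball
    fun m w hw => by
      rw [mem_ball_zero_iff] at hw
      rw [norm_mul, norm_mul, norm_pow, norm_pow, Complex.norm_real,
        Real.norm_of_nonneg (by positivity)]
      gcongr
  exact hd.differentiableAt (Metric.isOpen_ball.mem_nhds (by simp))

lemma aCoeff_eq (f : ℂ → ℂ) (t : ℝ) : aCoeff f t = seriesCoeff 0 f t := by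
  funext m
  rw [aCoeff, seriesCoeff, show 1 - fracOrder 0 = 2 / 3 by norm_num [fracOrder]]

lemma bCoeff_eq (f : ℂ → ℂ) (t : ℝ) : bCoeff f t = seriesCoeff 1 f t := by
  funext m
  rw [bCoeff, seriesCoeff, show 1 - fracOrder 1 = 1 / 3 by norm_num [fracOrder]]

/-- The part of the solution that comes from the `j`-th spatial derivative at the boundary. -/
def response (j : ℕ) (f : ℂ → ℂ) (x t : ℝ) : ℂ :=
  weight₁ j * integralΩ₁ (integrand (2 - j) f x t) + weight₂ j * integralΩ₂ (integrand (2 - j) f x t)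

lemma If₀_eq (f : ℂ → ℂ) (x t : ℝ) : If₀ f x t = response 0 f x t := by
  simp [If₀, response, weight₁, weight₂]

lemma If₁_eq (f : ℂ → ℂ) (x t : ℝ) : If₁ f x t = response 1 f x t := by
  simp [If₁, response, weight₁, weight₂]

lemma integrand_zero_right (p : ℕ) (f : ℂ → ℂ) (x : ℝ) : integrand p f x 0 = 0 := by
  funext k
  simp [integrand, timeTransform]

lemma tendsto_sectorBoundaryPartial_zero (θ₁ θ₂ : ℝ) :
    Tendsto (sectorBoundaryPartial θ₁ θ₂ 0) atTop (𝓝 0) := by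
  have h : sectorBoundaryPartial θ₁ θ₂ 0 = fun _ => 0 := by
    funext R
    simp [sectorBoundaryPartial, raySegmentIntegral]
  rw [h]
  exact tendsto_const_nhds

/-- Settles t = 0 separately, where the series with its negative powers of t is not used. -/
lemma response_zero_right (j : ℕ) (f : ℂ → ℂ) (x : ℝ) : response j f x 0 = 0 := by
  rw [response, integrand_zero_right, integralΩ₁, integralΩ₂, sectorBoundaryIntegral,
    sectorBoundaryIntegral, (tendsto_sectorBoundaryPartial_zero _ _).limUnder_eq,
    (tendsto_sectorBoundaryPartial_zero _ _).limUnder_eq, mul_zero, mul_zero, add_zero]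

section

variable {j : ℕ} {r T : ℝ} {f : ℂ → ℂ}

lemma hasDerivAt_iteratedDeriv_of_analyticOnNhd_nbhd (hr : 0 ≤ r) (hT : 0 ≤ T)
    (hf : AnalyticOnNhd ℂ f (nbhd T r)) (n : ℕ) {s : ℝ} (hs : s ∈ Set.Icc 0 (T + r)) :
    HasDerivAt (fun s : ℝ => iteratedDeriv n f s) (iteratedDeriv (n + 1) f s) s :=
  hasDerivAt_iteratedDeriv_ofReal (hf _ (ofReal_mem_nbhd hT hs hr)) n

lemma convergesΩ_and_response_eq (hj : j = 0 ∨ j = 1) {x t : ℝ} (hx : 0 < x) (ht : 0 < t)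
    (hf : ∀ n, ∀ s ∈ Set.Icc 0 t,
      HasDerivAt (fun s : ℝ => iteratedDeriv n f s) (iteratedDeriv (n + 1) f s) s) :
    ConvergesΩ (integrand (2 - j) f x t) ∧ response j f x t = remainder j f x t 0 := by
  have h0 : ∀ s ∈ Set.Icc 0 t, HasDerivAt (fun s : ℝ => f s) (iteratedDeriv 1 f s) s := fun s hs => by
    simpa using hf 0 s hs
  have h := boundary_integrals_eq hj hx ht (g := fun s => iteratedDeriv 1 f s) h0
    (fun s hs => (hf 1 s hs).continuousAt.continuousWithinAt)
  refine ⟨h.1, ?_⟩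
  rw [response, h.2, remainder, mul_zero, zero_add, iteratedDeriv_zero]

/-- The response is given by an everywhere convergent power series. -/
lemma exists_entire_response (hj : j = 0 ∨ j = 1) (hr : 0 < r) (hT : 0 < T)
    (hf : AnalyticOnNhd ℂ f (nbhd T r)) {t : ℝ} (ht : t ∈ Set.Ioc 0 T) :
    ∃ S : ℂ → ℂ, Differentiable ℂ S ∧
      (∀ z : ℂ, HasSum (fun m : ℕ => seriesCoeff j f t m * z ^ m) (S z)) ∧
      ∀ x : ℝ, 0 < x → response j f x t = S x := by
  obtain ⟨C, hC0, hC⟩ := exists_norm_iteratedDeriv_le hr hf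
  have hC' : ∀ n, ∀ s ∈ Set.Icc 0 t, ‖iteratedDeriv n f (s : ℂ)‖ ≤ C * (n.factorial / r ^ n) :=
    fun n s hs => hC n s ⟨hs.1, hs.2.trans ht.2⟩
  have hd : ∀ n, ∀ s ∈ Set.Icc 0 t,
      HasDerivAt (fun s : ℝ => iteratedDeriv n f s) (iteratedDeriv (n + 1) f s) s := fun n s hs =>
    hasDerivAt_iteratedDeriv_of_analyticOnNhd_nbhd hr.le hT.le hf n
      ⟨hs.1, by linarith [hs.2, ht.2]⟩
  have hs : ∀ z : ℂ, HasSum (fun m : ℕ => seriesCoeff j f t m * z ^ m)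
      (∑' n, valueTerm j f t z n + (∑' p, initialTerm j f t z p + ∑' n, abelTerm j f t z n)) :=
    fun z => hasSum_seriesCoeff hj (summable_valueTerm hr ht.1 hC0 hC' z).hasSum
      (hasSum_bracketTerm hj hr ht.1 hC0 hC' z)
  refine ⟨fun z => ∑' m, seriesCoeff j f t m * z ^ m,
    differentiable_tsum_of_summable fun z => (hs z).summable, fun z => (hs z).summable.hasSum,
    fun x hx => ?_⟩
  rw [(convergesΩ_and_response_eq hj hx ht.1 hd).2, remainder_zero_eq hj hx hr ht.1 hC0 hC' hd]
  exact (hs x).tsum_eq.symm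

lemma convergesΩ_of_analyticOnNhd (hj : j = 0 ∨ j = 1) (hr : 0 < r) (hT : 0 < T)
    (hf : AnalyticOnNhd ℂ f (nbhd T r)) {t : ℝ} (ht : t ∈ Set.Icc 0 T) {x : ℝ} (hx : 0 < x) :
    ConvergesΩ (integrand (2 - j) f x t) := by
  rcases ht.1.eq_or_lt with rfl | h0
  · rw [integrand_zero_right]
    exact ⟨⟨0, tendsto_sectorBoundaryPartial_zero _ _⟩, ⟨0, tendsto_sectorBoundaryPartial_zero _ _⟩⟩
  · exact (convergesΩ_and_response_eq hj hx h0 fun n s hs =>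
      hasDerivAt_iteratedDeriv_of_analyticOnNhd_nbhd hr.le hT.le hf n
        ⟨hs.1, by linarith [hs.2, ht.2]⟩).1

lemma analyticOnNhd_response (hj : j = 0 ∨ j = 1) (hr : 0 < r) (hT : 0 < T)
    (hf : AnalyticOnNhd ℂ f (nbhd T r)) {t : ℝ} (ht : t ∈ Set.Icc 0 T) :
    AnalyticOnNhd ℝ (fun x : ℝ => response j f x t) (Set.Ioi 0) := by
  rcases ht.1.eq_or_lt with rfl | h0
  · simp only [response_zero_right]
    exact analyticOnNhd_const
  · obtain ⟨S, hS, -, h⟩ := exists_entire_response hj hr hT hf ⟨h0, ht.2⟩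
    refine AnalyticOnNhd.congr isOpen_Ioi (f := fun x : ℝ => S x) (fun x _ => ?_)
      fun x hx => (h x hx).symm
    have h1 : AnalyticAt ℝ S x := (hS.analyticAt (x : ℂ)).restrictScalars
    exact h1.comp (g := S) (f := fun x : ℝ => (x : ℂ)) (Complex.ofRealCLM.analyticAt x)

lemma seriesCoeff_eq_rlDeriv (hj : j = 0 ∨ j = 1) (hr : 0 < r) (hT : 0 < T)
    (hf : AnalyticOnNhd ℂ f (nbhd T r)) {t : ℝ} (ht : t ∈ Set.Ioc 0 T) {n : ℕ} (hn : 1 ≤ n) :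
    ContDiffAt ℝ n (rlIntegral (fracOrder j) f) t ∧
      seriesCoeff j f t (3 * n - 1) =
        -rlDeriv n (fracOrder j) f t / ((3 * n - 1).factorial : ℂ) := by
  have h := contDiffAt_rlIntegral_and_rlDeriv_eq hj
    (fun n s hs => hasDerivAt_iteratedDeriv_of_analyticOnNhd_nbhd hr.le hT.le hf n hs) n
    (t := t) ⟨ht.1, by linarith [ht.2]⟩
  refine ⟨h.1, ?_⟩
  rw [h.2, seriesCoeff, if_neg (by omega), if_pos (by omega), show (3 * n - 1 + 1) / 3 = n by omega]

end

end KdV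

end

theorem mainTheorem2 (r T : ℝ) (hr : 0 < r) (hT : 0 < T) :
    (∀ f₀ : ℂ → ℂ, AnalyticOnNhd ℂ f₀ (KdV.nbhd T r) →
      (∀ t ∈ Set.Icc (0 : ℝ) T,
        (∀ x : ℝ, 0 < x → KdV.ConvergesΩ (KdV.integrand 2 f₀ x t)) ∧
        AnalyticOnNhd ℝ (fun x : ℝ => KdV.If₀ f₀ x t) (Set.Ioi 0)) ∧
      (∀ t ∈ Set.Ioc (0 : ℝ) T,
        (∃ S : ℂ → ℂ, Differentiable ℂ S ∧
          (∀ z : ℂ, HasSum (fun j : ℕ => KdV.aCoeff f₀ t j * z ^ j) (S z)) ∧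
          (∀ x : ℝ, 0 < x → KdV.If₀ f₀ x t = S (x : ℂ))) ∧
        (∀ n : ℕ, 1 ≤ n →
          ContDiffAt ℝ n (KdV.rlIntegral (1 / 3) f₀) t ∧
          KdV.aCoeff f₀ t (3 * n - 1) =
            -KdV.rlDeriv n (1 / 3) f₀ t / ((3 * n - 1).factorial : ℂ)))) ∧
    (∀ f₁ : ℂ → ℂ, AnalyticOnNhd ℂ f₁ (KdV.nbhd T r) →
      (∀ t ∈ Set.Icc (0 : ℝ) T,
        (∀ x : ℝ, 0 < x → KdV.ConvergesΩ (KdV.integrand 1 f₁ x t)) ∧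
        AnalyticOnNhd ℝ (fun x : ℝ => KdV.If₁ f₁ x t) (Set.Ioi 0)) ∧
      (∀ t ∈ Set.Ioc (0 : ℝ) T,
        (∃ S : ℂ → ℂ, Differentiable ℂ S ∧
          (∀ z : ℂ, HasSum (fun j : ℕ => KdV.bCoeff f₁ t j * z ^ j) (S z)) ∧
          (∀ x : ℝ, 0 < x → KdV.If₁ f₁ x t = S (x : ℂ))) ∧
        (∀ n : ℕ, 1 ≤ n →
          ContDiffAt ℝ n (KdV.rlIntegral (2 / 3) f₁) t ∧
          KdV.bCoeff f₁ t (3 * n - 1) =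
            -KdV.rlDeriv n (2 / 3) f₁ t / ((3 * n - 1).factorial : ℂ)))) := by
  have h0 : (0 : ℕ) = 0 ∨ (0 : ℕ) = 1 := Or.inl rfl
  have h1 : (1 : ℕ) = 0 ∨ (1 : ℕ) = 1 := Or.inr rfl
  have e0 : (1 / 3 : ℝ) = KdV.fracOrder 0 := by norm_num [KdV.fracOrder]
  have e1 : (2 / 3 : ℝ) = KdV.fracOrder 1 := by norm_num [KdV.fracOrder]
  simp only [KdV.If₀_eq, KdV.If₁_eq, KdV.aCoeff_eq, KdV.bCoeff_eq, e0, e1]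
  exact ⟨fun f hf => ⟨fun t ht => ⟨fun x hx => KdV.convergesΩ_of_analyticOnNhd h0 hr hT hf ht hx,
      KdV.analyticOnNhd_response h0 hr hT hf ht⟩,
      fun t ht => ⟨KdV.exists_entire_response h0 hr hT hf ht,
        fun n hn => KdV.seriesCoeff_eq_rlDeriv h0 hr hT hf ht hn⟩⟩,
    fun f hf => ⟨fun t ht => ⟨fun x hx => KdV.convergesΩ_of_analyticOnNhd h1 hr hT hf ht hx,
      KdV.analyticOnNhd_response h1 hr hT hf ht⟩,
      fun t ht => ⟨KdV.exists_entire_response h1 hr hT hf ht,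
        fun n hn => KdV.seriesCoeff_eq_rlDeriv h1 hr hT hf ht hn⟩⟩⟩
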